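/- **Setting.** Fix $N$ and $p\ge 0$, put $K=p+1$ and assume $N>K$. For each sample size $T$ the $N$-vector of gross returns and the $p$-vector of (misspecified) proxy factors $(r_t,\tilde g_t)_{t}$ are jointly strictly stationary with finite fourth moments; their law may depend on $T$. Let $\tilde G_t=(1,\tilde g_t')'\in\mathbb R^{K}$, $q=\mathbb E(r_t\tilde G_t')$, $Q_T=\mathbb E(\tilde G_t\tilde G_t')$, $B=qQ_T^{-1}$, $\tilde u_t=r_t-B\tilde G_t$, $e(\theta)=\iota_N-q\theta$ and $H=(\iota_N,q)\in\mathbb R^{N\times(K+1)}$ (all possibly depending on $T$). In the sample let $\hat q=T^{-1}\sum r_t\tilde G_t'$, $\hat Q=T^{-1}\sum\tilde G_t\tilde G_t'$, $\hat B=\hat q\hat Q^{-1}$, $\hat Q_r=T^{-1}\sum r_tr_t'$, $e_t(\theta)=\iota_N-r_t\tilde G_t'\theta$, $e_T(\theta)=T^{-1}\sum e_t(\theta)$, $S_T(\theta)=T^{-1}\sum e_t(\theta)e_t(\theta)'$. *Statistics.* $AR(\theta)=T\,e_T(\theta)'S_T(\theta)^{-1}e_T(\theta)$, and $\mathcal J=\inf_\theta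 AR(\theta)$ over all $\theta\in\mathbb R^K$ with $S_T(\theta)$ nonsingular. Let $\Theta\subset\mathbb R^K$ be compact, $\alpha,\alpha_1,\alpha_2\in(0,1)$ with $(1-\alpha_1)(1-\alpha_2)=1-\alpha$, and let $CS$ be the set of $\theta\in\Theta$ with $S_T(\theta)$ nonsingular and $AR(\theta)\le c_{\chi^2_N,1-\alpha_1}$. Let $\hat\delta^*=\inf_{\theta\in CS}e_T(\theta)'\hat Q_r^{-1}e_T(\theta)$ ($=\infty$ if $CS=\emptyset$) and $c^*=\sup_{\theta\in CS}c^*_{1-\alpha_2}(\theta)$ ($=0$ if $CS=\emptyset$), where $c^*_{1-\alpha_2}(\theta)$ is the $1-\alpha_2$ quantile of $\sum_i p_ix_i$, with $x_i$ independent $\chi^2(1)$ variables and $p_i$ the nonzero eigenvalues of $S_T(\theta)^{1/2}\hat Q_r^{-1}S_T(\theta)^{1/2\prime}$. The HJS test rejects if $T\hat\delta^*>c^*$. *Assumptions.* (a) There is $a>0$ with $\|e(\theta)\|>a$ for all $\theta\in\Theta$ and all $T$. (b) $Q_T\to Q$ and $\mathbb E(\tilde u_t\tilde u_t')\to\Sigma$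 with $Q,\Sigma$ positive definite, $\hat Q\to_p Q$, and $\sqrt T\,\mathrm{vec}(\hat B-B)\to_d N(0,Q^{-1}\otimes\Sigma)$. (c) For every $\theta$, $\sqrt T(e_T(\theta)-e(\theta))\to_d N(0,V(\theta))$, where $V(\theta)$ is positive definite for $\theta\ne0$, and $T^{-1}\sum(e_t(\theta)-e_T(\theta))(e_t(\theta)-e_T(\theta))'\to_p V(\theta)$. **Theorem.** Let $k\ge1$ be an integer. (i) (Unidentified model.) Suppose $H$ does not depend on $T$ and has rank $K+1-k$. Let $w$ be the smallest eigenvalue of a central Wishart matrix $\mathcal W_k(N-K-1+k,I_k)$. Then $\mathcal J$ is asymptotically stochastically dominated by $w$, that is $$\limsup_T\mathbb P(\mathcal J\ge x)\le\mathbb P(w\ge x)\quad\text{for all }x\in\mathbb R;$$ moreover $\limsup_T\mathbb P(\mathcal J\ge c_{\chi^2_{N-K},1-\alpha})\le\alpha$ and $\liminf_T\mathbb P(T\hat\delta^*>c^*)=1$. (ii) (Weakly identified model.) Let $Q_x=\mathrm{diag}(I_{K+1-k},\sqrt T I_k)$ and suppose that $HQ_x\to L$ with $L'L$ positive definite. Write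 $L=(L_1,L_2)$ with $L_2$ the last $k$ columns, let $Q_{22}$ be the lower right $k\times k$ block of $Q$, and put $\tilde\mu=\Sigma^{-1/2}L_2Q_{22}^{-1/2}$, $X=\Sigma^{-1/2}L_1$ and $\mu=\tilde\mu'\bigl(I_N-X(X'X)^{-1}X'\bigr)\tilde\mu$. Then $\mathcal J\to_d w$, where $w$ is the smallest eigenvalue of the noncentral Wishart matrix $\mathcal W_k(\mu,N-K-1+k,I_k)$, i.e. of $Y'Y$ where $Y$ is an $(N-K-1+k)\times k$ matrix with independent unit-variance normal entries and $(\mathbb EY)'(\mathbb EY)=\mu$ (such means exist, and the convergence holds for each of them); moreover $\liminf_T\mathbb P(\mathcal J\ge c_{\chi^2_{N-K},1-\alpha})<1$ and $\liminf_T\mathbb P(T\hat\delta^*>c^*)=1$. -/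

import Mathlib

open MeasureTheory ProbabilityTheory Filter Topology Matrix
open scoped ENNReal Kronecker MatrixOrder

noncomputable section

namespace HJSpec

/-! ### Distributions -/

/-- The `p`-quantile of a distribution on the line. -/
def quantile (ν : Measure ℝ) (p : ℝ) : ℝ :=
  sInf {x : ℝ | ENNReal.ofReal p ≤ ν (Set.Iic x)}

/-- The law of `∑ i, w i * x i` with independent `χ²(1)` variables `x i`. -/
def weightedChiSq {ι : Type*} [Fintype ι] (w : ι → ℝ) : Measure ℝ :=
  (Measure.pi fun _ : ι => gaussianReal 0 1).map fun z => ∑ i, w i * z i ^ 2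

/-- The chi-square distribution with `n` degrees of freedom. -/
def chiSq (n : ℕ) : Measure ℝ := weightedChiSq fun _ : Fin n => 1

/-- The law of a matrix with independent entries, the `(i, j)` entry being `N(M i j, 1)`. -/
def gaussianEntries {m ι : Type*} [Fintype m] [Fintype ι] (M : Matrix m ι ℝ) :
    Measure (m → ι → ℝ) :=
  Measure.pi fun i => Measure.pi fun j => gaussianReal (M i j) 1

instance {m ι : Type*} [Fintype m] [Fintype ι] (M : Matrix m ι ℝ) :
    IsProbabilityMeasure (gaussianEntries M) := by
  have h : ∀ i, IsProbabilityMeasure (Measure.pi fun j => gaussianReal (M i j) 1) :=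
    fun i => inferInstance
  unfold gaussianEntries
  infer_instance

/-- The smallest eigenvalue of a (symmetric) matrix. -/
def minEigenvalue {ι : Type*} [Fintype ι] [DecidableEq ι] (A : Matrix ι ι ℝ) : ℝ :=
  sInf (spectrum ℝ A)

/-- The Wishart matrix `Xᵀ X` built from an `n × k` matrix `X`. If `X` has law
`gaussianEntries M`, with `M` of size `n × k`, then `wishart X` has the Wishart distribution with
`n` degrees of freedom, scale matrix `I_k` and noncentrality (location) matrix `Mᵀ M`; it is
central for `M = 0`. -/
def wishart {m ι : Type*} [Fintype m] (X : m → ι → ℝ) : Matrix ι ι ℝ :=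
  (Matrix.of X)ᵀ * Matrix.of X

/-! ### Sample quantities

A realised sample is a sequence of returns `x t ∈ ℝᴺ` and of proxies `y t ∈ ℝᵖ`; the sample of
size `T` consists of the observations `t < T`. -/

section Sample

variable {N p : ℕ}

/-- `G = (1, g')'`. -/
def aug (y : Fin p → ℝ) : Fin (p + 1) → ℝ := Fin.cons 1 y

/-- `q_{G,T} = T⁻¹ ∑ r_t G_t'`. -/
def qHat (x : ℕ → Fin N → ℝ) (y : ℕ → Fin p → ℝ) (T : ℕ) : Matrix (Fin N) (Fin (p + 1)) ℝ :=
  (T : ℝ)⁻¹ • ∑ t ∈ Finset.range T, vecMulVec (x t) (aug (y t))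

/-- `Q̂_G = T⁻¹ ∑ G_t G_t'`. -/
def QGHat (y : ℕ → Fin p → ℝ) (T : ℕ) : Matrix (Fin (p + 1)) (Fin (p + 1)) ℝ :=
  (T : ℝ)⁻¹ • ∑ t ∈ Finset.range T, vecMulVec (aug (y t)) (aug (y t))

/-- `Q̂_r = T⁻¹ ∑ r_t r_t'`. -/
def QrHat (x : ℕ → Fin N → ℝ) (T : ℕ) : Matrix (Fin N) (Fin N) ℝ :=
  (T : ℝ)⁻¹ • ∑ t ∈ Finset.range T, vecMulVec (x t) (x t)

/-- `B̂ = q_{G,T} Q̂_G⁻¹`. -/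
def BHat (x : ℕ → Fin N → ℝ) (y : ℕ → Fin p → ℝ) (T : ℕ) : Matrix (Fin N) (Fin (p + 1)) ℝ :=
  qHat x y T * (QGHat y T)⁻¹

/-- `e_t(θ) = ι - r_t G_t' θ`. -/
def errAt (x : ℕ → Fin N → ℝ) (y : ℕ → Fin p → ℝ) (t : ℕ) (θ : Fin (p + 1) → ℝ) : Fin N → ℝ :=
  (fun _ => 1) - (aug (y t) ⬝ᵥ θ) • x t

/-- `e_T(θ) = ι - q_{G,T} θ`, the average of the `e_t(θ)`. -/
def errBar (x : ℕ → Fin N → ℝ) (y : ℕ → Fin p → ℝ) (T : ℕ) (θ : Fin (p + 1) → ℝ) : Fin N → ℝ :=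
  (fun _ => 1) - qHat x y T *ᵥ θ

/-- `S_T(θ) = T⁻¹ ∑ e_t(θ) e_t(θ)'`. -/
def SHat (x : ℕ → Fin N → ℝ) (y : ℕ → Fin p → ℝ) (T : ℕ) (θ : Fin (p + 1) → ℝ) :
    Matrix (Fin N) (Fin N) ℝ :=
  (T : ℝ)⁻¹ • ∑ t ∈ Finset.range T, vecMulVec (errAt x y t θ) (errAt x y t θ)

/-- The sample covariance matrix `T⁻¹ ∑ (e_t(θ) - e_T(θ)) (e_t(θ) - e_T(θ))'`. -/
def covHat (x : ℕ → Fin N → ℝ) (y : ℕ → Fin p → ℝ) (T : ℕ) (θ : Fin (p + 1) → ℝ) :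
    Matrix (Fin N) (Fin N) ℝ :=
  (T : ℝ)⁻¹ • ∑ t ∈ Finset.range T,
    vecMulVec (errAt x y t θ - errBar x y T θ) (errAt x y t θ - errBar x y T θ)

/-- `AR(θ) = T e_T(θ)' S_T(θ)⁻¹ e_T(θ)`; only used where `S_T(θ)` is invertible. -/
def AR (x : ℕ → Fin N → ℝ) (y : ℕ → Fin p → ℝ) (T : ℕ) (θ : Fin (p + 1) → ℝ) : ℝ :=
  T * (errBar x y T θ ⬝ᵥ (SHat x y T θ)⁻¹ *ᵥ errBar x y T θ)

/-- `J = inf_θ AR(θ)`, over all parameter values at which `AR` is defined. -/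
def Jstat (x : ℕ → Fin N → ℝ) (y : ℕ → Fin p → ℝ) (T : ℕ) : ℝ :=
  sInf {v : ℝ | ∃ θ : Fin (p + 1) → ℝ, IsUnit (SHat x y T θ).det ∧ v = AR x y T θ}

/-- The robust confidence set `{θ ∈ Θ : AR(θ) ≤ c_{1-α₁}}`, where `c_{1-α₁}` is a quantile of
`χ²(N)`. -/
def confSet (Θ : Set (Fin (p + 1) → ℝ)) (α₁ : ℝ)
    (x : ℕ → Fin N → ℝ) (y : ℕ → Fin p → ℝ) (T : ℕ) : Set (Fin (p + 1) → ℝ) :=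
  {θ | θ ∈ Θ ∧ IsUnit (SHat x y T θ).det ∧ AR x y T θ ≤ quantile (chiSq N) (1 - α₁)}

/-- `δ_T(θ) = e_T(θ)' Q̂_r⁻¹ e_T(θ)`. -/
def hjDist (x : ℕ → Fin N → ℝ) (y : ℕ → Fin p → ℝ) (T : ℕ) (θ : Fin (p + 1) → ℝ) : ℝ :=
  errBar x y T θ ⬝ᵥ (QrHat x T)⁻¹ *ᵥ errBar x y T θ

/-- The HJS statistic: the infimum of `δ_T` over the confidence set, `∞` if the set is empty. -/
def hjsStat (Θ : Set (Fin (p + 1) → ℝ)) (α₁ : ℝ)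
    (x : ℕ → Fin N → ℝ) (y : ℕ → Fin p → ℝ) (T : ℕ) : ℝ≥0∞ :=
  ⨅ θ ∈ confSet Θ α₁ x y T, ENNReal.ofReal (hjDist x y T θ)

/-- `S_T(θ)^{1/2} Q̂_r⁻¹ (S_T(θ)^{1/2})'`. -/
def weightMatrix (x : ℕ → Fin N → ℝ) (y : ℕ → Fin p → ℝ) (T : ℕ) (θ : Fin (p + 1) → ℝ) :
    Matrix (Fin N) (Fin N) ℝ :=
  CFC.sqrt (SHat x y T θ) * (QrHat x T)⁻¹ * (CFC.sqrt (SHat x y T θ))ᴴ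

lemma QrHat_isHermitian (x : ℕ → Fin N → ℝ) (T : ℕ) : (QrHat x T).IsHermitian := by
  ext i j
  simp [QrHat, Matrix.sum_apply, vecMulVec_apply, mul_comm]

lemma weightMatrix_isHermitian (x : ℕ → Fin N → ℝ) (y : ℕ → Fin p → ℝ) (T : ℕ)
    (θ : Fin (p + 1) → ℝ) : (weightMatrix x y T θ).IsHermitian :=
  isHermitian_mul_mul_conjTranspose _ (QrHat_isHermitian x T).inv

/-- The `1 - α₂` quantile of the weighted sum of independent `χ²(1)` variables, with the
eigenvalues of `weightMatrix` as weights (a zero eigenvalue contributes nothing). -/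
def hjsCritAt (α₂ : ℝ) (x : ℕ → Fin N → ℝ) (y : ℕ → Fin p → ℝ) (T : ℕ)
    (θ : Fin (p + 1) → ℝ) : ℝ :=
  quantile (weightedChiSq (weightMatrix_isHermitian x y T θ).eigenvalues) (1 - α₂)

/-- The HJS critical value: the supremum of `hjsCritAt` over the confidence set. -/
def hjsCrit (Θ : Set (Fin (p + 1) → ℝ)) (α₁ α₂ : ℝ)
    (x : ℕ → Fin N → ℝ) (y : ℕ → Fin p → ℝ) (T : ℕ) : ℝ≥0∞ :=
  ⨆ θ ∈ confSet Θ α₁ x y T, ENNReal.ofReal (hjsCritAt α₂ x y T θ)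

/-- The HJS test rejects when `T` times the HJS statistic exceeds the critical value. -/
def HJSRejects (Θ : Set (Fin (p + 1) → ℝ)) (α₁ α₂ : ℝ)
    (x : ℕ → Fin N → ℝ) (y : ℕ → Fin p → ℝ) (T : ℕ) : Prop :=
  hjsCrit Θ α₁ α₂ x y T < (T : ℝ≥0∞) * hjsStat Θ α₁ x y T

end Sample

/-! ### Population quantities

The data may depend on the sample size: `r T t` and `g T t` are the returns and the proxies of
period `t` in the model that governs the sample of size `T`. By stationarity moments do not
depend on `t` and are taken at `t = 0`. -/

section Population

variable {Ω : Type*} [MeasurableSpace Ω] {N p : ℕ}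

/-- `q_G = E(r_t G_t')`. -/
def qPop (P : Measure Ω) (r : ℕ → Ω → Fin N → ℝ) (g : ℕ → Ω → Fin p → ℝ) :
    Matrix (Fin N) (Fin (p + 1)) ℝ :=
  Matrix.of fun i j => ∫ ω, r 0 ω i * aug (g 0 ω) j ∂P

/-- `Q_G = E(G_t G_t')`. -/
def QGPop (P : Measure Ω) (g : ℕ → Ω → Fin p → ℝ) : Matrix (Fin (p + 1)) (Fin (p + 1)) ℝ :=
  Matrix.of fun i j => ∫ ω, aug (g 0 ω) i * aug (g 0 ω) j ∂P

/-- `B = q_G Q_G⁻¹`, the coefficients of the linear projection of `r_t` on `G_t`. -/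
def BPop (P : Measure Ω) (r : ℕ → Ω → Fin N → ℝ) (g : ℕ → Ω → Fin p → ℝ) :
    Matrix (Fin N) (Fin (p + 1)) ℝ :=
  qPop P r g * (QGPop P g)⁻¹

/-- The projection error `ũ_t = r_t - B G_t`. -/
def resid (P : Measure Ω) (r : ℕ → Ω → Fin N → ℝ) (g : ℕ → Ω → Fin p → ℝ) (ω : Ω) :
    Fin N → ℝ :=
  r 0 ω - BPop P r g *ᵥ aug (g 0 ω)

/-- The covariance matrix of the projection error `ũ_t` (which has mean zero, since `G_t`
contains a constant). -/
def residCov (P : Measure Ω) (r : ℕ → Ω → Fin N → ℝ) (g : ℕ → Ω → Fin p → ℝ) :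
    Matrix (Fin N) (Fin N) ℝ :=
  Matrix.of fun i j => ∫ ω, resid P r g ω i * resid P r g ω j ∂P

/-- The population pricing errors `e(θ) = ι - q_G θ`. -/
def errPop (P : Measure Ω) (r : ℕ → Ω → Fin N → ℝ) (g : ℕ → Ω → Fin p → ℝ)
    (θ : Fin (p + 1) → ℝ) : Fin N → ℝ :=
  (fun _ => 1) - qPop P r g *ᵥ θ

/-- `H = (ι, q_G)`. -/
def Hmat (P : Measure Ω) (r : ℕ → Ω → Fin N → ℝ) (g : ℕ → Ω → Fin p → ℝ) :
    Matrix (Fin N) (Fin (p + 2)) ℝ :=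
  Matrix.of fun i => Fin.cons 1 (qPop P r g i)

/-- Returns and proxies are jointly strictly stationary with finite fourth moments. -/
structure StationaryData (P : Measure Ω) (r : ℕ → Ω → Fin N → ℝ) (g : ℕ → Ω → Fin p → ℝ) :
    Prop where
  measurable_r : ∀ t, Measurable (r t)
  measurable_g : ∀ t, Measurable (g t)
  stationary : P.map (fun ω t => (r (t + 1) ω, g (t + 1) ω)) = P.map (fun ω t => (r t ω, g t ω))
  memLp_r : ∀ t i, MemLp (fun ω => r t ω i) 4 P
  memLp_g : ∀ t j, MemLp (fun ω => g t ω j) 4 P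

/-- The limits of `Q_G` and of the covariance matrix of `ũ_t` exist and are positive definite
(in particular, when these matrices do not depend on `T`), `Q̂_G` is consistent, and
`ψ_B = √T (B̂ - B)` satisfies `vec(ψ_B) → N(0, Q_G⁻¹ ⊗ Σ)` in distribution. -/
structure HomoskedasticLimit (P : Measure Ω) [IsProbabilityMeasure P]
    (r : ℕ → ℕ → Ω → Fin N → ℝ) (g : ℕ → ℕ → Ω → Fin p → ℝ)
    (Q : Matrix (Fin (p + 1)) (Fin (p + 1)) ℝ) (Sig : Matrix (Fin N) (Fin N) ℝ) : Prop where
  posDef_Q : Q.PosDef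
  posDef_Sig : Sig.PosDef
  tendsto_Q : Tendsto (fun T => QGPop P (g T)) atTop (𝓝 Q)
  tendsto_Sig : Tendsto (fun T => residCov P (r T) (g T)) atTop (𝓝 Sig)
  consistent_Q : ∀ i j, TendstoInMeasure P
    (fun (T : ℕ) ω => QGHat (fun t => g T t ω) T i j) atTop (fun _ => Q i j)
  tendsto_psi : TendstoInDistribution
    (fun (T : ℕ) ω => WithLp.toLp 2
      (√(T : ℝ) • vec (BHat (fun t => r T t ω) (fun t => g T t ω) T - BPop P (r T) (g T))))
    atTop (id : EuclideanSpace ℝ (Fin (p + 1) × Fin N) → _) (fun _ => P)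
    (multivariateGaussian 0 (Q⁻¹ ⊗ₖ Sig))

/-- `V θ` is the long-run covariance matrix of the sample pricing errors, that is the asymptotic
covariance matrix of `√T (e_T(θ) - e(θ))`; it is nonsingular for `θ ≠ 0` (at `θ = 0` the pricing
errors are not random), and the sample covariance matrix of the `e_t(θ)` estimates it
consistently. -/
structure ConsistentVariance (P : Measure Ω) [IsProbabilityMeasure P]
    (r : ℕ → ℕ → Ω → Fin N → ℝ) (g : ℕ → ℕ → Ω → Fin p → ℝ)
    (V : (Fin (p + 1) → ℝ) → Matrix (Fin N) (Fin N) ℝ) : Prop where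
  posDef : ∀ θ, θ ≠ 0 → (V θ).PosDef
  tendsto_err : ∀ θ, TendstoInDistribution
    (fun (T : ℕ) ω => WithLp.toLp 2
      (√(T : ℝ) • (errBar (fun t => r T t ω) (fun t => g T t ω) T θ - errPop P (r T) (g T) θ)))
    atTop (id : EuclideanSpace ℝ (Fin N) → _) (fun _ => P) (multivariateGaussian 0 (V θ))
  consistent : ∀ θ i j, TendstoInMeasure P
    (fun (T : ℕ) ω => covHat (fun t => r T t ω) (fun t => g T t ω) T θ i j)
    atTop (fun _ => V θ i j)

/-- `Q_x = diag(I_{K+1-k}, √T I_k)`, where `K + 1 = p + 2`. -/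
def Qx (p k T : ℕ) : Matrix (Fin (p + 2)) (Fin (p + 2)) ℝ :=
  diagonal fun j => if (j : ℕ) < p + 2 - k then 1 else √(T : ℝ)

/-- The indices of the first `K + 1 - k` columns of `H`. -/
abbrev Strong (p k : ℕ) : Type := {j : Fin (p + 2) // (j : ℕ) < p + 2 - k}

/-- The indices of the last `k` components of `G`. -/
abbrev Weak (p k : ℕ) : Type := {j : Fin (p + 1) // p + 1 - k ≤ (j : ℕ)}

/-- The projection `M_X = I - X (X'X)⁻¹ X'` onto the orthogonal complement of the columns. -/
def annihilator {ι : Type*} [Fintype ι] [DecidableEq ι] (X : Matrix (Fin N) ι ℝ) :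
    Matrix (Fin N) (Fin N) ℝ :=
  1 - X * (Xᵀ * X)⁻¹ * Xᵀ

/-- The noncentrality matrix `μ = μ̃' M_X μ̃`. With `L = lim H Q_x = (L₁, L₂)`, where `L₂` holds
the last `k` columns, `μ̃ = Σ^{-1/2} L₂ Q₂₂^{-1/2}` and `X = Σ^{-1/2} L₁`, where `Q₂₂` is the
lower right `k × k` block of `Q_G`. -/
def noncentrality (k : ℕ) (Q : Matrix (Fin (p + 1)) (Fin (p + 1)) ℝ)
    (Sig : Matrix (Fin N) (Fin N) ℝ) (L : Matrix (Fin N) (Fin (p + 2)) ℝ) :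
    Matrix (Weak p k) (Weak p k) ℝ :=
  let L₁ : Matrix (Fin N) (Strong p k) ℝ := L.submatrix id Subtype.val
  let L₂ : Matrix (Fin N) (Weak p k) ℝ := L.submatrix id fun j => j.val.succ
  let Q₂₂ : Matrix (Weak p k) (Weak p k) ℝ := Q.submatrix Subtype.val Subtype.val
  let muTilde := CFC.sqrt Sig⁻¹ * L₂ * CFC.sqrt Q₂₂⁻¹
  muTildeᵀ * annihilator (CFC.sqrt Sig⁻¹ * L₁) * muTilde

end Population

end HJSpec

end

/-! The data enter through `Ψ = √T (B̂ - B)`, the matrix `Q̂` and the sample covariance of the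
pricing errors. The covariance is a quadratic map of `θ`, so finitely many of its values determine
it, and pointwise consistency becomes convergence of the whole family. `Ψ` has a matrix normal
limit; the other two converge in probability to constants. An extended continuous mapping theorem
(`limsup_measure_le_of_eventually`, `tendstoInDistribution_of_eventually`) then reduces the
asymptotic claims about `J` and the HJS test to deterministic limits along these data.

For `J`, pass to homogeneous coordinates `v` with `θ = -v₀⁻¹ Q̂⁻¹ Q_T tail(v)`. Then `AR(θ) = b' S⁻¹
b` with `b = √T H v + Ψ Q_T tail(v)`, where `S` is a second moment matrix and the value does not
change when `v` is rescaled. Write `v = T^{-1/2} Cs w + Cw z`, with `Cs` spanning strongly and `Cw`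
weakly identified directions: a complement and the kernel of `H` in (i), coordinate vectors in (ii);
`WeakLimit` covers both. Now `b` tends to `L₁ w + (L₂ + Ψ Q tail(Cw)) z` and `S` to `V(tail(Cw) z)`.
Although the parameter space is not compact, scale invariance leaves only the unit sphere of pairs
`(w, z)`. Where `z = 0` the limit of `S` vanishes, but the dual bound `b' S⁻¹ b ≥ 2 d'b - d'Sd`
survives and can be made arbitrarily large.

Minimizing the limit over `w` restricts the dual variable `d` to the orthogonal complement of the
columns of `L₁`. There `V(φ)` acts as `(φ'Qφ) Σ`, because (b) and (c) give two limit laws for one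
and the same statistic (`WeakLimit.dotProduct_mulVec_eq`). What remains is a Rayleigh quotient of
`Y'Y`, where `Y` has independent unit-variance normal entries; its minimum over `z` is the smallest
Wishart eigenvalue (`tendstoInDistribution_Jstat`).

For the size bound in (i), evaluate the Wishart form at a unit vector orthogonal to `k - 1` of the
rows: this leaves a `χ²` variable with `N - K` degrees of freedom. In (ii) the smallest eigenvalue
lies below any positive level with positive probability, so the `J` test fails to be consistent. The
HJS test rejects eventually because, uniformly on the compact `Θ`, the distance stays away from zero
and the critical values stay bounded, while the statistic carries a factor `T`. -/

noncomputable section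

namespace HJSpec

/-! ### Convergence in probability and an extended continuous mapping theorem -/

section Convergence

variable {Ω : Type*} [MeasurableSpace Ω] {P : Measure Ω}

/-- Convergence in (outer) probability to a constant; no measurability is required. -/
def ConvProb {F : Type*} [TopologicalSpace F] (P : Measure Ω) (Y : ℕ → Ω → F) (c : F) : Prop :=
  ∀ U ∈ 𝓝 c, Tendsto (fun T => P {ω | Y T ω ∉ U}) atTop (𝓝 0)

lemma ConvProb.of_tendstoInMeasure {Y : ℕ → Ω → ℝ} {c : ℝ}
    (h : TendstoInMeasure P Y atTop fun _ => c) : ConvProb P Y c := by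
  intro U hU
  obtain ⟨ε, hε, hb⟩ := EMetric.mem_nhds_iff.1 hU
  refine tendsto_of_tendsto_of_tendsto_of_le_of_le tendsto_const_nhds (h ε hε)
    (fun _ => zero_le) fun T => measure_mono fun ω hω => ?_
  by_contra hlt
  exact hω (hb (by simpa using hlt))

lemma ConvProb.prodMk {F G : Type*} [TopologicalSpace F] [TopologicalSpace G]
    {Y : ℕ → Ω → F} {Y' : ℕ → Ω → G} {c : F} {c' : G}
    (h : ConvProb P Y c) (h' : ConvProb P Y' c') :
    ConvProb P (fun T ω => (Y T ω, Y' T ω)) (c, c') := by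
  intro U hU
  obtain ⟨V, hV, W, hW, hVW⟩ := mem_nhds_prod_iff.1 hU
  have h0 := (h V hV).add (h' W hW)
  rw [add_zero] at h0
  refine tendsto_of_tendsto_of_tendsto_of_le_of_le tendsto_const_nhds h0
    (fun _ => zero_le) fun T => ?_
  refine (measure_mono ?_).trans (measure_union_le {ω | Y T ω ∉ V} {ω | Y' T ω ∉ W})
  intro ω hω
  by_contra hn
  simp only [Set.mem_union, Set.mem_ofPred_eq, not_or, not_not] at hn
  exact hω (hVW ⟨hn.1, hn.2⟩)

lemma ConvProb.pi {ι : Type*} [Finite ι] {F : ι → Type*} [∀ i, TopologicalSpace (F i)]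
    {Y : ℕ → Ω → ∀ i, F i} {c : ∀ i, F i}
    (h : ∀ i, ConvProb P (fun T ω => Y T ω i) (c i)) : ConvProb P Y c := by
  intro U hU
  have := Fintype.ofFinite ι
  rw [nhds_pi, Filter.mem_pi'] at hU
  obtain ⟨I, t, ht, htU⟩ := hU
  have h0 := tendsto_finsetSum (Finset.univ : Finset ι) fun i _ => h i (t i) (ht i)
  rw [Finset.sum_const_zero] at h0
  refine tendsto_of_tendsto_of_tendsto_of_le_of_le tendsto_const_nhds h0
    (fun _ => zero_le) fun T => ?_
  refine (measure_mono ?_).trans (measure_iUnion_fintype_le P fun i => {ω | Y T ω i ∉ t i})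
  intro ω hω
  by_contra hn
  simp only [Set.mem_iUnion, Set.mem_ofPred_eq, not_exists, not_not] at hn
  exact hω (htU fun i _ => hn i)

lemma ConvProb.unique [IsProbabilityMeasure P] {Y : ℕ → Ω → ℝ} {c c' : ℝ}
    (h : ConvProb P Y c) (h' : ConvProb P Y c') : c = c' := by
  by_contra hne
  obtain ⟨U, V, hU, hV, hc, hc', hd⟩ := t2_separation hne
  have h0 := (h U (hU.mem_nhds hc)).add (h' V (hV.mem_nhds hc'))
  rw [add_zero] at h0
  have h1 : ∀ T, (1 : ℝ≥0∞) ≤ P {ω | Y T ω ∉ U} + P {ω | Y T ω ∉ V} := fun T => by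
    rw [← measure_univ (μ := P)]
    refine (measure_mono fun ω _ => ?_).trans (measure_union_le _ _)
    by_contra hn
    simp only [Set.mem_union, Set.mem_ofPred_eq, not_or, not_not] at hn
    exact Set.disjoint_left.1 hd hn.1 hn.2
  have := ge_of_tendsto' h0 h1
  simp at this

variable [IsProbabilityMeasure P] {Ω' : Type*} [MeasurableSpace Ω'] {P' : Measure Ω'}
  [IsProbabilityMeasure P'] {E F : Type*} [TopologicalSpace E] [MeasurableSpace E] [BorelSpace E]
  [HasOuterApproxClosed E] [TopologicalSpace F] [FirstCountableTopology F]

/-- A uniform version of the portmanteau theorem. -/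
theorem limsup_measure_le_of_eventually {X : ℕ → Ω → E} {Z : Ω' → E}
    (hX : TendstoInDistribution X atTop Z (fun _ => P) P') {Y : ℕ → Ω → F} {c : F}
    (hY : ConvProb P Y c) (B : ℕ → Set Ω) (A : Set Ω')
    (h : ∀ ω', ω' ∉ A → ∀ᶠ z : ℕ × E × F in atTop ×ˢ 𝓝 (Z ω') ×ˢ 𝓝 c,
      ∀ ω, X z.1 ω = z.2.1 → Y z.1 ω = z.2.2 → ω ∉ B z.1) :
    limsup (fun T => P (B T)) atTop ≤ P' A := by
  obtain ⟨U, hU⟩ := (𝓝 c).exists_antitone_basis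
  -- For `T ≥ n` the event `B T` is contained in `{X T ∈ G n} ∪ {Y T ∉ U n}`, and the second event
  -- is negligible. Taking closures makes the portmanteau theorem applicable for each fixed `n`; the
  -- hypothesis is what forces `ω' ∈ A` whenever `Z ω'` lies in all the `G n`.
  let G : ℕ → Set E := fun n => closure {x | ∃ s ≥ n, ∃ ω ∈ B s, X s ω = x ∧ Y s ω ∈ U n}
  have hGc : ∀ n, IsClosed (G n) := fun n => isClosed_closure
  have hGa : Antitone G := by
    intro n n' hn
    refine closure_mono ?_
    rintro x ⟨s, hs, ω, hω, hx, hy⟩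
    exact ⟨s, hn.trans hs, ω, hω, hx, hU.2 hn hy⟩
  have h1 : ∀ n, limsup (fun T => P (B T)) atTop ≤ P'.map Z (G n) := by
    intro n
    have hcl := ProbabilityMeasure.limsup_measure_closed_le_of_tendsto hX.tendsto (hGc n)
    simp only [ProbabilityMeasure.coe_mk] at hcl
    calc limsup (fun T => P (B T)) atTop
        ≤ limsup (fun T => P.map (X T) (G n) + P {ω | Y T ω ∉ U n}) atTop := by
          refine limsup_le_limsup ?_
          filter_upwards [eventually_ge_atTop n] with T hT
          rw [Measure.map_apply_of_aemeasurable (hX.forall_aemeasurable T) (hGc n).measurableSet]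
          refine (measure_mono fun ω hω => ?_).trans (measure_union_le _ _)
          by_cases hy : Y T ω ∈ U n
          · exact Or.inl (subset_closure ⟨T, hT, ω, hω, rfl, hy⟩)
          · exact Or.inr hy
      _ = limsup (fun T => P.map (X T) (G n)) atTop :=
          ENNReal.limsup_add_of_right_tendsto_zero (hY _ (hU.1.mem_of_mem trivial)) _
      _ ≤ _ := hcl
  have h2 : Tendsto (fun n => P'.map Z (G n)) atTop (𝓝 (P'.map Z (⋂ n, G n))) := by
    have : IsProbabilityMeasure (P'.map Z) := Measure.isProbabilityMeasure_map hX.aemeasurable_limit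
    exact tendsto_measure_iInter_atTop (fun n => (hGc n).measurableSet.nullMeasurableSet) hGa
      ⟨0, measure_ne_top _ _⟩
  refine (ge_of_tendsto' h2 h1).trans ?_
  rw [Measure.map_apply_of_aemeasurable hX.aemeasurable_limit
    (isClosed_iInter hGc).measurableSet]
  refine measure_mono fun ω' hω' => ?_
  by_contra hA
  have hev := h ω' hA
  rw [Filter.eventually_prod_iff] at hev
  obtain ⟨pa, hpa, pb, hpb, hab⟩ := hev
  rw [Filter.eventually_prod_iff] at hpb
  obtain ⟨pc, hpc, pd, hpd, hcd⟩ := hpb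
  obtain ⟨n₁, hn₁⟩ := eventually_atTop.1 hpa
  obtain ⟨n₂, -, hn₂⟩ := hU.1.mem_iff.1 hpd
  have hm := Set.mem_iInter.1 hω' (max n₁ n₂)
  obtain ⟨x, hx1, s, hs, ω, hω, hx2, hy⟩ := mem_closure_iff_nhds.1 hm _ hpc
  exact hab (hn₁ s ((le_max_left _ _).trans hs)) (hcd hx1 (hn₂ (hU.2 (le_max_right n₁ n₂) hy)))
    ω hx2 rfl hω

/-- The extended continuous mapping theorem. -/
theorem tendstoInDistribution_of_eventually {X : ℕ → Ω → E} {Z : Ω' → E}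
    (hX : TendstoInDistribution X atTop Z (fun _ => P) P') {Y : ℕ → Ω → F} {c : F}
    (hY : ConvProb P Y c) {W : ℕ → Ω → ℝ} {w : Ω' → ℝ} (hW : ∀ T, AEMeasurable (W T) P)
    (hw : AEMeasurable w P')
    (h : ∀ ω', ∀ V ∈ 𝓝 (w ω'), ∀ᶠ z : ℕ × E × F in atTop ×ˢ 𝓝 (Z ω') ×ˢ 𝓝 c,
      ∀ ω, X z.1 ω = z.2.1 → Y z.1 ω = z.2.2 → W z.1 ω ∈ V) :
    TendstoInDistribution W atTop w (fun _ => P) P' where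
  forall_aemeasurable := hW
  aemeasurable_limit := hw
  tendsto := by
    refine tendsto_of_forall_isClosed_limsup_le' fun C hC => ?_
    simp only [ProbabilityMeasure.coe_mk]
    rw [Measure.map_apply_of_aemeasurable hw hC.measurableSet]
    simp_rw [fun T => Measure.map_apply_of_aemeasurable (hW T) hC.measurableSet]
    refine limsup_measure_le_of_eventually hX hY _ _ fun ω' hω' => ?_
    filter_upwards [h ω' Cᶜ (hC.isOpen_compl.mem_nhds hω')] with z hz ω h1 h2 h3
    exact hz ω h1 h2 h3

end Convergence

/-! ### Dual form of inverse quadratic forms, smallest eigenvalues, orthogonal factors -/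

section LinearAlgebra

/-- Nonnegativity of the form of `S` at `y - S⁻¹ b`. The left side contains no inverse, so for fixed
`y` it passes to limits in which `S` becomes singular. -/
lemma two_mul_dotProduct_sub_le {n : Type*} [Fintype n] [DecidableEq n] {S : Matrix n n ℝ}
    (hS : S.PosSemidef) (hu : IsUnit S.det) (y b : n → ℝ) :
    2 * (y ⬝ᵥ b) - y ⬝ᵥ S *ᵥ y ≤ b ⬝ᵥ S⁻¹ *ᵥ b := by
  have hT : Sᵀ = S := by simpa using hS.isHermitian.eq
  have h := hS.dotProduct_mulVec_nonneg (y - S⁻¹ *ᵥ b)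
  have hb : S *ᵥ S⁻¹ *ᵥ b = b := by
    rw [mulVec_mulVec, mul_nonsing_inv S hu, one_mulVec]
  have hs : (S⁻¹ *ᵥ b) ⬝ᵥ S *ᵥ y = y ⬝ᵥ b := by
    rw [dotProduct_mulVec, ← mulVec_transpose, hT, hb, dotProduct_comm]
  rw [star_trivial, mulVec_sub, sub_dotProduct, dotProduct_sub, dotProduct_sub, hb, hs,
    dotProduct_comm (S⁻¹ *ᵥ b) b] at h
  linarith

/-- The case of equality in the dual bound, attained at `y = S⁻¹ b`. -/
lemma dotProduct_inv_mulVec_eq {n : Type*} [Fintype n] [DecidableEq n] {S : Matrix n n ℝ}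
    (hu : IsUnit S.det) (b : n → ℝ) :
    b ⬝ᵥ S⁻¹ *ᵥ b = 2 * ((S⁻¹ *ᵥ b) ⬝ᵥ b) - (S⁻¹ *ᵥ b) ⬝ᵥ S *ᵥ (S⁻¹ *ᵥ b) := by
  rw [mulVec_mulVec, mul_nonsing_inv S hu, one_mulVec, dotProduct_comm]
  ring

lemma isHermitian_wishart {m ι : Type*} [Fintype m] (X : m → ι → ℝ) :
    (wishart X).IsHermitian := by
  simpa [wishart] using isHermitian_conjTranspose_mul_self (Matrix.of X)

lemma dotProduct_wishart {m ι : Type*} [Fintype m] [Fintype ι] (X : m → ι → ℝ) (c : ι → ℝ) :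
    c ⬝ᵥ wishart X *ᵥ c = (Matrix.of X *ᵥ c) ⬝ᵥ (Matrix.of X *ᵥ c) := by
  rw [wishart, ← mulVec_mulVec, dotProduct_mulVec, vecMul_transpose]

section MinEigenvalue

variable {ι : Type*} [Fintype ι] [DecidableEq ι]

lemma minEigenvalue_mul_le {A : Matrix ι ι ℝ} (hA : A.IsHermitian) (c : ι → ℝ) :
    minEigenvalue A * (c ⬝ᵥ c) ≤ c ⬝ᵥ A *ᵥ c := by
  have hfin : (spectrum ℝ A).Finite := Matrix.finite_real_spectrum
  have hps : (A - minEigenvalue A • (1 : Matrix ι ι ℝ)).PosSemidef := by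
    rw [Matrix.posSemidef_iff_isHermitian_and_spectrum_nonneg]
    refine ⟨hA.sub ?_, ?_⟩
    · rw [IsHermitian, conjTranspose_smul]; simp
    · intro a ha
      have h1 : a + minEigenvalue A ∈ spectrum ℝ A := by
        have h2 := spectrum.add_mem_add_iff (R := ℝ) (a := A - minEigenvalue A • (1 : Matrix ι ι ℝ))
          (r := a) (s := minEigenvalue A)
        rw [Algebra.algebraMap_eq_smul_one, add_sub_cancel] at h2
        exact h2.2 ha
      have h2 : minEigenvalue A ≤ a + minEigenvalue A := csInf_le hfin.bddBelow h1
      simpa using h2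
  have h := hps.dotProduct_mulVec_nonneg c
  rw [star_trivial, sub_mulVec, dotProduct_sub, smul_mulVec, one_mulVec, dotProduct_smul,
    smul_eq_mul] at h
  linarith

variable [Nonempty ι]

lemma exists_dotProduct_eq_minEigenvalue {A : Matrix ι ι ℝ} (hA : A.IsHermitian) :
    ∃ c : ι → ℝ, c ⬝ᵥ c = 1 ∧ c ⬝ᵥ A *ᵥ c = minEigenvalue A := by
  have hfin : (spectrum ℝ A).Finite := Matrix.finite_real_spectrum
  have hne : (spectrum ℝ A).Nonempty := by
    rw [hA.spectrum_real_eq_range_eigenvalues]; exact Set.range_nonempty _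
  have hmem : minEigenvalue A ∈ spectrum ℝ A := hne.csInf_mem hfin
  rw [hA.spectrum_real_eq_range_eigenvalues] at hmem
  obtain ⟨i, hi⟩ := hmem
  refine ⟨(hA.eigenvectorBasis i : ι → ℝ), ?_, ?_⟩
  · have h := hA.eigenvectorBasis.orthonormal.1 i
    have h2 := EuclideanSpace.real_norm_sq_eq (hA.eigenvectorBasis i)
    rw [h] at h2
    simp only [dotProduct, ← pow_two]
    linarith
  · rw [hA.mulVec_eigenvectorBasis, dotProduct_smul, hi]
    have h := hA.eigenvectorBasis.orthonormal.1 i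
    have h2 := EuclideanSpace.real_norm_sq_eq (hA.eigenvectorBasis i)
    rw [h] at h2
    simp only [dotProduct, ← pow_two, smul_eq_mul]
    rw [← h2]; simp

/-- Turns the spectral definition into an infimum over a compact set that does not depend on `A`;
continuity in the matrix follows from this. -/
lemma minEigenvalue_eq_sInf {A : Matrix ι ι ℝ} (hA : A.IsHermitian) :
    minEigenvalue A = sInf ((fun c : EuclideanSpace ℝ ι => c.ofLp ⬝ᵥ A *ᵥ c.ofLp) ''
      Metric.sphere 0 1) := by
  have hsph : ∀ c : EuclideanSpace ℝ ι, c ∈ Metric.sphere (0 : EuclideanSpace ℝ ι) 1 ↔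
      c.ofLp ⬝ᵥ c.ofLp = 1 := by
    intro c
    have h2 := EuclideanSpace.real_norm_sq_eq c
    rw [mem_sphere_zero_iff_norm]
    simp only [dotProduct, ← pow_two]
    rw [← h2, pow_eq_one_iff_of_nonneg (norm_nonneg c) two_ne_zero]
  have hle : ∀ v ∈ ((fun c : EuclideanSpace ℝ ι => c.ofLp ⬝ᵥ A *ᵥ c.ofLp) ''
      Metric.sphere 0 1), minEigenvalue A ≤ v := by
    rintro v ⟨c, hc, rfl⟩
    have := minEigenvalue_mul_le hA c.ofLp
    rwa [(hsph c).1 hc, mul_one] at this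
  obtain ⟨c, hc1, hc2⟩ := exists_dotProduct_eq_minEigenvalue hA
  have hmem : minEigenvalue A ∈ ((fun c : EuclideanSpace ℝ ι => c.ofLp ⬝ᵥ A *ᵥ c.ofLp) ''
      Metric.sphere 0 1) := ⟨WithLp.toLp 2 c, (hsph _).2 hc1, hc2⟩
  exact le_antisymm (le_csInf ⟨_, hmem⟩ hle) (csInf_le ⟨_, hle⟩ hmem)

lemma continuous_minEigenvalue_wishart {m : Type*} [Fintype m] :
    Continuous fun X : m → ι → ℝ => minEigenvalue (wishart X) := by
  simp_rw [fun X : m → ι → ℝ => minEigenvalue_eq_sInf (isHermitian_wishart X), dotProduct_wishart]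
  refine IsCompact.continuous_sInf (isCompact_sphere (0 : EuclideanSpace ℝ ι) 1) ?_
  have hf : Continuous fun q : (m → ι → ℝ) × EuclideanSpace ℝ ι => Matrix.of q.1 *ᵥ q.2.ofLp :=
    Continuous.matrix_mulVec (by exact continuous_fst) (by fun_prop)
  exact hf.dotProduct hf

end MinEigenvalue

variable {N : ℕ} {σ : Type*} [Fintype σ] [DecidableEq σ]

lemma annihilator_mul_self (X : Matrix (Fin N) σ ℝ) (hX : IsUnit (Xᵀ * X).det) :
    annihilator X * X = 0 := by
  rw [annihilator, Matrix.sub_mul, Matrix.one_mul, Matrix.mul_assoc, Matrix.mul_assoc,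
    nonsing_inv_mul _ hX, Matrix.mul_one, sub_self]

lemma transpose_annihilator (X : Matrix (Fin N) σ ℝ) : (annihilator X)ᵀ = annihilator X := by
  simp [annihilator, transpose_sub, transpose_mul, transpose_nonsing_inv, Matrix.mul_assoc]

lemma annihilator_mulVec_of_orthogonal (X : Matrix (Fin N) σ ℝ) (y : Fin N → ℝ)
    (hy : Xᵀ *ᵥ y = 0) : annihilator X *ᵥ y = y := by
  rw [annihilator, sub_mulVec, one_mulVec, ← mulVec_mulVec, hy, mulVec_zero, sub_zero]

/-- The rows of `W` are an orthonormal basis of the kernel of `Xᵀ`, which has dimension `N - card σ`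
because `X` has full column rank. Compression by `W` produces the degrees of freedom of the Wishart
matrix. -/
lemma exists_mul_transpose_eq_one_of_annihilator {m : ℕ} (X : Matrix (Fin N) σ ℝ)
    (hX : IsUnit (Xᵀ * X).det) (hm : m + Fintype.card σ = N) :
    ∃ W : Matrix (Fin m) (Fin N) ℝ, W * Wᵀ = 1 ∧ Wᵀ * W = annihilator X := by
  let K : Submodule ℝ (EuclideanSpace ℝ (Fin N)) := LinearMap.ker (Matrix.toLpLin 2 2 Xᵀ)
  have hKm : ∀ y : EuclideanSpace ℝ (Fin N), y ∈ K ↔ Xᵀ *ᵥ y.ofLp = 0 := by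
    intro y
    simp [K, LinearMap.mem_ker, Matrix.toLpLin_apply]
  have hrange : LinearMap.range (Matrix.toLpLin 2 2 Xᵀ) = ⊤ := by
    rw [LinearMap.range_eq_top]
    intro z
    refine ⟨WithLp.toLp 2 (X *ᵥ (Xᵀ * X)⁻¹ *ᵥ z.ofLp), ?_⟩
    rw [Matrix.toLpLin_apply]
    simp only [mulVec_mulVec]
    rw [← Matrix.mul_assoc, mul_nonsing_inv _ hX, one_mulVec]
  have hdim : Module.finrank ℝ K = m := by
    have h := LinearMap.finrank_range_add_finrank_ker (Matrix.toLpLin 2 2 Xᵀ)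
    rw [hrange, finrank_top, finrank_euclideanSpace, finrank_euclideanSpace, Fintype.card_fin] at h
    change _ + Module.finrank ℝ K = N at h
    omega
  let b : OrthonormalBasis (Fin m) ℝ K := (stdOrthonormalBasis ℝ K).reindex (finCongr hdim)
  let W : Matrix (Fin m) (Fin N) ℝ := Matrix.of fun i j => (b i : EuclideanSpace ℝ (Fin N)) j
  have hW1 : W * Wᵀ = 1 := by
    ext i j
    have h := orthonormal_iff_ite.1 b.orthonormal j i
    rw [Submodule.coe_inner, EuclideanSpace.inner_eq_star_dotProduct] at h
    simp only [mul_apply, transpose_apply, one_apply, W, of_apply]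
    simp only [star_trivial, dotProduct] at h
    rw [h]
    simp [eq_comm]
  have hW2 : ∀ y : Fin N → ℝ, Xᵀ *ᵥ y = 0 → Wᵀ *ᵥ W *ᵥ y = y := by
    intro y hy
    let y' : K := ⟨WithLp.toLp 2 y, (hKm _).2 hy⟩
    have h := b.sum_repr y'
    have h2 := congrArg (fun z : K => (z : EuclideanSpace ℝ (Fin N)).ofLp) h
    ext j
    have h3 := congrFun h2 j
    simp only [Submodule.coe_sum, Submodule.coe_smul, WithLp.ofLp_sum, WithLp.ofLp_smul,
      Finset.sum_apply, Pi.smul_apply, smul_eq_mul] at h3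
    change _ = y j at h3
    rw [← h3]
    simp only [mulVec, dotProduct, transpose_apply]
    refine Finset.sum_congr rfl fun i _ => ?_
    rw [mul_comm]
    congr 1
    rw [b.repr_apply_apply, Submodule.coe_inner, EuclideanSpace.inner_eq_star_dotProduct]
    simp [dotProduct, W, y', mul_comm]
  have hW3 : W * X = 0 := by
    ext i j
    have h := (hKm _).1 (b i).2
    have h2 := congrFun h j
    simp only [mulVec, dotProduct, transpose_apply, Pi.zero_apply] at h2
    simp only [mul_apply, W, of_apply, Matrix.zero_apply]
    rw [← h2]
    exact Finset.sum_congr rfl fun i _ => mul_comm _ _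
  refine ⟨W, hW1, ?_⟩
  have h4 : Wᵀ * W * annihilator X = annihilator X := by
    refine Matrix.ext_of_mulVec_single fun j => ?_
    rw [← mulVec_mulVec, ← mulVec_mulVec]
    refine hW2 _ ?_
    rw [mulVec_mulVec, ← transpose_annihilator, ← transpose_mul, annihilator_mul_self _ hX,
      transpose_zero, zero_mulVec]
  rw [← h4, annihilator, Matrix.mul_sub, Matrix.mul_one, ← Matrix.mul_assoc, ← Matrix.mul_assoc,
    Matrix.mul_assoc Wᵀ W X, hW3]
  simp

/-- Two matrices with the same Gram matrix differ by an orthogonal factor. -/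
lemma exists_orthogonal_mul_eq {m : ℕ} {κ : Type*} [Fintype κ] [DecidableEq κ]
    {M M' : Matrix (Fin m) κ ℝ} (h : Mᵀ * M = M'ᵀ * M') :
    ∃ U : Matrix (Fin m) (Fin m) ℝ, Uᵀ * U = 1 ∧ U * Uᵀ = 1 ∧ U * M' = M := by
  let f : EuclideanSpace ℝ κ →ₗ[ℝ] EuclideanSpace ℝ (Fin m) := Matrix.toLpLin 2 2 M
  let f' : EuclideanSpace ℝ κ →ₗ[ℝ] EuclideanSpace ℝ (Fin m) := Matrix.toLpLin 2 2 M'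
  have hn : ∀ (A : Matrix (Fin m) κ ℝ) (c : EuclideanSpace ℝ κ),
      ‖Matrix.toLpLin 2 2 A c‖ ^ 2 = c.ofLp ⬝ᵥ (Aᵀ * A) *ᵥ c.ofLp := by
    intro A c
    rw [EuclideanSpace.real_norm_sq_eq, ← mulVec_mulVec, dotProduct_mulVec, vecMul_transpose]
    simp [dotProduct, pow_two, Matrix.toLpLin_apply]
  have hnorm : ∀ c, ‖f c‖ = ‖f' c‖ := fun c => by
    rw [← sq_eq_sq₀ (norm_nonneg _) (norm_nonneg _), hn, hn, h]
  have hker : LinearMap.ker f' ≤ LinearMap.ker f := by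
    intro c hc
    rw [LinearMap.mem_ker] at hc ⊢
    rw [← norm_eq_zero, hnorm, hc, norm_zero]
  obtain ⟨g, hg⟩ : ∃ g : LinearMap.range f' →ₗ[ℝ] EuclideanSpace ℝ (Fin m),
      ∀ c, g ⟨f' c, LinearMap.mem_range_self f' c⟩ = f c := by
    refine ⟨((LinearMap.ker f').liftQ f hker).comp f'.quotKerEquivRange.symm.toLinearMap,
      fun c => ?_⟩
    have : f'.quotKerEquivRange.symm ⟨f' c, LinearMap.mem_range_self f' c⟩
        = (LinearMap.ker f').mkQ c := by
      rw [LinearEquiv.symm_apply_eq]; rfl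
    simp [this]
  -- Equal Gram matrices mean `‖M c‖ = ‖M' c‖`, so `M' c ↦ M c` is a well-defined isometry on the
  -- range of `M'`; a linear isometry on a subspace extends to the whole space.
  let gi : LinearMap.range f' →ₗᵢ[ℝ] EuclideanSpace ℝ (Fin m) :=
    ⟨g, by
      rintro ⟨_, c, rfl⟩
      rw [hg, hnorm]; rfl⟩
  let e := gi.extend
  have he : ∀ c, e (f' c) = f c := fun c => by
    have := gi.extend_apply ⟨f' c, LinearMap.mem_range_self f' c⟩
    exact this.trans (hg c)
  let U : Matrix (Fin m) (Fin m) ℝ := (Matrix.toLpLin 2 2).symm e.toLinearMap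
  have hU : ∀ c : EuclideanSpace ℝ (Fin m), Matrix.toLpLin 2 2 U c = e c := fun c => by
    simp [U]
  have hUv : ∀ c : Fin m → ℝ, U *ᵥ c = (e (WithLp.toLp 2 c)).ofLp := fun c => by
    rw [← hU, Matrix.toLpLin_apply]
  have hUU : Uᵀ * U = 1 := by
    ext i j
    have h1 := e.inner_map_map (WithLp.toLp 2 (Pi.single j 1)) (WithLp.toLp 2 (Pi.single i 1))
    rw [EuclideanSpace.inner_eq_star_dotProduct, EuclideanSpace.inner_eq_star_dotProduct,
      ← hUv, ← hUv] at h1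
    simp only [star_trivial, mulVec_single_one, dotProduct_single_one] at h1
    rw [mul_apply]
    have h2 : ∑ x, Uᵀ i x * U x j = U.col i ⬝ᵥ U.col j := rfl
    rw [h2, h1, one_apply, Pi.single_apply]
    simp only [eq_comm]
  refine ⟨U, hUU, mul_eq_one_comm.1 hUU, ?_⟩
  refine Matrix.ext_of_mulVec_single fun j => ?_
  have h1 := he (WithLp.toLp 2 (Pi.single j 1))
  rw [← mulVec_mulVec, hUv]
  have h2 : f' (WithLp.toLp 2 (Pi.single j 1)) = WithLp.toLp 2 (M' *ᵥ Pi.single j 1) := rfl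
  have h3 : f (WithLp.toLp 2 (Pi.single j 1)) = WithLp.toLp 2 (M *ᵥ Pi.single j 1) := rfl
  rw [h2, h3] at h1
  rw [h1]

end LinearAlgebra

/-! ### Limits of matrix operations -/

section Limits

lemma _root_.Filter.Tendsto.matrixVecMulVec {α m n : Type*} {F : Filter α} {u : α → m → ℝ} {v : α → n → ℝ} {a : m → ℝ}
    {b : n → ℝ} (hu : Tendsto u F (𝓝 a)) (hv : Tendsto v F (𝓝 b)) :
    Tendsto (fun x => vecMulVec (u x) (v x)) F (𝓝 (vecMulVec a b)) :=
  ((continuous_fst.matrix_vecMulVec continuous_snd).tendsto (a, b)).comp (hu.prodMk_nhds hv)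

variable {α l m n : Type*} [Fintype m] {F : Filter α}

lemma _root_.Filter.Tendsto.matrixMul {A : α → Matrix l m ℝ} {B : α → Matrix m n ℝ}
    {a : Matrix l m ℝ} {b : Matrix m n ℝ} (hA : Tendsto A F (𝓝 a)) (hB : Tendsto B F (𝓝 b)) :
    Tendsto (fun x => A x * B x) F (𝓝 (a * b)) :=
  ((continuous_fst.matrix_mul continuous_snd).tendsto (a, b)).comp (hA.prodMk_nhds hB)

lemma _root_.Filter.Tendsto.matrixMulVec {A : α → Matrix l m ℝ} {v : α → m → ℝ}
    {a : Matrix l m ℝ} {b : m → ℝ} (hA : Tendsto A F (𝓝 a)) (hv : Tendsto v F (𝓝 b)) :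
    Tendsto (fun x => A x *ᵥ v x) F (𝓝 (a *ᵥ b)) :=
  ((continuous_fst.matrix_mulVec continuous_snd).tendsto (a, b)).comp (hA.prodMk_nhds hv)

lemma _root_.Filter.Tendsto.dotProduct' {u v : α → m → ℝ} {a b : m → ℝ}
    (hu : Tendsto u F (𝓝 a)) (hv : Tendsto v F (𝓝 b)) :
    Tendsto (fun x => u x ⬝ᵥ v x) F (𝓝 (a ⬝ᵥ b)) :=
  ((continuous_fst.dotProduct continuous_snd).tendsto (a, b)).comp (hu.prodMk_nhds hv)

lemma _root_.Filter.Tendsto.matrixDet [DecidableEq m] {A : α → Matrix m m ℝ} {a : Matrix m m ℝ}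
    (hA : Tendsto A F (𝓝 a)) : Tendsto (fun x => (A x).det) F (𝓝 a.det) :=
  (continuous_id.matrix_det.tendsto a).comp hA

lemma _root_.Filter.Tendsto.matrixInv [DecidableEq m] {A : α → Matrix m m ℝ} {a : Matrix m m ℝ}
    (hA : Tendsto A F (𝓝 a)) (ha : IsUnit a.det) : Tendsto (fun x => (A x)⁻¹) F (𝓝 a⁻¹) := by
  simp_rw [Matrix.inv_def, Ring.inverse_eq_inv']
  exact (hA.matrixDet.inv₀ ha.ne_zero).smul ((continuous_id.matrix_adjugate.tendsto a).comp hA)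

lemma _root_.Filter.Tendsto.eventually_isUnit_det [DecidableEq m] {A : α → Matrix m m ℝ}
    {a : Matrix m m ℝ} (hA : Tendsto A F (𝓝 a)) (ha : IsUnit a.det) :
    ∀ᶠ x in F, IsUnit (A x).det := by
  filter_upwards [hA.matrixDet.eventually_ne ha.ne_zero] with x hx
  exact isUnit_iff_ne_zero.2 hx

end Limits

/-! ### Gaussian laws through characteristic functions -/

section Laws

/-- The matrix with a given vectorization. -/
def unvec {N p : ℕ} (x : EuclideanSpace ℝ (Fin p × Fin N)) : Matrix (Fin N) (Fin p) ℝ :=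
  Matrix.of fun i j => x (j, i)

lemma vec_unvec {N p : ℕ} (x : EuclideanSpace ℝ (Fin p × Fin N)) : vec (unvec x) = x.ofLp := rfl

lemma continuous_unvec {N p : ℕ} :
    Continuous (unvec : EuclideanSpace ℝ (Fin p × Fin N) → Matrix (Fin N) (Fin p) ℝ) := by
  unfold unvec
  fun_prop

lemma charFunDual_real (ν : Measure ℝ) (L : StrongDual ℝ ℝ) :
    charFunDual ν L = charFun ν (L 1) := by
  rw [charFunDual_apply, charFun_apply_real]
  congr 1
  ext x
  have : L x = x * L 1 := by
    conv_lhs => rw [← mul_one x, ← smul_eq_mul, map_smul, smul_eq_mul]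
  rw [this]
  push_cast
  ring_nf

lemma charFunDual_gaussianEntries {m κ : Type*} [Fintype m] [Fintype κ] [DecidableEq m]
    [DecidableEq κ] (M : Matrix m κ ℝ) (L : StrongDual ℝ (m → κ → ℝ)) :
    charFunDual (gaussianEntries M) L = Complex.exp
      ((∑ i, ∑ j, L (Pi.single i (Pi.single j 1)) * M i j : ℝ) * Complex.I
        - (∑ i, ∑ j, L (Pi.single i (Pi.single j 1)) ^ 2 : ℝ) / 2) := by
  have hs : ∀ i, SigmaFinite (Measure.pi fun j => gaussianReal (M i j) 1) :=
    fun i => inferInstance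
  rw [gaussianEntries, charFunDual_pi]
  simp_rw [charFunDual_pi, charFunDual_real, charFun_gaussianReal, ← Complex.exp_sum]
  congr 1
  push_cast
  rw [Finset.sum_mul, Finset.sum_div, ← Finset.sum_sub_distrib]
  refine Finset.sum_congr rfl fun i _ => ?_
  rw [Finset.sum_mul, Finset.sum_div, ← Finset.sum_sub_distrib]
  refine Finset.sum_congr rfl fun j _ => ?_
  simp

lemma apply_eq_sum_single {m κ : Type*} [Fintype m] [Fintype κ] [DecidableEq m]
    [DecidableEq κ] (L : StrongDual ℝ (m → κ → ℝ)) (f : m → κ → ℝ) :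
    L f = ∑ i, ∑ j, L (Pi.single i (Pi.single j 1)) * f i j := by
  have h : f = ∑ i, ∑ j, f i j • (Pi.single i (Pi.single j (1 : ℝ)) : m → κ → ℝ) := by
    ext a b
    simp [Finset.sum_apply, Pi.single_apply, apply_ite, ite_apply]
  conv_lhs => rw [h]
  simp only [map_sum, map_smul, smul_eq_mul, mul_comm]

/-- A linear functional with coefficient matrix `l` has variance equal to the Kronecker form at `vec
(Aᵀ l Dᵀ)`. The two whitening identities reduce this to `trace (lᵀ l)`, the variance under
independent unit-variance entries. -/
theorem map_multivariateGaussian_eq_gaussianEntries {N p m : ℕ} {κ : Type*} [Fintype κ]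
    [DecidableEq κ] {Qi : Matrix (Fin p) (Fin p) ℝ} {Sig : Matrix (Fin N) (Fin N) ℝ}
    (hQi : Qi.PosSemidef) (hSig : Sig.PosSemidef) (A : Matrix (Fin m) (Fin N) ℝ)
    (D : Matrix (Fin p) κ ℝ) (M : Matrix (Fin m) κ ℝ) (hA : A * Sig * Aᵀ = 1)
    (hD : Dᵀ * Qi * D = 1) :
    (multivariateGaussian 0 (Qi ⊗ₖ Sig)).map
      (fun x i j => (M + A * unvec x * D) i j) = gaussianEntries M := by
  have hc : Continuous fun (x : EuclideanSpace ℝ (Fin p × Fin N)) i j =>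
      (M + A * unvec x * D) i j :=
    continuous_const.add ((continuous_const.matrix_mul continuous_unvec).matrix_mul
      continuous_const)
  have : IsProbabilityMeasure ((multivariateGaussian 0 (Qi ⊗ₖ Sig)).map
      (fun x i j => (M + A * unvec x * D) i j)) :=
    Measure.isProbabilityMeasure_map hc.measurable.aemeasurable
  refine Measure.ext_of_charFunDual <| funext fun L => ?_
  rw [charFunDual_gaussianEntries]
  set l : Matrix (Fin m) κ ℝ := Matrix.of fun i j => L (Pi.single i (Pi.single j 1)) with hl
  have htr : ∀ B : Matrix (Fin m) κ ℝ, L (fun i j => B i j) = (lᵀ * B).trace := by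
    intro B
    rw [apply_eq_sum_single, Finset.sum_comm]
    rfl
  have hlin : ∀ x : EuclideanSpace ℝ (Fin p × Fin N),
      L (fun i j => (M + A * unvec x * D) i j)
        = (lᵀ * M).trace + inner ℝ x (WithLp.toLp 2 (vec (Aᵀ * l * Dᵀ))) := by
    intro x
    rw [htr, Matrix.mul_add, trace_add, EuclideanSpace.inner_eq_star_dotProduct, star_trivial,
      ← vec_unvec x, vec_dotProduct_vec]
    congr 1
    rw [transpose_mul, transpose_mul, transpose_transpose, transpose_transpose,
      Matrix.mul_assoc D, trace_mul_comm D]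
    congr 1
    simp only [Matrix.mul_assoc]
  rw [charFunDual_apply, integral_map hc.measurable.aemeasurable (by fun_prop)]
  simp_rw [hlin]
  have hsplit : ∀ x : EuclideanSpace ℝ (Fin p × Fin N),
      Complex.exp ((((lᵀ * M).trace + inner ℝ x (WithLp.toLp 2 (vec (Aᵀ * l * Dᵀ))) : ℝ) : ℂ)
        * Complex.I) = Complex.exp (((lᵀ * M).trace : ℂ) * Complex.I) *
        Complex.exp (((inner ℝ x (WithLp.toLp 2 (vec (Aᵀ * l * Dᵀ))) : ℝ) : ℂ) * Complex.I) := by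
    intro x
    rw [← Complex.exp_add]
    push_cast
    ring_nf
  simp_rw [hsplit]
  rw [integral_const_mul]
  have hcf := charFun_multivariateGaussian (μ := 0) (hQi.kronecker hSig)
    (WithLp.toLp 2 (vec (Aᵀ * l * Dᵀ)))
  rw [charFun] at hcf
  rw [hcf, ← Complex.exp_add]
  have hquad : vec (Aᵀ * l * Dᵀ) ⬝ᵥ (Qi ⊗ₖ Sig) *ᵥ vec (Aᵀ * l * Dᵀ) = (lᵀ * l).trace := by
    rw [kronecker_mulVec_vec, vec_dotProduct_vec]
    have hQt : Qiᵀ = Qi := by simpa using hQi.isHermitian.eq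
    calc ((Aᵀ * l * Dᵀ)ᵀ * (Sig * (Aᵀ * l * Dᵀ) * Qiᵀ)).trace
        = (D * (lᵀ * (A * Sig * Aᵀ) * l * (Dᵀ * Qi))).trace := by
          rw [hQt]
          simp only [transpose_mul, transpose_transpose, Matrix.mul_assoc]
      _ = (lᵀ * l * (Dᵀ * Qi * D)).trace := by
          rw [trace_mul_comm, hA]
          simp only [Matrix.mul_assoc, Matrix.mul_one]
      _ = _ := by rw [hD, Matrix.mul_one]
  have h1 : (lᵀ * M).trace = ∑ i, ∑ j, L (Pi.single i (Pi.single j 1)) * M i j := by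
    rw [Finset.sum_comm]; rfl
  have h2 : (lᵀ * l).trace = ∑ i, ∑ j, L (Pi.single i (Pi.single j 1)) ^ 2 := by
    rw [Finset.sum_comm]; simp [Matrix.trace, mul_apply, hl, pow_two]
  congr 1
  rw [← h1, ← h2, ← hquad]
  simp
  ring

lemma charFun_map_dotProduct_multivariateGaussian {ι : Type*} [Fintype ι] [DecidableEq ι]
    {S : Matrix ι ι ℝ} (hS : S.PosSemidef) (y : ι → ℝ) :
    charFun ((multivariateGaussian 0 S).map fun x : EuclideanSpace ℝ ι => y ⬝ᵥ x.ofLp) 1 =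
      Complex.exp ((-(y ⬝ᵥ S *ᵥ y / 2) : ℝ) : ℂ) := by
  have hcf := charFun_multivariateGaussian (μ := 0) hS (WithLp.toLp 2 y)
  have hc : Continuous fun x : EuclideanSpace ℝ ι => y ⬝ᵥ x.ofLp :=
    continuous_const.dotProduct (by fun_prop)
  rw [charFun_apply_real, integral_map hc.measurable.aemeasurable (by fun_prop)]
  rw [charFun] at hcf
  simp only [EuclideanSpace.inner_eq_star_dotProduct, star_trivial] at hcf
  simp only [Complex.ofReal_one, one_mul]
  rw [hcf]
  congr 1
  simp

/-- The characteristic function of a centred normal variable at `1` already determines its variance.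
-/
lemma dotProduct_mulVec_eq_of_map_eq {ι ι' : Type*} [Fintype ι] [DecidableEq ι] [Fintype ι']
    [DecidableEq ι'] {S : Matrix ι ι ℝ} {S' : Matrix ι' ι' ℝ} (hS : S.PosSemidef)
    (hS' : S'.PosSemidef) (y : ι → ℝ) (y' : ι' → ℝ)
    (h : ((multivariateGaussian 0 S).map fun x : EuclideanSpace ℝ ι => y ⬝ᵥ x.ofLp) =
      (multivariateGaussian 0 S').map fun x : EuclideanSpace ℝ ι' => y' ⬝ᵥ x.ofLp) :
    y ⬝ᵥ S *ᵥ y = y' ⬝ᵥ S' *ᵥ y' := by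
  have h1 := charFun_map_dotProduct_multivariateGaussian hS y
  rw [h, charFun_map_dotProduct_multivariateGaussian hS' y', ← Complex.ofReal_exp,
    ← Complex.ofReal_exp, Complex.ofReal_inj, Real.exp_eq_exp] at h1
  linarith

/-- Rotation invariance of the standard normal law, in the form needed for a row of a Gaussian
matrix tested against a fixed unit vector. -/
lemma map_dotProduct_pi_gaussianReal {κ : Type*} [Fintype κ] [DecidableEq κ] (u : κ → ℝ)
    (hu : u ⬝ᵥ u = 1) :
    (Measure.pi fun _ : κ => gaussianReal 0 1).map (fun z => z ⬝ᵥ u) = gaussianReal 0 1 := by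
  have hc : Continuous fun z : κ → ℝ => z ⬝ᵥ u := continuous_id.dotProduct continuous_const
  have : IsProbabilityMeasure ((Measure.pi fun _ : κ => gaussianReal 0 1).map
      (fun z => z ⬝ᵥ u)) := Measure.isProbabilityMeasure_map hc.measurable.aemeasurable
  refine Measure.ext_of_charFunDual <| funext fun L => ?_
  rw [charFunDual_real (gaussianReal 0 1), charFun_gaussianReal, charFunDual_apply,
    integral_map hc.measurable.aemeasurable (by fun_prop)]
  let L' : StrongDual ℝ (κ → ℝ) :=
    LinearMap.toContinuousLinearMap
      { toFun := fun z => z ⬝ᵥ (L 1 • u)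
        map_add' := fun a b => add_dotProduct _ _ _
        map_smul' := fun a b => smul_dotProduct _ _ _ }
  have hL : ∀ z : κ → ℝ, L (z ⬝ᵥ u) = L' z := by
    intro z
    have : L (z ⬝ᵥ u) = (z ⬝ᵥ u) * L 1 := by
      conv_lhs => rw [← mul_one (z ⬝ᵥ u), ← smul_eq_mul, map_smul, smul_eq_mul]
    rw [this]
    change _ = z ⬝ᵥ (L 1 • u)
    rw [dotProduct_smul, smul_eq_mul, mul_comm]
  simp_rw [hL]
  rw [← charFunDual_apply, charFunDual_pi]
  simp_rw [charFunDual_real, charFun_gaussianReal, ← Complex.exp_sum]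
  have hL1 : ∀ i, (L'.comp (ContinuousLinearMap.single ℝ (fun _ : κ => ℝ) i)) 1 = L 1 * u i := by
    intro i
    change (Pi.single i 1 : κ → ℝ) ⬝ᵥ (L 1 • u) = _
    simp
  congr 1
  simp_rw [hL1]
  have h2 : ((∑ i, u i * u i : ℝ) : ℂ) = 1 := by
    rw [show ∑ i, u i * u i = 1 from hu]; simp
  push_cast at h2 ⊢
  have : ∀ i, ((0 : ℂ) - 1 * ((L 1 : ℂ) * u i) ^ 2 / 2)
      = -((L 1 : ℂ) ^ 2 / 2) * (u i * u i) := fun i => by ring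
  simp only [mul_zero, zero_mul]
  simp_rw [this]
  rw [← Finset.mul_sum, h2]
  ring

end Laws

/-! ### Quadratic matrix-valued maps, determined by finitely many values -/

section QuadraticFamilies

variable {ι M : Type*} [Fintype ι] [AddCommGroup M] [Module ℝ M]

/-- The value at `θ` of the quadratic map with values `D a b` at the vectors `e a + e b`. -/
def quadOf (D : ι → ι → M) (θ : ι → ℝ) : M :=
  ∑ a, ∑ b, (θ a * θ b / 2) • (D a b - (1 / 4 : ℝ) • D a a - (1 / 4 : ℝ) • D b b)

/-- Polarization. The factor `1/4` appears because the diagonal datum is the value at `2 e_a`, which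
is four times the value at `e_a`. The coefficients `C` need not be symmetric: only their
symmetrization is recovered. -/
lemma quadOf_eq [DecidableEq ι] {F : (ι → ℝ) → M} (C : ι → ι → M)
    (hF : ∀ θ, F θ = ∑ a, ∑ b, (θ a * θ b) • C a b) (θ : ι → ℝ) :
    F θ = quadOf (fun a b => F (Pi.single a 1 + Pi.single b 1)) θ := by
  have hD : ∀ a b, F (Pi.single a 1 + Pi.single b 1) = C a a + C a b + C b a + C b b := by
    intro a b
    rw [hF]
    simp only [Pi.add_apply, add_mul, mul_add, add_smul, Finset.sum_add_distrib, Pi.single_apply,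
      ite_mul, one_mul, zero_mul, ite_smul, one_smul, zero_smul]
    have h : ∀ c d : ι, (∑ x, if x = c then ∑ y, if y = d then C x y else 0 else 0) = C c d := by
      intro c d
      simp
    simp only [Finset.sum_ite_irrel, Finset.sum_const_zero]
    rw [h, h, h, h]
    abel
  have h1 : ∀ a b, (θ a * θ b / 2) • (F (Pi.single a 1 + Pi.single b 1)
      - (1 / 4 : ℝ) • F (Pi.single a 1 + Pi.single a 1)
      - (1 / 4 : ℝ) • F (Pi.single b 1 + Pi.single b 1))
      = (1 / 2 : ℝ) • ((θ a * θ b) • C a b) + (1 / 2 : ℝ) • ((θ b * θ a) • C b a) := by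
    intro a b
    rw [hD, hD, hD]
    module
  rw [quadOf]
  simp_rw [h1, Finset.sum_add_distrib]
  rw [Finset.sum_comm (f := fun a b => (1 / 2 : ℝ) • ((θ b * θ a) • C b a))]
  simp_rw [← Finset.smul_sum]
  rw [← hF]
  module

lemma quadOf_smul (D : ι → ι → M) (c : ℝ) (θ : ι → ℝ) :
    quadOf D (c • θ) = c ^ 2 • quadOf D θ := by
  simp only [quadOf, Finset.smul_sum, smul_smul, Pi.smul_apply, smul_eq_mul]
  refine Finset.sum_congr rfl fun a _ => Finset.sum_congr rfl fun b _ => ?_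
  congr 1
  ring

lemma quadOf_zero (D : ι → ι → M) : quadOf D 0 = 0 := by simp [quadOf]

lemma continuous_quadOf {n : Type*} [Finite n] :
    Continuous fun q : (ι → ι → Matrix n n ℝ) × (ι → ℝ) => quadOf q.1 q.2 := by
  have h : ∀ a b, Continuous fun q : (ι → ι → Matrix n n ℝ) × (ι → ℝ) => q.1 a b := fun a b =>
    (continuous_apply_apply a b).comp continuous_fst
  have h' : ∀ a, Continuous fun q : (ι → ι → Matrix n n ℝ) × (ι → ℝ) => q.2 a := fun a =>
    (continuous_apply a).comp continuous_snd
  unfold quadOf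
  refine continuous_finsetSum _ fun a _ => continuous_finsetSum _ fun b _ => ?_
  refine Continuous.smul (((h' a).mul (h' b)).div_const 2) ?_
  exact ((h a b).sub ((h a a).const_smul (1 / 4 : ℝ))).sub ((h b b).const_smul (1 / 4 : ℝ))

lemma tendsto_quadOf {n α : Type*} [Finite n] {l : Filter α} {D : α → ι → ι → Matrix n n ℝ}
    {θ : α → ι → ℝ} {D₀ : ι → ι → Matrix n n ℝ} {θ₀ : ι → ℝ}
    (hD : Tendsto D l (𝓝 D₀)) (hθ : Tendsto θ l (𝓝 θ₀)) :
    Tendsto (fun x => quadOf (D x) (θ x)) l (𝓝 (quadOf D₀ θ₀)) := by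
  have h := (continuous_quadOf.tendsto (D₀, θ₀)).comp (hD.prodMk_nhds hθ)
  rwa [Function.comp_def] at h

end QuadraticFamilies

/-! ### Algebra of the sample moments -/

section Sample

variable {N p : ℕ} (x : ℕ → Fin N → ℝ) (y : ℕ → Fin p → ℝ) (T : ℕ)

lemma errAt_sub_errBar (t : ℕ) (θ : Fin (p + 1) → ℝ) (i : Fin N) :
    (errAt x y t θ - errBar x y T θ) i
      = -∑ a, θ a * (aug (y t) a * x t i - qHat x y T i a) := by
  simp only [errAt, errBar, Pi.sub_apply, Pi.smul_apply, smul_eq_mul, mulVec, dotProduct, mul_sub,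
    Finset.sum_sub_distrib, Finset.sum_mul]
  have h1 : ∑ a, aug (y t) a * θ a * x t i = ∑ a, θ a * (aug (y t) a * x t i) :=
    Finset.sum_congr rfl fun a _ => by ring
  have h2 : ∑ a, qHat x y T i a * θ a = ∑ a, θ a * qHat x y T i a :=
    Finset.sum_congr rfl fun a _ => by ring
  rw [h1, h2]
  ring

/-- The values of the sample covariance matrix that determine it. -/
def covData : Fin (p + 1) → Fin (p + 1) → Matrix (Fin N) (Fin N) ℝ :=
  fun a b => covHat x y T (Pi.single a 1 + Pi.single b 1)

/-- The centred errors are linear in `θ`, so their covariance is quadratic. Consistency at the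
finitely many points `e_a + e_b` thus controls every `θ` at once. -/
lemma covHat_eq_quadOf (θ : Fin (p + 1) → ℝ) : covHat x y T θ = quadOf (covData x y T) θ := by
  refine quadOf_eq (fun a b => Matrix.of fun i j => (T : ℝ)⁻¹ * ∑ t ∈ Finset.range T,
    (aug (y t) a * x t i - qHat x y T i a) * (aug (y t) b * x t j - qHat x y T j b)) ?_ θ
  intro θ
  ext i j
  simp only [covHat, Matrix.smul_apply, Matrix.sum_apply, vecMulVec_apply, smul_eq_mul, of_apply,
    errAt_sub_errBar, neg_mul_neg, Finset.sum_mul_sum]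
  rw [Finset.sum_comm, Finset.mul_sum]
  refine Finset.sum_congr rfl fun a _ => ?_
  rw [Finset.sum_comm, Finset.mul_sum]
  refine Finset.sum_congr rfl fun b _ => ?_
  simp only [Finset.mul_sum]
  refine Finset.sum_congr rfl fun t _ => ?_
  ring

lemma vecMulVec_self_posSemidef (v : Fin N → ℝ) : (vecMulVec v v).PosSemidef := by
  simpa using posSemidef_vecMulVec_self_star v

lemma sum_vecMulVec_posSemidef (v : ℕ → Fin N → ℝ) :
    ((T : ℝ)⁻¹ • ∑ t ∈ Finset.range T, vecMulVec (v t) (v t)).PosSemidef :=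
  (posSemidef_sum _ fun t _ => vecMulVec_self_posSemidef (v t)).smul (by positivity)

lemma SHat_posSemidef (θ : Fin (p + 1) → ℝ) : (SHat x y T θ).PosSemidef :=
  sum_vecMulVec_posSemidef T _

lemma QrHat_posSemidef : (QrHat x T).PosSemidef :=
  sum_vecMulVec_posSemidef T _

variable {T}

lemma mean_errAt (hT : 0 < T) (θ : Fin (p + 1) → ℝ) (i : Fin N) :
    (T : ℝ)⁻¹ * ∑ t ∈ Finset.range T, errAt x y t θ i = errBar x y T θ i := by
  have hT' : (T : ℝ) ≠ 0 := by positivity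
  have h : (T : ℝ)⁻¹ * ∑ t ∈ Finset.range T, (errAt x y t θ - errBar x y T θ) i = 0 := by
    simp_rw [errAt_sub_errBar]
    rw [Finset.sum_neg_distrib, Finset.sum_comm, mul_neg, Finset.mul_sum, neg_eq_zero]
    refine Finset.sum_eq_zero fun a _ => ?_
    rw [← Finset.mul_sum, Finset.sum_sub_distrib, Finset.sum_const, Finset.card_range, qHat]
    simp only [Matrix.smul_apply, Matrix.sum_apply, vecMulVec_apply, smul_eq_mul, nsmul_eq_mul]
    rw [mul_inv_cancel_left₀ hT']
    simp [mul_comm]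
  simp only [Pi.sub_apply, Finset.sum_sub_distrib, Finset.sum_const, Finset.card_range,
    nsmul_eq_mul, mul_sub] at h
  rw [inv_mul_cancel_left₀ hT'] at h
  linarith

lemma sum_vecMulVec_eq_centered (hT : 0 < T) (v : ℕ → Fin N → ℝ) (m : Fin N → ℝ)
    (hm : ∀ i, (T : ℝ)⁻¹ * ∑ t ∈ Finset.range T, v t i = m i) :
    (T : ℝ)⁻¹ • ∑ t ∈ Finset.range T, vecMulVec (v t) (v t) =
      (T : ℝ)⁻¹ • ∑ t ∈ Finset.range T, vecMulVec (v t - m) (v t - m) + vecMulVec m m := by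
  have hT' : (T : ℝ) ≠ 0 := by positivity
  ext i j
  simp only [Matrix.smul_apply, Matrix.sum_apply, vecMulVec_apply, smul_eq_mul, Matrix.add_apply,
    Pi.sub_apply, sub_mul, mul_sub, Finset.sum_sub_distrib, ← Finset.sum_mul, ← Finset.mul_sum,
    Finset.sum_const, Finset.card_range, nsmul_eq_mul]
  have h : ∀ i, ∑ t ∈ Finset.range T, v t i = T * m i := fun i => by
    rw [← hm, mul_inv_cancel_left₀ hT']
  rw [h, h]
  field_simp
  ring

lemma SHat_eq (hT : 0 < T) (θ : Fin (p + 1) → ℝ) :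
    SHat x y T θ = quadOf (covData x y T) θ + vecMulVec (errBar x y T θ) (errBar x y T θ) := by
  rw [← covHat_eq_quadOf]
  exact sum_vecMulVec_eq_centered hT _ _ (mean_errAt x y hT θ)

/-- At `θ = e₀` the pricing error is `ι - r_t`, so its centred second moment is that of the returns.
This expresses `Q̂_r` through the same finite data as `S_T`. -/
lemma QrHat_eq (hT : 0 < T) :
    QrHat x T = quadOf (covData x y T) (Pi.single 0 1)
      + vecMulVec (qHat x y T *ᵥ Pi.single 0 1) (qHat x y T *ᵥ Pi.single 0 1) := by
  have haug : ∀ t, aug (y t) ⬝ᵥ Pi.single 0 1 = 1 := fun t => by simp [aug]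
  have h := sum_vecMulVec_eq_centered hT x (qHat x y T *ᵥ Pi.single 0 1) fun i => by
    have h1 := mean_errAt x y hT (Pi.single 0 1) i
    have hT' : (T : ℝ) ≠ 0 := by positivity
    simp only [errAt, errBar, haug, one_smul, Pi.sub_apply, Finset.sum_sub_distrib,
      Finset.sum_const, Finset.card_range, nsmul_eq_mul, mul_one, mul_sub,
      inv_mul_cancel₀ hT'] at h1
    linarith
  rw [QrHat, h, ← covHat_eq_quadOf, covHat]
  congr 2
  refine Finset.sum_congr rfl fun t _ => ?_
  have h2 : errAt x y t (Pi.single 0 1) - errBar x y T (Pi.single 0 1)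
      = -(x t - qHat x y T *ᵥ Pi.single 0 1) := by
    rw [errAt, errBar, haug, one_smul]
    abel
  rw [h2, neg_vecMulVec, vecMulVec_neg, neg_neg]

lemma qHat_eq (h : IsUnit (QGHat y T).det) : qHat x y T = BHat x y T * QGHat y T := by
  rw [BHat, Matrix.mul_assoc, nonsing_inv_mul _ h, Matrix.mul_one]

end Sample

/-! ### Continuity in the parameter and measurability of `J` -/

section Measurability

lemma measurable_matrix_of_apply {Ω m n : Type*} [MeasurableSpace Ω]
    {A : Ω → Matrix m n ℝ} (h : ∀ i j, Measurable fun ω => A ω i j) :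
    Measurable fun ω i j => A ω i j :=
  measurable_pi_lambda _ fun i => measurable_pi_lambda _ fun j => h i j

lemma measurable_det {Ω n : Type*} [MeasurableSpace Ω] [Fintype n] [DecidableEq n]
    {A : Ω → Matrix n n ℝ} (h : ∀ i j, Measurable fun ω => A ω i j) :
    Measurable fun ω => (A ω).det := by
  have hc : Continuous fun B : n → n → ℝ => (Matrix.of B).det :=
    Continuous.matrix_det (by exact continuous_id)
  exact hc.measurable.comp (measurable_matrix_of_apply h)

lemma measurable_inv_apply {Ω n : Type*} [MeasurableSpace Ω] [Fintype n] [DecidableEq n]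
    {A : Ω → Matrix n n ℝ} (h : ∀ i j, Measurable fun ω => A ω i j) (i j : n) :
    Measurable fun ω => (A ω)⁻¹ i j := by
  have hc : Continuous fun B : n → n → ℝ => (Matrix.of B).adjugate i j :=
    (Continuous.matrix_adjugate (by exact continuous_id)).matrix_elem i j
  have h1 : Measurable fun ω => (A ω).adjugate i j :=
    hc.measurable.comp (measurable_matrix_of_apply h)
  simp_rw [Matrix.inv_def, Ring.inverse_eq_inv', Matrix.smul_apply, smul_eq_mul]
  exact (measurable_det h).inv.mul h1

section Continuity

variable {N p : ℕ} (x : ℕ → Fin N → ℝ) (y : ℕ → Fin p → ℝ) (T : ℕ)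

lemma continuous_errBar : Continuous (errBar x y T) :=
  continuous_const.sub (continuous_const.matrix_mulVec continuous_id)

lemma continuous_SHat : Continuous (SHat x y T) := by
  have h : ∀ t, Continuous (errAt x y t) := fun t =>
    continuous_const.sub ((continuous_const.dotProduct continuous_id).smul continuous_const)
  exact (continuous_finsetSum _ fun t _ => (h t).matrix_vecMulVec (h t)).const_smul (T : ℝ)⁻¹

lemma continuousAt_AR {θ : Fin (p + 1) → ℝ} (h : IsUnit (SHat x y T θ).det) :
    ContinuousAt (AR x y T) θ := by
  have he := (continuous_errBar x y T).tendsto θ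
  have hS := (continuous_SHat x y T).tendsto θ
  exact (he.dotProduct' ((hS.matrixInv h).matrixMulVec he)).const_mul (T : ℝ)

lemma AR_nonneg (θ : Fin (p + 1) → ℝ) : 0 ≤ AR x y T θ := by
  refine mul_nonneg (by positivity) ?_
  simpa using (SHat_posSemidef x y T θ).inv.dotProduct_mulVec_nonneg (errBar x y T θ)

lemma Jstat_le {θ : Fin (p + 1) → ℝ} (h : IsUnit (SHat x y T θ).det) :
    Jstat x y T ≤ AR x y T θ := by
  refine csInf_le ⟨0, ?_⟩ ⟨θ, h, rfl⟩
  rintro v ⟨θ, -, rfl⟩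
  exact AR_nonneg x y T θ

lemma Jstat_eq_zero (hne : ∀ θ, ¬ IsUnit (SHat x y T θ).det) : Jstat x y T = 0 := by
  have h0 : {v : ℝ | ∃ θ, IsUnit (SHat x y T θ).det ∧ v = AR x y T θ} = ∅ :=
    Set.eq_empty_iff_forall_notMem.2 fun v ⟨θ, hθ, _⟩ => hne θ hθ
  rw [Jstat, h0, Real.sInf_empty]

/-- `AR` is continuous on the open set where `S_T` is nonsingular, so a dense sequence suffices and
the event becomes a countable combination. The second alternative accounts for the value `0` of the
infimum of the empty set. -/
lemma Jstat_lt_iff (c : ℝ) (d : ℕ → Fin (p + 1) → ℝ) (hd : DenseRange d) :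
    Jstat x y T < c ↔ (∃ n, IsUnit (SHat x y T (d n)).det ∧ AR x y T (d n) < c) ∨
      ((∀ n, ¬ IsUnit (SHat x y T (d n)).det) ∧ 0 < c) := by
  have hopen : IsOpen {θ | IsUnit (SHat x y T θ).det} := by
    simp_rw [isUnit_iff_ne_zero]
    exact isOpen_ne_fun (continuous_SHat x y T).matrix_det continuous_const
  constructor
  · intro hJ
    by_cases hne : ∃ θ, IsUnit (SHat x y T θ).det
    · left
      obtain ⟨θ, hθ⟩ := hne
      have hne' : {v : ℝ | ∃ θ, IsUnit (SHat x y T θ).det ∧ v = AR x y T θ}.Nonempty :=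
        ⟨_, θ, hθ, rfl⟩
      obtain ⟨v, ⟨θ', hθ', rfl⟩, hv⟩ := exists_lt_of_csInf_lt hne' hJ
      have h1 : ∀ᶠ θ in 𝓝 θ', IsUnit (SHat x y T θ).det ∧ AR x y T θ < c :=
        (hopen.eventually_mem hθ').and ((continuousAt_AR x y T hθ').eventually_lt_const hv)
      obtain ⟨n, hn⟩ := hd.mem_nhds h1
      exact ⟨n, hn⟩
    · right
      push Not at hne
      refine ⟨fun n => hne _, ?_⟩
      rwa [Jstat_eq_zero x y T hne] at hJ
  · rintro (⟨n, hn, hlt⟩ | ⟨hn, hc⟩)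
    · exact (Jstat_le x y T hn).trans_lt hlt
    · have hne : ∀ θ, ¬ IsUnit (SHat x y T θ).det := by
        intro θ hθ
        obtain ⟨n, hn'⟩ := hd.mem_nhds (hopen.mem_nhds hθ)
        exact hn n hn'
      rwa [Jstat_eq_zero x y T hne]

end Continuity

variable {Ω : Type*} [MeasurableSpace Ω] {N p : ℕ} {r : ℕ → Ω → Fin N → ℝ}
  {g : ℕ → Ω → Fin p → ℝ}

lemma measurable_aug (hg : ∀ t, Measurable (g t)) (t : ℕ) (a : Fin (p + 1)) :
    Measurable fun ω => aug (g t ω) a := by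
  refine Fin.cases ?_ (fun j => ?_) a
  · simp [aug]
  · simpa [aug] using measurable_pi_iff.1 (hg t) j

lemma measurable_errAt (hr : ∀ t, Measurable (r t)) (hg : ∀ t, Measurable (g t)) (t : ℕ)
    (θ : Fin (p + 1) → ℝ) (i : Fin N) :
    Measurable fun ω => errAt (fun t => r t ω) (fun t => g t ω) t θ i := by
  simp only [errAt, Pi.sub_apply, Pi.smul_apply, smul_eq_mul, dotProduct]
  exact measurable_const.sub ((Finset.measurable_sum _ fun a _ =>
    (measurable_aug hg t a).mul_const _).mul (measurable_pi_iff.1 (hr t) i))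

lemma measurable_SHat (hr : ∀ t, Measurable (r t)) (hg : ∀ t, Measurable (g t)) (T : ℕ)
    (θ : Fin (p + 1) → ℝ) (i j : Fin N) :
    Measurable fun ω => SHat (fun t => r t ω) (fun t => g t ω) T θ i j := by
  simp only [SHat, Matrix.smul_apply, Matrix.sum_apply, vecMulVec_apply, smul_eq_mul]
  exact (Finset.measurable_sum _ fun t _ =>
    (measurable_errAt hr hg t θ i).mul (measurable_errAt hr hg t θ j)).const_mul _

lemma measurable_errBar (hr : ∀ t, Measurable (r t)) (hg : ∀ t, Measurable (g t)) (T : ℕ)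
    (θ : Fin (p + 1) → ℝ) (i : Fin N) :
    Measurable fun ω => errBar (fun t => r t ω) (fun t => g t ω) T θ i := by
  simp only [errBar, qHat, Pi.sub_apply, mulVec, dotProduct, Matrix.smul_apply, Matrix.sum_apply,
    vecMulVec_apply, smul_eq_mul]
  exact measurable_const.sub (Finset.measurable_sum _ fun a _ =>
    ((Finset.measurable_sum _ fun t _ => (measurable_pi_iff.1 (hr t) i).mul
      (measurable_aug hg t a)).const_mul _).mul_const _)

lemma measurable_AR (hr : ∀ t, Measurable (r t)) (hg : ∀ t, Measurable (g t)) (T : ℕ)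
    (θ : Fin (p + 1) → ℝ) :
    Measurable fun ω => AR (fun t => r t ω) (fun t => g t ω) T θ := by
  simp only [AR, mulVec, dotProduct]
  exact (Finset.measurable_sum _ fun i _ => (measurable_errBar hr hg T θ i).mul
    (Finset.measurable_sum _ fun j _ => (measurable_inv_apply (measurable_SHat hr hg T θ) i j).mul
      (measurable_errBar hr hg T θ j))).const_mul _

theorem measurable_Jstat (hr : ∀ t, Measurable (r t)) (hg : ∀ t, Measurable (g t)) (T : ℕ) :
    Measurable fun ω => Jstat (fun t => r t ω) (fun t => g t ω) T := by
  have hd := TopologicalSpace.denseRange_denseSeq (Fin (p + 1) → ℝ)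
  have hu : ∀ θ, MeasurableSet {ω | IsUnit (SHat (fun t => r t ω) (fun t => g t ω) T θ).det} := by
    intro θ
    simp_rw [isUnit_iff_ne_zero]
    exact (measurableSet_eq_fun (measurable_det (measurable_SHat hr hg T θ))
      measurable_const).compl
  refine measurable_of_Iio fun c => ?_
  have hset : (fun ω => Jstat (fun t => r t ω) (fun t => g t ω) T) ⁻¹' Set.Iio c =
      (⋃ n, {ω | IsUnit (SHat (fun t => r t ω) (fun t => g t ω) T
          (TopologicalSpace.denseSeq _ n)).det} ∩
        {ω | AR (fun t => r t ω) (fun t => g t ω) T (TopologicalSpace.denseSeq _ n) < c}) ∪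
      ((⋂ n, {ω | IsUnit (SHat (fun t => r t ω) (fun t => g t ω) T
          (TopologicalSpace.denseSeq _ n)).det}ᶜ) ∩ {_ω | 0 < c}) := by
    ext ω
    simp only [Set.mem_preimage, Set.mem_Iio, Jstat_lt_iff _ _ _ _ _ hd]
    simp
  rw [hset]
  exact (MeasurableSet.iUnion fun n => (hu _).inter
    (measurableSet_lt (measurable_AR hr hg T _) measurable_const)).union
    ((MeasurableSet.iInter fun n => (hu _).compl).inter (MeasurableSet.const _))

end Measurability

/-- Each point of `K` comes with a neighbourhood on which the property holds for all indices in one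
set of the filter; finitely many such neighbourhoods cover `K`. -/
lemma eventually_forall_mem_compact {α X : Type*} [TopologicalSpace X] {K : Set X}
    (hK : IsCompact K) {l : Filter α} {R : α → X → Prop}
    (h : ∀ x ∈ K, ∀ᶠ z in l ×ˢ 𝓝 x, R z.1 z.2) : ∀ᶠ a in l, ∀ x ∈ K, R a x := by
  have h1 : ∀ x ∈ K, ∃ U ∈ 𝓝 x, ∀ᶠ a in l, ∀ x' ∈ U, R a x' := by
    intro x hx
    obtain ⟨pa, hpa, pb, hpb, hab⟩ := Filter.eventually_prod_iff.1 (h x hx)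
    exact ⟨{x | pb x}, hpb, hpa.mono fun a ha x' hx' => hab ha hx'⟩
  choose! U hU hUl using h1
  obtain ⟨t, htK, hcov⟩ := hK.elim_nhds_subcover U hU
  have h2 : ∀ᶠ a in l, ∀ x ∈ t, ∀ x' ∈ U x, R a x' :=
    (eventually_all_finset t).2 fun x hx => hUl x (htK x hx)
  filter_upwards [h2] with a ha x hx
  obtain ⟨i, hi, hxi⟩ := Set.mem_iUnion₂.1 (hcov hx)
  exact ha i hi x hxi

/-! ### The AR statistic in homogeneous coordinates and its deterministic limits -/

section Core

variable {N p : ℕ}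

/-- The matrix `(ι, q)`. -/
def Hof (q : Matrix (Fin N) (Fin (p + 1)) ℝ) : Matrix (Fin N) (Fin (p + 2)) ℝ :=
  Matrix.of fun i => Fin.cons 1 (q i)

lemma Hof_mulVec (q : Matrix (Fin N) (Fin (p + 1)) ℝ) (v : Fin (p + 2) → ℝ) :
    Hof q *ᵥ v = (fun _ => v 0) + q *ᵥ Fin.tail v := by
  ext i
  simp [Hof, mulVec, dotProduct, Fin.sum_univ_succ, Fin.tail]

/-- Scaled pricing errors in homogeneous coordinates. -/
def bvec (q : Matrix (Fin N) (Fin (p + 1)) ℝ) (Qp : Matrix (Fin (p + 1)) (Fin (p + 1)) ℝ) (T : ℕ)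
    (Ψ : Matrix (Fin N) (Fin (p + 1)) ℝ) (v : Fin (p + 2) → ℝ) : Fin N → ℝ :=
  √(T : ℝ) • Hof q *ᵥ v + Ψ *ᵥ Qp *ᵥ Fin.tail v

/-- The parameter (up to scale) that belongs to homogeneous coordinates. -/
def phivec (Qp Qh : Matrix (Fin (p + 1)) (Fin (p + 1)) ℝ) (v : Fin (p + 2) → ℝ) :
    Fin (p + 1) → ℝ :=
  Qh⁻¹ *ᵥ Qp *ᵥ Fin.tail v

/-- The second moment matrix of the pricing errors in homogeneous coordinates. -/
def Smat (q : Matrix (Fin N) (Fin (p + 1)) ℝ) (Qp : Matrix (Fin (p + 1)) (Fin (p + 1)) ℝ) (T : ℕ)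
    (Ψ : Matrix (Fin N) (Fin (p + 1)) ℝ) (Qh : Matrix (Fin (p + 1)) (Fin (p + 1)) ℝ)
    (D : Fin (p + 1) → Fin (p + 1) → Matrix (Fin N) (Fin N) ℝ) (v : Fin (p + 2) → ℝ) :
    Matrix (Fin N) (Fin N) ℝ :=
  quadOf D (phivec Qp Qh v) + (T : ℝ)⁻¹ • vecMulVec (bvec q Qp T Ψ v) (bvec q Qp T Ψ v)

section OneSample

variable {x : ℕ → Fin N → ℝ} {y : ℕ → Fin p → ℝ} {T : ℕ}
  {q : Matrix (Fin N) (Fin (p + 1)) ℝ} {Qp : Matrix (Fin (p + 1)) (Fin (p + 1)) ℝ}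
  {Ψ : Matrix (Fin N) (Fin (p + 1)) ℝ}

lemma qHat_eq_of_psi (hT : 0 < T) (hQh : IsUnit (QGHat y T).det)
    (hΨ : √(T : ℝ) • (BHat x y T - q * Qp⁻¹) = Ψ) :
    qHat x y T = (q * Qp⁻¹ + (√(T : ℝ))⁻¹ • Ψ) * QGHat y T := by
  have hs : √(T : ℝ) ≠ 0 := by positivity
  rw [qHat_eq x y hQh, ← hΨ, smul_smul, inv_mul_cancel₀ hs, one_smul, add_sub_cancel]

/-- The factor `Q̂⁻¹` in the parameter cancels the `Q̂` in `q̂ = B̂ Q̂`. The population part then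
becomes exactly `√T H v`, with no error from estimating `Q`; this matters because `Q̂` is consistent
without a rate. -/
lemma sqrt_smul_errBar (hT : 0 < T) (hQh : IsUnit (QGHat y T).det) (hQp : IsUnit Qp.det)
    (hΨ : √(T : ℝ) • (BHat x y T - q * Qp⁻¹) = Ψ) {v : Fin (p + 2) → ℝ} (hv : v 0 ≠ 0) :
    √(T : ℝ) • errBar x y T (-(v 0)⁻¹ • phivec Qp (QGHat y T) v) = (v 0)⁻¹ • bvec q Qp T Ψ v := by
  have hs : √(T : ℝ) ≠ 0 := by positivity
  have h1 : qHat x y T *ᵥ phivec Qp (QGHat y T) v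
      = q *ᵥ Fin.tail v + (√(T : ℝ))⁻¹ • Ψ *ᵥ Qp *ᵥ Fin.tail v := by
    rw [qHat_eq_of_psi hT hQh hΨ, phivec, mulVec_mulVec, Matrix.mul_assoc,
      mul_nonsing_inv _ hQh, Matrix.mul_one, mulVec_mulVec, Matrix.add_mul, Matrix.mul_assoc,
      nonsing_inv_mul _ hQp, Matrix.mul_one, add_mulVec, Matrix.smul_mul, smul_mulVec,
      mulVec_mulVec]
  rw [errBar, mulVec_smul, h1, bvec, Hof_mulVec]
  ext i
  simp only [Pi.smul_apply, Pi.sub_apply, Pi.add_apply, smul_eq_mul]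
  field_simp
  ring

lemma SHat_eq_Smat (hT : 0 < T) (hQh : IsUnit (QGHat y T).det) (hQp : IsUnit Qp.det)
    (hΨ : √(T : ℝ) • (BHat x y T - q * Qp⁻¹) = Ψ) {v : Fin (p + 2) → ℝ} (hv : v 0 ≠ 0) :
    SHat x y T (-(v 0)⁻¹ • phivec Qp (QGHat y T) v)
      = (v 0)⁻¹ ^ 2 • Smat q Qp T Ψ (QGHat y T) (covData x y T) v := by
  have hs : √(T : ℝ) ≠ 0 := by positivity
  have hss : √(T : ℝ) * √(T : ℝ) = T := Real.mul_self_sqrt (by positivity)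
  have h1 := sqrt_smul_errBar hT hQh hQp hΨ hv
  have h2 : errBar x y T (-(v 0)⁻¹ • phivec Qp (QGHat y T) v)
      = ((√(T : ℝ))⁻¹ * (v 0)⁻¹) • bvec q Qp T Ψ v := by
    rw [← smul_smul, ← h1, smul_smul, inv_mul_cancel₀ hs, one_smul]
  rw [SHat_eq x y hT, quadOf_smul, h2, Smat, smul_add, neg_sq]
  congr 1
  rw [smul_vecMulVec, vecMulVec_smul, smul_smul, smul_smul]
  congr 1
  have hi : (T : ℝ)⁻¹ = (√(T : ℝ))⁻¹ * (√(T : ℝ))⁻¹ := by rw [← mul_inv, hss]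
  rw [hi]
  ring

lemma AR_eq_sqrt (θ : Fin (p + 1) → ℝ) :
    AR x y T θ = (√(T : ℝ) • errBar x y T θ) ⬝ᵥ (SHat x y T θ)⁻¹ *ᵥ (√(T : ℝ) • errBar x y T θ) := by
  rw [mulVec_smul, dotProduct_smul, smul_dotProduct, smul_smul, Real.mul_self_sqrt (by positivity),
    AR, smul_eq_mul]

lemma le_AR (hT : 0 < T) (hQh : IsUnit (QGHat y T).det) (hQp : IsUnit Qp.det)
    (hΨ : √(T : ℝ) • (BHat x y T - q * Qp⁻¹) = Ψ) {v : Fin (p + 2) → ℝ} (hv : v 0 ≠ 0)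
    (hu : IsUnit (SHat x y T (-(v 0)⁻¹ • phivec Qp (QGHat y T) v)).det) (c : Fin N → ℝ) :
    2 * (c ⬝ᵥ bvec q Qp T Ψ v) - c ⬝ᵥ Smat q Qp T Ψ (QGHat y T) (covData x y T) v *ᵥ c
      ≤ AR x y T (-(v 0)⁻¹ • phivec Qp (QGHat y T) v) := by
  -- Scaling the dual vector by `v 0` absorbs the factors `(v 0)⁻¹` and `(v 0)⁻²` carried by the
  -- error and its second moment.
  have h := two_mul_dotProduct_sub_le (SHat_posSemidef x y T _) hu (v 0 • c)
    (√(T : ℝ) • errBar x y T (-(v 0)⁻¹ • phivec Qp (QGHat y T) v))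
  rw [AR_eq_sqrt]
  refine le_trans (le_of_eq ?_) h
  rw [sqrt_smul_errBar hT hQh hQp hΨ hv, SHat_eq_Smat hT hQh hQp hΨ hv, smul_mulVec, mulVec_smul]
  simp only [smul_dotProduct, dotProduct_smul, smul_eq_mul]
  field_simp

lemma AR_eq_Smat (hT : 0 < T) (hQh : IsUnit (QGHat y T).det) (hQp : IsUnit Qp.det)
    (hΨ : √(T : ℝ) • (BHat x y T - q * Qp⁻¹) = Ψ) {v : Fin (p + 2) → ℝ} (hv : v 0 ≠ 0)
    (hu : IsUnit (Smat q Qp T Ψ (QGHat y T) (covData x y T) v).det) :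
    IsUnit (SHat x y T (-(v 0)⁻¹ • phivec Qp (QGHat y T) v)).det ∧
    AR x y T (-(v 0)⁻¹ • phivec Qp (QGHat y T) v) =
      bvec q Qp T Ψ v ⬝ᵥ (Smat q Qp T Ψ (QGHat y T) (covData x y T) v)⁻¹ *ᵥ bvec q Qp T Ψ v := by
  have hv2 : (v 0)⁻¹ ^ 2 ≠ 0 := pow_ne_zero _ (inv_ne_zero hv)
  have hinv : ((v 0)⁻¹ ^ 2 • Smat q Qp T Ψ (QGHat y T) (covData x y T) v)⁻¹
      = ((v 0)⁻¹ ^ 2)⁻¹ • (Smat q Qp T Ψ (QGHat y T) (covData x y T) v)⁻¹ := by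
    refine Matrix.inv_eq_left_inv ?_
    rw [Matrix.smul_mul, Matrix.mul_smul, smul_smul, inv_mul_cancel₀ hv2, one_smul,
      nonsing_inv_mul _ hu]
  constructor
  · rw [SHat_eq_Smat hT hQh hQp hΨ hv, det_smul]
    exact (isUnit_iff_ne_zero.2 (pow_ne_zero _ hv2)).mul hu
  · rw [AR_eq_sqrt, sqrt_smul_errBar hT hQh hQp hΨ hv, SHat_eq_Smat hT hQh hQp hΨ hv, hinv,
      smul_mulVec, mulVec_smul]
    simp only [smul_dotProduct, dotProduct_smul, smul_eq_mul]
    field_simp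

end OneSample

variable {σ κ : Type*} [Fintype σ] [Fintype κ]

/-- Limits of `(ι, q_T)` in a basis `(Cs, Cw)` of the coordinate space: the columns in `Cs`
converge, those in `Cw` converge at the rate `√T`. -/
structure WeakLimit (q : ℕ → Matrix (Fin N) (Fin (p + 1)) ℝ) (Cs : Matrix (Fin (p + 2)) σ ℝ)
    (Cw : Matrix (Fin (p + 2)) κ ℝ) (As : Matrix σ (Fin (p + 2)) ℝ)
    (Aw : Matrix κ (Fin (p + 2)) ℝ) (L₁ : Matrix (Fin N) σ ℝ)
    (L₂ : Matrix (Fin N) κ ℝ) : Prop where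
  complete : Cs * As + Cw * Aw = 1
  injective : ∀ c, Cw *ᵥ c = 0 → c = 0
  strong : Tendsto (fun T => Hof (q T) * Cs) atTop (𝓝 L₁)
  weak : Tendsto (fun T : ℕ => √(T : ℝ) • (Hof (q T) * Cw)) atTop (𝓝 L₂)
  full : ∀ c, L₁ *ᵥ c = 0 → c = 0

/-- Homogeneous coordinates from the coordinates in the basis `(Cs, Cw)`. -/
def vOf (Cs : Matrix (Fin (p + 2)) σ ℝ) (Cw : Matrix (Fin (p + 2)) κ ℝ) (T : ℕ)
    (u : (σ → ℝ) × (κ → ℝ)) : Fin (p + 2) → ℝ :=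
  (√(T : ℝ))⁻¹ • Cs *ᵥ u.1 + Cw *ᵥ u.2

/-- The last `p + 1` coordinates of the columns of `Cw`. -/
def tailRows (Cw : Matrix (Fin (p + 2)) κ ℝ) : Matrix (Fin (p + 1)) κ ℝ :=
  Cw.submatrix Fin.succ id

variable {q : ℕ → Matrix (Fin N) (Fin (p + 1)) ℝ} {Cs : Matrix (Fin (p + 2)) σ ℝ}
  {Cw : Matrix (Fin (p + 2)) κ ℝ} {As : Matrix σ (Fin (p + 2)) ℝ}
  {Aw : Matrix κ (Fin (p + 2)) ℝ} {L₁ : Matrix (Fin N) σ ℝ} {L₂ : Matrix (Fin N) κ ℝ}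

lemma vOf_smul (T : ℕ) (c : ℝ) (u : (σ → ℝ) × (κ → ℝ)) :
    vOf Cs Cw T (c • u) = c • vOf Cs Cw T u := by
  simp only [vOf, Prod.smul_fst, Prod.smul_snd, mulVec_smul, smul_add]
  rw [smul_comm]

lemma vOf_add (T : ℕ) (u u' : (σ → ℝ) × (κ → ℝ)) :
    vOf Cs Cw T (u + u') = vOf Cs Cw T u + vOf Cs Cw T u' := by
  simp only [vOf, Prod.fst_add, Prod.snd_add, mulVec_add, smul_add]
  abel

lemma WeakLimit.vOf_surjective (h : WeakLimit q Cs Cw As Aw L₁ L₂) {T : ℕ} (hT : 0 < T) :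
    Function.Surjective (vOf Cs Cw T) := by
  intro v
  have hs : √(T : ℝ) ≠ 0 := by positivity
  refine ⟨(√(T : ℝ) • As *ᵥ v, Aw *ᵥ v), ?_⟩
  rw [vOf, mulVec_smul, smul_smul, inv_mul_cancel₀ hs, one_smul, mulVec_mulVec, mulVec_mulVec,
    ← add_mulVec, h.complete, one_mulVec]

/-- Only `v` with `v 0 ≠ 0` correspond to a parameter. If `u₀` gives `v 0 = 0`, a small move along
the direction mapped to `e₀` repairs this without leaving the neighbourhood. -/
lemma WeakLimit.exists_vOf_ne_zero (h : WeakLimit q Cs Cw As Aw L₁ L₂) {T : ℕ} (hT : 0 < T)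
    {u₀ : (σ → ℝ) × (κ → ℝ)} {R : (σ → ℝ) × (κ → ℝ) → Prop} (hR : ∀ᶠ u in 𝓝 u₀, R u) :
    ∃ u, R u ∧ vOf Cs Cw T u 0 ≠ 0 := by
  by_cases h0 : vOf Cs Cw T u₀ 0 = 0
  · obtain ⟨d, hd⟩ := h.vOf_surjective hT (Pi.single 0 1)
    have hc : Tendsto (fun t : ℝ => u₀ + t • d) (𝓝[≠] 0) (𝓝 u₀) := by
      have : Continuous fun t : ℝ => u₀ + t • d := by fun_prop
      have h1 := this.tendsto 0
      rw [zero_smul, add_zero] at h1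
      exact h1.mono_left nhdsWithin_le_nhds
    obtain ⟨t, ht, ht0⟩ := ((hc.eventually hR).and self_mem_nhdsWithin).exists
    refine ⟨u₀ + t • d, ht, ?_⟩
    rw [vOf_add, vOf_smul, hd, Pi.add_apply, h0]
    simpa using ht0
  · exact ⟨u₀, hR.self_of_nhds, h0⟩

section Limit

variable {Qp : ℕ → Matrix (Fin (p + 1)) (Fin (p + 1)) ℝ}
  {Q : Matrix (Fin (p + 1)) (Fin (p + 1)) ℝ} {α : Type*} {l : Filter α} {T : α → ℕ}
  {Ψ : α → Matrix (Fin N) (Fin (p + 1)) ℝ} {Ψ₀ : Matrix (Fin N) (Fin (p + 1)) ℝ}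
  {Qh : α → Matrix (Fin (p + 1)) (Fin (p + 1)) ℝ}
  {D : α → Fin (p + 1) → Fin (p + 1) → Matrix (Fin N) (Fin N) ℝ}
  {D₀ : Fin (p + 1) → Fin (p + 1) → Matrix (Fin N) (Fin N) ℝ}
  {u : α → (σ → ℝ) × (κ → ℝ)} {u₀ : (σ → ℝ) × (κ → ℝ)}

/-- The limit of the scaled pricing errors. -/
def bLim (Cw : Matrix (Fin (p + 2)) κ ℝ) (L₁ : Matrix (Fin N) σ ℝ) (L₂ : Matrix (Fin N) κ ℝ)
    (Q : Matrix (Fin (p + 1)) (Fin (p + 1)) ℝ) (Ψ : Matrix (Fin N) (Fin (p + 1)) ℝ)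
    (u : (σ → ℝ) × (κ → ℝ)) : Fin N → ℝ :=
  L₁ *ᵥ u.1 + (L₂ + Ψ * Q * tailRows Cw) *ᵥ u.2

lemma tendsto_inv_sqrt (hT : Tendsto T l atTop) :
    Tendsto (fun a => (√(T a : ℝ))⁻¹) l (𝓝 0) :=
  tendsto_inv_atTop_zero.comp (Real.tendsto_sqrt_atTop.comp
    (tendsto_natCast_atTop_atTop.comp hT))

lemma tendsto_tail_vOf (hT : Tendsto T l atTop) (hu : Tendsto u l (𝓝 u₀)) :
    Tendsto (fun a => Fin.tail (vOf Cs Cw (T a) (u a))) l (𝓝 (tailRows Cw *ᵥ u₀.2)) := by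
  have hu1 : Tendsto (fun a => (u a).1) l (𝓝 u₀.1) := (continuous_fst.tendsto _).comp hu
  have hu2 : Tendsto (fun a => (u a).2) l (𝓝 u₀.2) := (continuous_snd.tendsto _).comp hu
  have h := ((tendsto_inv_sqrt hT).smul
    ((tendsto_const_nhds (x := tailRows Cs)).matrixMulVec hu1)).add
      ((tendsto_const_nhds (x := tailRows Cw)).matrixMulVec hu2)
  rw [zero_smul, zero_add] at h
  exact h

/-- The factor `√T` cancels the `T^{-1/2}` in front of `Cs` and is absorbed by the convergence of
`√T H Cw`. The strong coordinates drop out of the noise term, since they enter `tail v` only at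
order `T^{-1/2}`. -/
lemma WeakLimit.tendsto_bvec (h : WeakLimit q Cs Cw As Aw L₁ L₂)
    (hQp : Tendsto Qp atTop (𝓝 Q)) (hT : Tendsto T l atTop) (hΨ : Tendsto Ψ l (𝓝 Ψ₀))
    (hu : Tendsto u l (𝓝 u₀)) :
    Tendsto (fun a => bvec (q (T a)) (Qp (T a)) (T a) (Ψ a) (vOf Cs Cw (T a) (u a))) l
      (𝓝 (bLim Cw L₁ L₂ Q Ψ₀ u₀)) := by
  have hu1 : Tendsto (fun a => (u a).1) l (𝓝 u₀.1) := (continuous_fst.tendsto _).comp hu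
  have hu2 : Tendsto (fun a => (u a).2) l (𝓝 u₀.2) := (continuous_snd.tendsto _).comp hu
  have h1 := ((h.strong.comp hT).matrixMulVec hu1).add ((h.weak.comp hT).matrixMulVec hu2)
  have h2 := hΨ.matrixMulVec ((hQp.comp hT).matrixMulVec
    (tendsto_tail_vOf (Cs := Cs) (Cw := Cw) hT hu))
  have h3 := h1.add h2
  have e : L₁ *ᵥ u₀.1 + L₂ *ᵥ u₀.2 + Ψ₀ *ᵥ Q *ᵥ tailRows Cw *ᵥ u₀.2
      = bLim Cw L₁ L₂ Q Ψ₀ u₀ := by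
    rw [bLim, add_mulVec, mulVec_mulVec, mulVec_mulVec, add_assoc]
  rw [e] at h3
  refine h3.congr' ?_
  filter_upwards [hT.eventually_gt_atTop 0] with a ha
  have hs : √(T a : ℝ) ≠ 0 := by positivity
  simp only [Function.comp_apply, bvec]
  congr 1
  rw [vOf, mulVec_add, mulVec_smul, smul_add, smul_smul, mul_inv_cancel₀ hs, one_smul,
    mulVec_mulVec, mulVec_mulVec, smul_mulVec]

lemma tendsto_phivec (hQp : Tendsto Qp atTop (𝓝 Q)) (hQ : IsUnit Q.det) (hT : Tendsto T l atTop)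
    (hQh : Tendsto Qh l (𝓝 Q)) (hu : Tendsto u l (𝓝 u₀)) :
    Tendsto (fun a => phivec (Qp (T a)) (Qh a) (vOf Cs Cw (T a) (u a))) l
      (𝓝 (tailRows Cw *ᵥ u₀.2)) := by
  have h := (hQh.matrixInv hQ).matrixMulVec ((hQp.comp hT).matrixMulVec
    (tendsto_tail_vOf (Cs := Cs) (Cw := Cw) hT hu))
  rw [mulVec_mulVec _ Q⁻¹ Q, nonsing_inv_mul _ hQ, one_mulVec] at h
  exact h

lemma WeakLimit.tendsto_Smat (h : WeakLimit q Cs Cw As Aw L₁ L₂)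
    (hQp : Tendsto Qp atTop (𝓝 Q)) (hQ : IsUnit Q.det) (hT : Tendsto T l atTop)
    (hΨ : Tendsto Ψ l (𝓝 Ψ₀)) (hQh : Tendsto Qh l (𝓝 Q)) (hD : Tendsto D l (𝓝 D₀))
    (hu : Tendsto u l (𝓝 u₀)) :
    Tendsto (fun a => Smat (q (T a)) (Qp (T a)) (T a) (Ψ a) (Qh a) (D a) (vOf Cs Cw (T a) (u a))) l
      (𝓝 (quadOf D₀ (tailRows Cw *ᵥ u₀.2))) := by
  have hb := h.tendsto_bvec hQp hT hΨ hu
  have h1 := (tendsto_inv_atTop_nhds_zero_nat (𝕜 := ℝ).comp hT).smul (hb.matrixVecMulVec hb)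
  have h2 := (tendsto_quadOf hD (tendsto_phivec (Cs := Cs) (Cw := Cw) hQp hQ hT hQh hu)).add h1
  rw [zero_smul, add_zero] at h2
  exact h2

/-- Asymptotic lower bound for `AR`, uniformly in the parameter. -/
lemma WeakLimit.eventually_le_AR (h : WeakLimit q Cs Cw As Aw L₁ L₂)
    (hQp : Tendsto Qp atTop (𝓝 Q)) (hQ : IsUnit Q.det) (hT : Tendsto T l atTop)
    (hΨ : Tendsto Ψ l (𝓝 Ψ₀)) (hQh : Tendsto Qh l (𝓝 Q)) (hD : Tendsto D l (𝓝 D₀)) {c : ℝ}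
    (hc : ∀ u : (σ → ℝ) × (κ → ℝ), u ≠ 0 → ∃ d, c < 2 * (d ⬝ᵥ bLim Cw L₁ L₂ Q Ψ₀ u)
      - d ⬝ᵥ quadOf D₀ (tailRows Cw *ᵥ u.2) *ᵥ d) :
    ∀ᶠ a in l, ∀ x y, √(T a : ℝ) • (BHat x y (T a) - q (T a) * (Qp (T a))⁻¹) = Ψ a →
      QGHat y (T a) = Qh a → covData x y (T a) = D a →
      ∀ θ, IsUnit (SHat x y (T a) θ).det → c ≤ AR x y (T a) θ := by
  have hsph : ∀ u₀ ∈ Metric.sphere (0 : (σ → ℝ) × (κ → ℝ)) 1, ∀ᶠ z : α × ((σ → ℝ) × (κ → ℝ)) in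
      l ×ˢ 𝓝 u₀, ∃ d, c < 2 * (d ⬝ᵥ bvec (q (T z.1)) (Qp (T z.1)) (T z.1) (Ψ z.1)
        (vOf Cs Cw (T z.1) z.2)) - d ⬝ᵥ Smat (q (T z.1)) (Qp (T z.1)) (T z.1) (Ψ z.1) (Qh z.1)
          (D z.1) (vOf Cs Cw (T z.1) z.2) *ᵥ d := by
    intro u₀ hu₀
    obtain ⟨d, hd⟩ := hc u₀ (by rintro rfl; simp at hu₀)
    have hT' : Tendsto (fun z : α × ((σ → ℝ) × (κ → ℝ)) => T z.1) (l ×ˢ 𝓝 u₀) atTop :=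
      hT.comp tendsto_fst
    have hb := h.tendsto_bvec hQp hT' (hΨ.comp tendsto_fst) (tendsto_snd (f := l) (g := 𝓝 u₀))
    have hS := h.tendsto_Smat hQp hQ hT' (hΨ.comp tendsto_fst) (hQh.comp tendsto_fst)
      (hD.comp tendsto_fst) (tendsto_snd (f := l) (g := 𝓝 u₀))
    have hlim := ((tendsto_const_nhds (x := d)).dotProduct' hb).const_mul 2 |>.sub
      ((tendsto_const_nhds (x := d)).dotProduct' (hS.matrixMulVec (tendsto_const_nhds (x := d))))
    filter_upwards [hlim.eventually_const_lt hd] with z hz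
    exact ⟨d, hz⟩
  -- The dual vector `d` is fixed near each point of the sphere and may change between points;
  -- compactness makes the resulting bound uniform.
  have hsph' := eventually_forall_mem_compact
    (R := fun a u => ∃ d, c < 2 * (d ⬝ᵥ bvec (q (T a)) (Qp (T a)) (T a) (Ψ a)
        (vOf Cs Cw (T a) u)) - d ⬝ᵥ Smat (q (T a)) (Qp (T a)) (T a) (Ψ a) (Qh a)
          (D a) (vOf Cs Cw (T a) u) *ᵥ d)
    (isCompact_sphere (0 : (σ → ℝ) × (κ → ℝ)) 1) hsph
  filter_upwards [hsph',
    hT.eventually_gt_atTop 0, hQh.eventually_isUnit_det hQ,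
    (hQp.comp hT).eventually_isUnit_det hQ] with a ha hTa hQa hQpa x y h1 h2 h3 θ hθ
  rw [Function.comp_apply] at hQpa
  -- Homogeneous coordinates of the given `θ`, obtained by inverting the parametrization with `v 0 =
  -- 1`. Dividing by the norm of `u` below leaves `θ` unchanged and moves `u` to the unit sphere.
  let v : Fin (p + 2) → ℝ := Fin.cons 1 (-((Qp (T a))⁻¹ *ᵥ Qh a *ᵥ θ))
  obtain ⟨u, hu⟩ := h.vOf_surjective hTa v
  have hu0 : u ≠ 0 := by
    rintro rfl
    have h0 : vOf Cs Cw (T a) 0 = 0 := by simp [vOf]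
    have := congrFun (hu.symm.trans h0) 0
    simp [v] at this
  have hs : ‖u‖ ≠ 0 := norm_ne_zero_iff.2 hu0
  obtain ⟨d, hd⟩ := ha (‖u‖⁻¹ • u) (by
    rw [mem_sphere_zero_iff_norm, norm_smul, norm_inv, norm_norm, inv_mul_cancel₀ hs])
  rw [vOf_smul, hu] at hd
  have hv0 : (‖u‖⁻¹ • v) 0 = ‖u‖⁻¹ := by simp [v]
  have hv0' : (‖u‖⁻¹ • v) 0 ≠ 0 := by rw [hv0]; exact inv_ne_zero hs
  have hθ' : -((‖u‖⁻¹ • v) 0)⁻¹ • phivec (Qp (T a)) (QGHat y (T a)) (‖u‖⁻¹ • v) = θ := by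
    have ht : Fin.tail (‖u‖⁻¹ • v) = ‖u‖⁻¹ • -((Qp (T a))⁻¹ *ᵥ Qh a *ᵥ θ) := rfl
    rw [hv0, h2, phivec, ht, mulVec_smul, mulVec_smul, inv_inv, neg_smul, smul_smul,
      mul_inv_cancel₀ hs, one_smul, mulVec_neg, mulVec_neg, neg_neg, mulVec_mulVec _ (Qp (T a)),
      mul_nonsing_inv _ hQpa, one_mulVec, mulVec_mulVec, nonsing_inv_mul _ hQa, one_mulVec]
  have hle := le_AR hTa (by rwa [h2]) hQpa h1 hv0' (by rwa [hθ']) d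
  rw [hθ', h2, h3] at hle
  exact hd.le.trans hle

/-- Asymptotic upper bound for the infimum of `AR`. -/
lemma WeakLimit.eventually_exists_AR_lt (h : WeakLimit q Cs Cw As Aw L₁ L₂)
    (hQp : Tendsto Qp atTop (𝓝 Q)) (hQ : IsUnit Q.det) (hT : Tendsto T l atTop)
    (hΨ : Tendsto Ψ l (𝓝 Ψ₀)) (hQh : Tendsto Qh l (𝓝 Q)) (hD : Tendsto D l (𝓝 D₀)) {c : ℝ}
    (u₀ : (σ → ℝ) × (κ → ℝ)) (hdet : IsUnit (quadOf D₀ (tailRows Cw *ᵥ u₀.2)).det)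
    (hc : bLim Cw L₁ L₂ Q Ψ₀ u₀ ⬝ᵥ (quadOf D₀ (tailRows Cw *ᵥ u₀.2))⁻¹ *ᵥ bLim Cw L₁ L₂ Q Ψ₀ u₀
      < c) :
    ∀ᶠ a in l, ∀ x y, √(T a : ℝ) • (BHat x y (T a) - q (T a) * (Qp (T a))⁻¹) = Ψ a →
      QGHat y (T a) = Qh a → covData x y (T a) = D a →
      ∃ θ, IsUnit (SHat x y (T a) θ).det ∧ AR x y (T a) θ < c := by
  have hT' : Tendsto (fun z : α × ((σ → ℝ) × (κ → ℝ)) => T z.1) (l ×ˢ 𝓝 u₀) atTop :=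
    hT.comp tendsto_fst
  have hb := h.tendsto_bvec hQp hT' (hΨ.comp tendsto_fst) (tendsto_snd (f := l) (g := 𝓝 u₀))
  have hS := h.tendsto_Smat hQp hQ hT' (hΨ.comp tendsto_fst) (hQh.comp tendsto_fst)
    (hD.comp tendsto_fst) (tendsto_snd (f := l) (g := 𝓝 u₀))
  have hev := (hS.eventually_isUnit_det hdet).and
    ((hb.dotProduct' ((hS.matrixInv hdet).matrixMulVec hb)).eventually_lt_const hc)
  -- Currying keeps the bound on a whole neighbourhood of `u₀` for each index, leaving room to
  -- perturb `u₀` to a point with `v 0 ≠ 0`.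
  filter_upwards [hev.curry, hT.eventually_gt_atTop 0, hQh.eventually_isUnit_det hQ,
    (hQp.comp hT).eventually_isUnit_det hQ] with a ha hTa hQa hQpa x y h1 h2 h3
  obtain ⟨u, ⟨hu1, hu2⟩, hu0⟩ := h.exists_vOf_ne_zero hTa ha
  have hAR := AR_eq_Smat (x := x) (y := y) hTa (by rwa [h2]) hQpa h1 hu0
    (by rw [h2, h3]; exact hu1)
  refine ⟨_, hAR.1, ?_⟩
  rw [hAR.2, h2, h3]
  exact hu2

end Limit

end Core

/-! ### Minimizing the limiting AR statistic: the smallest Wishart eigenvalue -/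

section LimitValue

variable {N p m : ℕ} {σ κ : Type*} [Fintype σ] [DecidableEq σ] [Fintype κ] [DecidableEq κ]
  {Cw : Matrix (Fin (p + 2)) κ ℝ} {L₁ : Matrix (Fin N) σ ℝ} {L₂ : Matrix (Fin N) κ ℝ}
  {Q : Matrix (Fin (p + 1)) (Fin (p + 1)) ℝ} {Sig R : Matrix (Fin N) (Fin N) ℝ}
  {D₀ : Fin (p + 1) → Fin (p + 1) → Matrix (Fin N) (Fin N) ℝ} {G : Matrix κ κ ℝ}
  {W : Matrix (Fin m) (Fin N) ℝ} {Ψ : Matrix (Fin N) (Fin (p + 1)) ℝ}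

/-- On the orthogonal complement of the columns of `L₁`, the limiting covariance matrix of the
pricing errors in weakly identified directions has Kronecker structure. -/
def KroneckerOn (Cw : Matrix (Fin (p + 2)) κ ℝ) (L₁ : Matrix (Fin N) σ ℝ)
    (Q : Matrix (Fin (p + 1)) (Fin (p + 1)) ℝ) (Sig : Matrix (Fin N) (Fin N) ℝ)
    (D₀ : Fin (p + 1) → Fin (p + 1) → Matrix (Fin N) (Fin N) ℝ) : Prop :=
  ∀ z : κ → ℝ, z ≠ 0 → (quadOf D₀ (tailRows Cw *ᵥ z)).PosDef ∧
    ∀ y, L₁ᵀ *ᵥ y = 0 → y ⬝ᵥ quadOf D₀ (tailRows Cw *ᵥ z) *ᵥ y =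
      ((tailRows Cw *ᵥ z) ⬝ᵥ Q *ᵥ (tailRows Cw *ᵥ z)) * (y ⬝ᵥ Sig *ᵥ y)

lemma isUnit_det_of_mul_mul_transpose_eq_one {n : Type*} [Fintype n] [DecidableEq n]
    {A B C : Matrix n n ℝ} (h : A * B * C = 1) : IsUnit A.det ∧ IsUnit C.det := by
  have h1 := congrArg det h
  rw [det_mul, det_mul, det_one] at h1
  exact ⟨IsUnit.of_mul_eq_one (B.det * C.det) (by rw [← h1]; ring),
    IsUnit.of_mul_eq_one (A.det * B.det) (by rw [← h1]; ring)⟩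

lemma dotProduct_mulVec_congr (G : Matrix κ κ ℝ) (hG : Gᵀ * ((tailRows Cw)ᵀ * Q * tailRows Cw) * G
    = 1) (c : κ → ℝ) :
    (tailRows Cw *ᵥ G *ᵥ c) ⬝ᵥ Q *ᵥ (tailRows Cw *ᵥ G *ᵥ c) = c ⬝ᵥ c := by
  have h : c ⬝ᵥ (Gᵀ * ((tailRows Cw)ᵀ * Q * tailRows Cw) * G) *ᵥ c = c ⬝ᵥ c := by
    rw [hG, one_mulVec]
  rw [← h]
  simp only [← mulVec_mulVec, dotProduct_mulVec _ Gᵀ, vecMul_transpose,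
    dotProduct_mulVec _ (tailRows Cw)ᵀ]

lemma isUnit_det_gram (hL : ∀ c, L₁ *ᵥ c = 0 → c = 0) (hR : IsUnit R.det) :
    IsUnit ((R * L₁)ᵀ * (R * L₁)).det := by
  have hinj : Function.Injective (R * L₁).mulVec := by
    refine (injective_iff_map_eq_zero (R * L₁).mulVecLin).2 fun c hc => ?_
    have h1 : R *ᵥ L₁ *ᵥ c = 0 := by rw [mulVec_mulVec]; exact hc
    refine hL c ?_
    have h2 := congrArg (R⁻¹ *ᵥ ·) h1
    simpa [mulVec_mulVec, ← Matrix.mul_assoc, nonsing_inv_mul _ hR] using h2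
  have := PosDef.conjTranspose_mul_self (R * L₁) hinj
  rw [conjTranspose_eq_transpose_of_trivial] at this
  exact (isUnit_iff_isUnit_det _).1 this.isUnit

lemma mul_eq_zero_of_annihilator {X : Matrix (Fin N) σ ℝ} (hX : IsUnit (Xᵀ * X).det)
    (hW1 : W * Wᵀ = 1) (hW2 : Wᵀ * W = annihilator X) : W * X = 0 := by
  rw [← Matrix.one_mul W, ← hW1, Matrix.mul_assoc, Matrix.mul_assoc, ← Matrix.mul_assoc Wᵀ, hW2,
    annihilator_mul_self _ hX, Matrix.mul_zero]

/-- The Wishart root matrix in the limit. -/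
def rootLim (Cw : Matrix (Fin (p + 2)) κ ℝ) (L₂ : Matrix (Fin N) κ ℝ)
    (Q : Matrix (Fin (p + 1)) (Fin (p + 1)) ℝ) (Ψ : Matrix (Fin N) (Fin (p + 1)) ℝ)
    (W : Matrix (Fin m) (Fin N) ℝ) (R : Matrix (Fin N) (Fin N) ℝ) (G : Matrix κ κ ℝ) :
    Matrix (Fin m) κ ℝ :=
  W * R * (L₂ + Ψ * Q * tailRows Cw) * G

/-- Lower half of the minimization. Dual vectors orthogonal to the columns of `L₁` do not see `w`,
and on them the covariance is a multiple of `Sig`; the best such vector gives a Rayleigh quotient of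
the Wishart matrix. -/
lemma exists_lt_of_lt_minEigenvalue (hK : KroneckerOn Cw L₁ Q Sig D₀)
    (hL : ∀ c, L₁ *ᵥ c = 0 → c = 0) (hR : R * Sig * Rᵀ = 1)
    (hG : Gᵀ * ((tailRows Cw)ᵀ * Q * tailRows Cw) * G = 1) (hW1 : W * Wᵀ = 1)
    (hW2 : Wᵀ * W = annihilator (R * L₁)) {c : ℝ}
    (hc : c < minEigenvalue (wishart (rootLim Cw L₂ Q Ψ W R G)))
    (u : (σ → ℝ) × (κ → ℝ)) (hu : u ≠ 0) : ∃ d, c < 2 * (d ⬝ᵥ bLim Cw L₁ L₂ Q Ψ u)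
      - d ⬝ᵥ quadOf D₀ (tailRows Cw *ᵥ u.2) *ᵥ d := by
  obtain ⟨w, z⟩ := u
  have hRu := (isUnit_det_of_mul_mul_transpose_eq_one hR).1
  by_cases hz : z = 0
  · subst hz
    have hw : w ≠ 0 := fun h => hu (by rw [h]; rfl)
    have hb : L₁ *ᵥ w ≠ 0 := fun h => hw (hL w h)
    have hbb : (L₁ *ᵥ w) ⬝ᵥ (L₁ *ᵥ w) ≠ 0 := fun h => hb (dotProduct_self_eq_zero.1 h)
    -- With `z = 0` the quadratic term vanishes while `L₁ w ≠ 0`, so a multiple of `L₁ w` reaches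
    -- any value; this one gives exactly `c + 1`.
    refine ⟨((c + 1) / (2 * ((L₁ *ᵥ w) ⬝ᵥ (L₁ *ᵥ w)))) • L₁ *ᵥ w, ?_⟩
    simp only [bLim, mulVec_zero, add_zero, quadOf_zero, zero_mulVec, dotProduct_zero, sub_zero,
      smul_dotProduct, smul_eq_mul]
    have : 2 * ((c + 1) / (2 * ((L₁ *ᵥ w) ⬝ᵥ (L₁ *ᵥ w))) * ((L₁ *ᵥ w) ⬝ᵥ (L₁ *ᵥ w))) = c + 1 := by
      field_simp
    rw [this]
    linarith
  · have hGu := (isUnit_det_of_mul_mul_transpose_eq_one hG).2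
    set a := G⁻¹ *ᵥ z with ha
    have hza : z = G *ᵥ a := by rw [ha, mulVec_mulVec, mul_nonsing_inv _ hGu, one_mulVec]
    have ha0 : a ≠ 0 := by
      rintro h
      exact hz (by rw [hza, h, mulVec_zero])
    set n := a ⬝ᵥ a with hn
    have hn0 : 0 < n := by
      simpa using dotProduct_star_self_pos_iff.2 ha0
    have hWX := mul_eq_zero_of_annihilator (isUnit_det_gram hL hRu) hW1 hW2
    set e := rootLim Cw L₂ Q Ψ W R G *ᵥ a with he
    have he' : e = W *ᵥ R *ᵥ (L₂ + Ψ * Q * tailRows Cw) *ᵥ z := by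
      rw [he, hza, rootLim]
      simp only [mulVec_mulVec, Matrix.mul_assoc]
    have hle : minEigenvalue (wishart (rootLim Cw L₂ Q Ψ W R G)) * n ≤ e ⬝ᵥ e :=
      (minEigenvalue_mul_le (isHermitian_wishart (rootLim Cw L₂ Q Ψ W R G)) a).trans_eq
        (dotProduct_wishart _ a)
    -- On vectors `Rᵀ Wᵀ x` the dual objective is `2 x'e - n x'x`. Its maximizer `x = e / n` gives
    -- the value `e'e / n`.
    refine ⟨n⁻¹ • Rᵀ *ᵥ Wᵀ *ᵥ e, ?_⟩
    have hd0 : L₁ᵀ *ᵥ (Rᵀ *ᵥ Wᵀ *ᵥ e) = 0 := by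
      rw [mulVec_mulVec, mulVec_mulVec, ← transpose_mul, ← transpose_mul, hWX,
        transpose_zero, zero_mulVec]
    have hd1 : (Rᵀ *ᵥ Wᵀ *ᵥ e) ⬝ᵥ bLim Cw L₁ L₂ Q Ψ (w, z) = e ⬝ᵥ e := by
      rw [bLim, dotProduct_add]
      have h1 : (Rᵀ *ᵥ Wᵀ *ᵥ e) ⬝ᵥ L₁ *ᵥ w = 0 := by
        rw [dotProduct_mulVec, ← mulVec_transpose, hd0, zero_dotProduct]
      rw [h1, zero_add, mulVec_transpose R, mulVec_transpose W, ← dotProduct_mulVec,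
        ← dotProduct_mulVec, ← he']
    have hd2 : (Rᵀ *ᵥ Wᵀ *ᵥ e) ⬝ᵥ Sig *ᵥ (Rᵀ *ᵥ Wᵀ *ᵥ e) = e ⬝ᵥ e := by
      have h1 : (Rᵀ *ᵥ Wᵀ *ᵥ e) ⬝ᵥ Sig *ᵥ (Rᵀ *ᵥ Wᵀ *ᵥ e)
          = e ⬝ᵥ (W * (R * Sig * Rᵀ) * Wᵀ) *ᵥ e := by
        simp only [← mulVec_mulVec]
        rw [mulVec_transpose R, mulVec_transpose W, ← dotProduct_mulVec, ← dotProduct_mulVec]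
      rw [h1, hR, Matrix.mul_one, hW1, one_mulVec]
    have hd3 := (hK z hz).2 _ hd0
    have hzQ : (tailRows Cw *ᵥ z) ⬝ᵥ Q *ᵥ (tailRows Cw *ᵥ z) = n := by
      rw [hza, dotProduct_mulVec_congr G hG]
    rw [hd2, hzQ] at hd3
    simp only [mulVec_smul, smul_dotProduct, dotProduct_smul, smul_eq_mul, hd1, hd3]
    have hval : 2 * (n⁻¹ * (e ⬝ᵥ e)) - n⁻¹ * (n⁻¹ * (n * (e ⬝ᵥ e))) = (e ⬝ᵥ e) / n := by
      field_simp
      ring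
    rw [hval, lt_div_iff₀ hn0]
    exact (mul_lt_mul_of_pos_right hc hn0).trans_le hle

/-- Upper half of the minimization: `z` comes from a unit eigenvector for the smallest eigenvalue
and `w` from generalized least squares. -/
lemma exists_le_minEigenvalue [Nonempty κ] (hK : KroneckerOn Cw L₁ Q Sig D₀)
    (hL : ∀ c, L₁ *ᵥ c = 0 → c = 0) (hR : R * Sig * Rᵀ = 1)
    (hG : Gᵀ * ((tailRows Cw)ᵀ * Q * tailRows Cw) * G = 1)
    (hW2 : Wᵀ * W = annihilator (R * L₁)) :
    ∃ u : (σ → ℝ) × (κ → ℝ), IsUnit (quadOf D₀ (tailRows Cw *ᵥ u.2)).det ∧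
      bLim Cw L₁ L₂ Q Ψ u ⬝ᵥ (quadOf D₀ (tailRows Cw *ᵥ u.2))⁻¹ *ᵥ bLim Cw L₁ L₂ Q Ψ u
        ≤ minEigenvalue (wishart (rootLim Cw L₂ Q Ψ W R G)) := by
  obtain ⟨a, ha1, ha2⟩ := exists_dotProduct_eq_minEigenvalue
    (isHermitian_wishart (rootLim Cw L₂ Q Ψ W R G))
  have hGu := (isUnit_det_of_mul_mul_transpose_eq_one hG).2
  have hRu := (isUnit_det_of_mul_mul_transpose_eq_one hR).1
  set e := rootLim Cw L₂ Q Ψ W R G *ᵥ a with he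
  replace ha2 : e ⬝ᵥ e = _ := (dotProduct_wishart _ a).symm.trans ha2
  set z := G *ᵥ a with hz
  have he' : e = W *ᵥ R *ᵥ (L₂ + Ψ * Q * tailRows Cw) *ᵥ z := by
    rw [he, hz, rootLim]
    simp only [mulVec_mulVec, Matrix.mul_assoc]
  have hz0 : z ≠ 0 := by
    intro h
    have : a = 0 := by
      have h1 := congrArg (G⁻¹ *ᵥ ·) (hz.symm.trans h)
      simpa [mulVec_mulVec, nonsing_inv_mul _ hGu] using h1
    rw [this] at ha1
    simp at ha1
  obtain ⟨hV, hVe⟩ := hK z hz0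
  set S := quadOf D₀ (tailRows Cw *ᵥ z) with hS
  have hSu : IsUnit S.det := (isUnit_iff_isUnit_det _).1 hV.isUnit
  have hLinj : Function.Injective L₁.mulVec :=
    (injective_iff_map_eq_zero L₁.mulVecLin).2 fun c hc => hL c hc
  have hLVL : IsUnit (L₁ᵀ * S⁻¹ * L₁).det := by
    have := hV.inv.conjTranspose_mul_mul_same hLinj
    rw [conjTranspose_eq_transpose_of_trivial] at this
    exact (isUnit_iff_isUnit_det _).1 this.isUnit
  set b₀ := (L₂ + Ψ * Q * tailRows Cw) *ᵥ z with hb₀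
  -- The minimizer of `b' S⁻¹ b` over `w`. Its first-order condition says that `y = S⁻¹ b` is
  -- orthogonal to the columns of `L₁`, which is where the Kronecker form of `S` is available.
  let w := -((L₁ᵀ * S⁻¹ * L₁)⁻¹ *ᵥ L₁ᵀ *ᵥ S⁻¹ *ᵥ b₀)
  refine ⟨(w, z), hSu, ?_⟩
  change bLim Cw L₁ L₂ Q Ψ (w, z) ⬝ᵥ S⁻¹ *ᵥ bLim Cw L₁ L₂ Q Ψ (w, z) ≤ _
  set b := bLim Cw L₁ L₂ Q Ψ (w, z) with hb
  have hbe : b = L₁ *ᵥ w + b₀ := rfl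
  set y := S⁻¹ *ᵥ b with hy
  have hLy : L₁ᵀ *ᵥ y = 0 := by
    have h1 : L₁ᵀ *ᵥ S⁻¹ *ᵥ L₁ *ᵥ w = -(L₁ᵀ *ᵥ S⁻¹ *ᵥ b₀) := by
      rw [mulVec_mulVec, mulVec_mulVec]
      change _ *ᵥ (-_) = _
      rw [mulVec_neg, mulVec_mulVec, mul_nonsing_inv _ hLVL, one_mulVec]
    rw [hy, hbe, mulVec_add, mulVec_add, h1, neg_add_cancel]
  have hval := dotProduct_inv_mulVec_eq hSu b
  rw [← hy, hVe y hLy, hz, dotProduct_mulVec_congr G hG, ha1, one_mul] at hval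
  rw [hval]
  have hRT : IsUnit (Rᵀ).det := by rwa [det_transpose]
  set s := (Rᵀ)⁻¹ *ᵥ y with hs
  have hys : y = Rᵀ *ᵥ s := by rw [hs, mulVec_mulVec, mul_nonsing_inv _ hRT, one_mulVec]
  -- Orthogonality of `y` to `L₁` puts `s` in the range of the annihilator, so nothing is lost by
  -- compressing with `W`. The value becomes `2 (W s)'e - (W s)'(W s)`, at most `e'e` by completing
  -- the square.
  have hWs : Wᵀ *ᵥ W *ᵥ s = s := by
    rw [mulVec_mulVec, hW2]
    refine annihilator_mulVec_of_orthogonal _ _ ?_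
    rw [transpose_mul, ← mulVec_mulVec, ← hys, hLy]
  have h1 : y ⬝ᵥ b = (W *ᵥ s) ⬝ᵥ e := by
    have h2 : y ⬝ᵥ L₁ *ᵥ w = 0 := by
      rw [dotProduct_mulVec, ← mulVec_transpose, hLy, zero_dotProduct]
    rw [hbe, dotProduct_add, h2, zero_add, hys, mulVec_transpose R, ← dotProduct_mulVec]
    conv_lhs => rw [← hWs]
    rw [mulVec_transpose W, ← dotProduct_mulVec, he']
  have h2 : y ⬝ᵥ Sig *ᵥ y = (W *ᵥ s) ⬝ᵥ (W *ᵥ s) := by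
    have h3 : y ⬝ᵥ Sig *ᵥ y = s ⬝ᵥ (R * Sig * Rᵀ) *ᵥ s := by
      simp only [← mulVec_mulVec]
      rw [hys, mulVec_transpose R, ← dotProduct_mulVec]
    rw [h3, hR, one_mulVec]
    conv_lhs => rw [← hWs, mulVec_transpose W, ← dotProduct_mulVec, ← mulVec_transpose, hWs]
  rw [h1, h2, ← ha2]
  have h3 : 0 ≤ (e - W *ᵥ s) ⬝ᵥ (e - W *ᵥ s) := by
    simpa using dotProduct_star_self_nonneg (e - W *ᵥ s)
  rw [sub_dotProduct, dotProduct_sub, dotProduct_sub, dotProduct_comm e (W *ᵥ s)] at h3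
  linarith

end LimitValue

instance {m n : Type*} [Finite m] [Finite n] : FirstCountableTopology (Matrix m n ℝ) :=
  inferInstanceAs (FirstCountableTopology (m → n → ℝ))

/-! ### Identification of the covariance and the limit law of `J` -/

section LimitLaw

variable {Ω : Type*} [MeasurableSpace Ω] {P : Measure Ω} {N p : ℕ}
  {r : ℕ → ℕ → Ω → Fin N → ℝ} {g : ℕ → ℕ → Ω → Fin p → ℝ}
  {Q : Matrix (Fin (p + 1)) (Fin (p + 1)) ℝ} {Sig : Matrix (Fin N) (Fin N) ℝ}
  {V : (Fin (p + 1) → ℝ) → Matrix (Fin N) (Fin N) ℝ}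

lemma ConvProb.comp_continuousAt {F G : Type*} [TopologicalSpace F] [TopologicalSpace G]
    {Y : ℕ → Ω → F} {c : F} (hY : ConvProb P Y c) {f : F → G} (hf : ContinuousAt f c) :
    ConvProb P (fun T ω => f (Y T ω)) (f c) :=
  fun U hU => hY (f ⁻¹' U) (hf hU)

lemma convProb_unit : ConvProb P (fun (_ : ℕ) (_ : Ω) => ()) () := by
  intro U hU
  simp [mem_of_mem_nhds hU]

/-- The limit of `covData`. -/
def covLim (V : (Fin (p + 1) → ℝ) → Matrix (Fin N) (Fin N) ℝ) :
    Fin (p + 1) → Fin (p + 1) → Matrix (Fin N) (Fin N) ℝ :=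
  fun a b => V (Pi.single a 1 + Pi.single b 1)

variable [IsProbabilityMeasure P]

lemma ConsistentVariance.convProb_covData (hV : ConsistentVariance P r g V) :
    ConvProb P (fun T ω => covData (fun t => r T t ω) (fun t => g T t ω) T) (covLim V) :=
  ConvProb.pi fun _ => ConvProb.pi fun _ => ConvProb.pi fun i => ConvProb.pi fun j =>
    ConvProb.of_tendstoInMeasure (hV.consistent _ i j)

lemma HomoskedasticLimit.convProb_QGHat (h : HomoskedasticLimit P r g Q Sig) :
    ConvProb P (fun T ω => QGHat (fun t => g T t ω) T) Q :=
  ConvProb.pi fun i => ConvProb.pi fun j => ConvProb.of_tendstoInMeasure (h.consistent_Q i j)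

/-- The quadratic dependence on `θ` passes from the sample covariance to `V` by uniqueness of limits
in probability. -/
lemma ConsistentVariance.eq_quadOf (hV : ConsistentVariance P r g V) (θ : Fin (p + 1) → ℝ) :
    V θ = quadOf (covLim V) θ := by
  ext i j
  refine ConvProb.unique (P := P) (ConvProb.of_tendstoInMeasure (hV.consistent θ i j)) ?_
  have hc : ContinuousAt (fun D : Fin (p + 1) → Fin (p + 1) → Matrix (Fin N) (Fin N) ℝ =>
      quadOf D θ i j) (covLim V) :=
    ((continuous_quadOf.comp (Continuous.prodMk_left θ)).matrix_elem i j).continuousAt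
  have h := hV.convProb_covData.comp_continuousAt hc
  simpa only [← covHat_eq_quadOf] using h

lemma HomoskedasticLimit.isUnit_det_Q (h : HomoskedasticLimit P r g Q Sig) : IsUnit Q.det :=
  (isUnit_iff_isUnit_det _).1 h.posDef_Q.isUnit

variable {σ κ : Type*} [Fintype σ] [Fintype κ]
  {Cs : Matrix (Fin (p + 2)) σ ℝ} {Cw : Matrix (Fin (p + 2)) κ ℝ}
  {As : Matrix σ (Fin (p + 2)) ℝ} {Aw : Matrix κ (Fin (p + 2)) ℝ} {L₁ : Matrix (Fin N) σ ℝ}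
  {L₂ : Matrix (Fin N) κ ℝ}

/-- If the tail of `Cw z` vanishes, then `H Cw z` is the constant vector with entries `(Cw z) 0`.
Since `√T` times this vector converges, that coordinate is zero as well, and injectivity of `Cw`
applies. -/
lemma WeakLimit.tailRows_injective {q : ℕ → Matrix (Fin N) (Fin (p + 1)) ℝ} (hN : 0 < N)
    (h : WeakLimit q Cs Cw As Aw L₁ L₂) {z : κ → ℝ} (hz : tailRows Cw *ᵥ z = 0) : z = 0 := by
  refine h.injective z ?_
  have htail : Fin.tail (Cw *ᵥ z) = 0 := hz
  have h1 : ∀ T : ℕ, (√(T : ℝ) • (Hof (q T) * Cw)) *ᵥ z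
      = fun _ => √(T : ℝ) * (Cw *ᵥ z) 0 := by
    intro T
    rw [smul_mulVec, ← mulVec_mulVec, Hof_mulVec, htail, mulVec_zero, add_zero]
    rfl
  have h2 := h.weak.matrixMulVec (tendsto_const_nhds (x := z))
  simp_rw [h1] at h2
  have h3 := (tendsto_inv_sqrt (T := id) tendsto_id).mul (tendsto_pi_nhds.1 h2 ⟨0, hN⟩)
  rw [zero_mul] at h3
  have h4 : (Cw *ᵥ z) 0 = 0 := by
    refine tendsto_nhds_unique (tendsto_const_nhds.congr' ?_) h3
    filter_upwards [eventually_gt_atTop 0] with T hT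
    have hs : √(T : ℝ) ≠ 0 := by positivity
    simp only [id]
    rw [inv_mul_cancel_left₀ hs]
  ext i
  refine Fin.cases h4 (fun j => ?_) i
  exact congrFun htail j

variable [DecidableEq σ]

lemma WeakLimit.isUnit_gram {q : ℕ → Matrix (Fin N) (Fin (p + 1)) ℝ}
    (h : WeakLimit q Cs Cw As Aw L₁ L₂) : IsUnit (L₁ᵀ * L₁).det := by
  have := isUnit_det_gram (R := 1) h.full (by simp)
  simpa using this

lemma WeakLimit.tendsto_annihilator {q : ℕ → Matrix (Fin N) (Fin (p + 1)) ℝ}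
    (h : WeakLimit q Cs Cw As Aw L₁ L₂) :
    Tendsto (fun T => annihilator (Hof (q T) * Cs)) atTop (𝓝 (annihilator L₁)) := by
  have ht : Tendsto (fun T => (Hof (q T) * Cs)ᵀ) atTop (𝓝 L₁ᵀ) :=
    (continuous_id.matrix_transpose.tendsto L₁).comp h.strong
  exact tendsto_const_nhds.sub
    ((h.strong.matrixMul ((ht.matrixMul h.strong).matrixInv h.isUnit_gram)).matrixMul ht)

/-- Uniqueness of the limit law of `√T (e_T(θ) - e(θ))` identifies the limiting covariance. -/
theorem WeakLimit.dotProduct_mulVec_eq (hdata : ∀ T, StationaryData P (r T) (g T))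
    (hpsi : HomoskedasticLimit P r g Q Sig) (hV : ConsistentVariance P r g V) (hN : 0 < N)
    (h : WeakLimit (fun T => qPop P (r T) (g T)) Cs Cw As Aw L₁ L₂) {z : κ → ℝ} (hz : z ≠ 0)
    {y : Fin N → ℝ} (hy : L₁ᵀ *ᵥ y = 0) :
    y ⬝ᵥ V (tailRows Cw *ᵥ z) *ᵥ y =
      ((tailRows Cw *ᵥ z) ⬝ᵥ Q *ᵥ (tailRows Cw *ᵥ z)) * (y ⬝ᵥ Sig *ᵥ y) := by
  set φ := tailRows Cw *ᵥ z with hφ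
  have hφ0 : φ ≠ 0 := fun h0 => hz (h.tailRows_injective hN h0)
  clear_value φ
  have hVpos := (hV.posDef φ hφ0).posSemidef
  have hKr := hpsi.posDef_Q.inv.posSemidef.kronecker hpsi.posDef_Sig.posSemidef
  have hMy : annihilator L₁ *ᵥ y = y := annihilator_mulVec_of_orthogonal _ _ hy
  have hyM : ∀ v, y ⬝ᵥ annihilator L₁ *ᵥ v = y ⬝ᵥ v := fun v => by
    rw [dotProduct_mulVec, ← mulVec_transpose, transpose_annihilator, hMy]
  -- The scaled error contains `√T q (Q_T⁻¹ Q̂ - 1) φ`, which need not be bounded. Projecting off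
  -- the columns of `H Cs` at each `T` removes its strongly identified part exactly; in the limit
  -- the projection fixes `y`.
  let M : ℕ → Matrix (Fin N) (Fin N) ℝ := fun T => annihilator (Hof (qPop P (r T) (g T)) * Cs)
  have hM : Tendsto M atTop (𝓝 (annihilator L₁)) := h.tendsto_annihilator
  let X : ℕ → Ω → Fin N → ℝ := fun T ω => √(T : ℝ) •
    (errBar (fun t => r T t ω) (fun t => g T t ω) T φ - errPop P (r T) (g T) φ)
  let S : ℕ → Ω → ℝ := fun T ω => y ⬝ᵥ M T *ᵥ X T ω
  have hSm : ∀ T, Measurable (S T) := by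
    intro T
    have hc : Continuous fun v : Fin N → ℝ => y ⬝ᵥ M T *ᵥ v :=
      continuous_const.dotProduct (continuous_const.matrix_mulVec continuous_id)
    refine hc.measurable.comp (measurable_pi_lambda _ fun i => ?_)
    exact ((measurable_errBar (hdata T).measurable_r (hdata T).measurable_g T φ i).sub_const
      _).const_mul _
  have h1 : TendstoInDistribution S atTop (fun x : EuclideanSpace ℝ (Fin N) => y ⬝ᵥ x.ofLp)
      (fun _ => P) (multivariateGaussian 0 (V φ)) := by
    have hcy : Continuous fun x : EuclideanSpace ℝ (Fin N) => y ⬝ᵥ x.ofLp :=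
      continuous_const.dotProduct (by fun_prop)
    refine tendstoInDistribution_of_eventually (hV.tendsto_err φ) convProb_unit
      (fun T => (hSm T).aemeasurable) hcy.measurable.aemeasurable fun ω' U hU => ?_
    have hlim : Tendsto (fun zz : ℕ × EuclideanSpace ℝ (Fin N) × Unit =>
        y ⬝ᵥ M zz.1 *ᵥ zz.2.1.ofLp) (atTop ×ˢ 𝓝 (id ω') ×ˢ 𝓝 ()) (𝓝 (y ⬝ᵥ ω'.ofLp)) := by
      have hx : Tendsto (fun zz : ℕ × EuclideanSpace ℝ (Fin N) × Unit => zz.2.1.ofLp)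
          (atTop ×ˢ 𝓝 (id ω') ×ˢ 𝓝 ()) (𝓝 ω'.ofLp) :=
        ((PiLp.continuous_ofLp 2 _).tendsto ω').comp (tendsto_fst.comp tendsto_snd)
      have := (tendsto_const_nhds (x := y)).dotProduct'
        ((hM.comp (tendsto_fst (f := atTop) (g := 𝓝 (id ω') ×ˢ 𝓝 ()))).matrixMulVec hx)
      rwa [hyM] at this
    filter_upwards [hlim hU] with zz hzz ω hω _
    have : zz.2.1.ofLp = X zz.1 ω := by rw [← hω]
    rw [Set.mem_preimage, this] at hzz
    exact hzz
  have h2 : TendstoInDistribution S atTop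
      (fun x : EuclideanSpace ℝ (Fin (p + 1) × Fin N) => -(vec (vecMulVec y (Q *ᵥ φ))) ⬝ᵥ x.ofLp)
      (fun _ => P) (multivariateGaussian 0 (Q⁻¹ ⊗ₖ Sig)) := by
    have hcy : Continuous fun x : EuclideanSpace ℝ (Fin (p + 1) × Fin N) =>
        -(vec (vecMulVec y (Q *ᵥ φ))) ⬝ᵥ x.ofLp :=
      continuous_const.dotProduct (by fun_prop)
    refine tendstoInDistribution_of_eventually hpsi.tendsto_psi hpsi.convProb_QGHat
      (fun T => (hSm T).aemeasurable) hcy.measurable.aemeasurable fun ω' U hU => ?_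
    set l : Filter (ℕ × EuclideanSpace ℝ (Fin (p + 1) × Fin N) ×
      Matrix (Fin (p + 1)) (Fin (p + 1)) ℝ) := atTop ×ˢ 𝓝 (id ω') ×ˢ 𝓝 Q with hl
    have hT : Tendsto (fun zz : ℕ × EuclideanSpace ℝ (Fin (p + 1) × Fin N) ×
        Matrix (Fin (p + 1)) (Fin (p + 1)) ℝ => zz.1) l atTop := tendsto_fst
    have hΨ : Tendsto (fun zz : ℕ × EuclideanSpace ℝ (Fin (p + 1) × Fin N) ×
        Matrix (Fin (p + 1)) (Fin (p + 1)) ℝ => unvec zz.2.1) l (𝓝 (unvec ω')) :=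
      (continuous_unvec.tendsto ω').comp (tendsto_fst.comp tendsto_snd)
    have hQh : Tendsto (fun zz : ℕ × EuclideanSpace ℝ (Fin (p + 1) × Fin N) ×
        Matrix (Fin (p + 1)) (Fin (p + 1)) ℝ => zz.2.2) l (𝓝 Q) := tendsto_snd.comp tendsto_snd
    have hQi := hpsi.isUnit_det_Q
    -- Here `η` is the estimation error of `Q` applied to `φ`, with a zero in front. Its weakly
    -- identified part is multiplied by the convergent `√T H Cw`, so consistency without a rate
    -- makes it vanish.
    have hη : Tendsto (fun zz : ℕ × EuclideanSpace ℝ (Fin (p + 1) × Fin N) ×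
        Matrix (Fin (p + 1)) (Fin (p + 1)) ℝ =>
        (Fin.cons 0 (((QGPop P (g zz.1))⁻¹ * zz.2.2 - 1) *ᵥ φ) : Fin (p + 2) → ℝ)) l (𝓝 0) := by
      have ha := ((((hpsi.tendsto_Q.comp hT).matrixInv hQi).matrixMul hQh).sub
        (tendsto_const_nhds (x := (1 : Matrix (Fin (p + 1)) (Fin (p + 1)) ℝ)))).matrixMulVec
          (tendsto_const_nhds (x := φ))
      rw [nonsing_inv_mul _ hQi, sub_self, zero_mulVec] at ha
      refine tendsto_pi_nhds.2 fun i => ?_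
      refine Fin.cases ?_ (fun j => ?_) i
      · simp
      · simpa using tendsto_pi_nhds.1 ha j
    have hlim := (tendsto_const_nhds (x := y)).dotProduct' ((hM.comp hT).matrixMulVec
      ((((h.weak.comp hT).matrixMulVec ((tendsto_const_nhds (x := Aw)).matrixMulVec hη)).add
        (hΨ.matrixMulVec (hQh.matrixMulVec (tendsto_const_nhds (x := φ))))).neg))
    have hlimval : y ⬝ᵥ annihilator L₁ *ᵥ -(L₂ *ᵥ Aw *ᵥ 0 + unvec ω' *ᵥ Q *ᵥ φ)
        = -(vec (vecMulVec y (Q *ᵥ φ))) ⬝ᵥ ω'.ofLp := by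
      rw [hyM, mulVec_zero, mulVec_zero, zero_add, dotProduct_neg, neg_dotProduct]
      congr 1
      rw [← vec_unvec ω', vec_dotProduct_vec, transpose_vecMulVec, vecMulVec_mul,
        trace_vecMulVec, dotProduct_mulVec, dotProduct_comm]
    rw [hlimval] at hlim
    have hstT := (continuous_id.matrix_transpose.tendsto L₁).comp (h.strong.comp hT)
    filter_upwards [hlim hU, hT.eventually_gt_atTop 0, hQh.eventually_isUnit_det hQi,
      (hpsi.tendsto_Q.comp hT).eventually_isUnit_det hQi,
      ((hstT.matrixMul (h.strong.comp hT)).eventually_isUnit_det h.isUnit_gram)] with zz hzz hT0 hdet hdet' hgr ω hω1 hω2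
    rw [Function.comp_apply] at hdet'
    have hΨe : √(zz.1 : ℝ) • (BHat (fun t => r zz.1 t ω) (fun t => g zz.1 t ω) zz.1 -
        qPop P (r zz.1) (g zz.1) * (QGPop P (g zz.1))⁻¹) = unvec zz.2.1 := by
      rw [← hω1]; rfl
    have hq := qHat_eq_of_psi hT0 (by rw [hω2]; exact hdet) hΨe
    have hs : √(zz.1 : ℝ) ≠ 0 := by positivity
    have hX : X zz.1 ω = -(√(zz.1 : ℝ) • Hof (qPop P (r zz.1) (g zz.1)) *ᵥ
        (Fin.cons 0 (((QGPop P (g zz.1))⁻¹ * zz.2.2 - 1) *ᵥ φ) : Fin (p + 2) → ℝ)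
        + unvec zz.2.1 *ᵥ zz.2.2 *ᵥ φ) := by
      have e1 : X zz.1 ω = -(√(zz.1 : ℝ) •
          (qHat (fun t => r zz.1 t ω) (fun t => g zz.1 t ω) zz.1 *ᵥ φ -
            qPop P (r zz.1) (g zz.1) *ᵥ φ)) := by
        change √(zz.1 : ℝ) • (errBar _ _ _ _ - errPop _ _ _ _) = _
        rw [errBar, errPop, ← smul_neg]
        congr 1
        abel
      rw [e1, hq, hω2, Hof_mulVec]
      have e2 : Fin.tail (Fin.cons 0 (((QGPop P (g zz.1))⁻¹ * zz.2.2 - 1) *ᵥ φ) : Fin (p + 2) → ℝ)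
          = ((QGPop P (g zz.1))⁻¹ * zz.2.2 - 1) *ᵥ φ := rfl
      have e3 : (fun _ : Fin N => (Fin.cons 0 (((QGPop P (g zz.1))⁻¹ * zz.2.2 - 1) *ᵥ φ) :
          Fin (p + 2) → ℝ) 0) = 0 := rfl
      rw [e2, e3, zero_add]
      congr 1
      simp only [Matrix.add_mul, add_mulVec, sub_mulVec, one_mulVec, mulVec_sub, Matrix.smul_mul,
        smul_mulVec, ← mulVec_mulVec, smul_sub, smul_add, smul_smul, mul_inv_cancel₀ hs, one_smul]
      abel
    have hMC : M zz.1 * (Hof (qPop P (r zz.1) (g zz.1)) * Cs) = 0 := annihilator_mul_self _ hgr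
    have hdec : ∀ η : Fin (p + 2) → ℝ, M zz.1 *ᵥ (√(zz.1 : ℝ) •
        Hof (qPop P (r zz.1) (g zz.1)) *ᵥ η) = M zz.1 *ᵥ
          ((√(zz.1 : ℝ) • (Hof (qPop P (r zz.1) (g zz.1)) * Cw)) *ᵥ Aw *ᵥ η) := by
      intro η
      have e1 : η = Cs *ᵥ As *ᵥ η + Cw *ᵥ Aw *ᵥ η := by
        rw [mulVec_mulVec, mulVec_mulVec, ← add_mulVec, h.complete, one_mulVec]
      conv_lhs => rw [e1]
      rw [mulVec_add, mulVec_mulVec _ _ Cs, smul_add, mulVec_add, mulVec_smul,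
        mulVec_mulVec _ (M zz.1), hMC, zero_mulVec, smul_zero, zero_add, mulVec_mulVec _ _ Cw,
        smul_mulVec]
    change S zz.1 ω ∈ U
    have hS : S zz.1 ω = y ⬝ᵥ (M ∘ fun zz : ℕ × EuclideanSpace ℝ (Fin (p + 1) × Fin N) ×
        Matrix (Fin (p + 1)) (Fin (p + 1)) ℝ => zz.1) zz *ᵥ
        -((√(zz.1 : ℝ) • (Hof (qPop P (r zz.1) (g zz.1)) * Cw)) *ᵥ Aw *ᵥ
          (Fin.cons 0 (((QGPop P (g zz.1))⁻¹ * zz.2.2 - 1) *ᵥ φ) : Fin (p + 2) → ℝ)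
          + unvec zz.2.1 *ᵥ zz.2.2 *ᵥ φ) := by
      change y ⬝ᵥ M zz.1 *ᵥ X zz.1 ω = y ⬝ᵥ M zz.1 *ᵥ _
      rw [hX, mulVec_neg, mulVec_neg, mulVec_add, mulVec_add, hdec]
    rw [hS]
    exact hzz
  -- The same real statistic has two centred normal limits, one with variance from `V φ` and one
  -- from the Kronecker covariance; these variances must agree.
  have hmap := tendstoInDistribution_unique S h1 h2
  have heq := dotProduct_mulVec_eq_of_map_eq hVpos hKr y _ hmap
  rw [heq, mulVec_neg, neg_dotProduct_neg, kronecker_mulVec_vec, vec_dotProduct_vec]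
  have hQt : Qᵀ = Q := by simpa using hpsi.posDef_Q.isHermitian.eq
  have hQit : (Q⁻¹)ᵀ = Q⁻¹ := by rw [transpose_nonsing_inv, hQt]
  rw [hQit, transpose_vecMulVec, ← Matrix.mul_assoc, trace_mul_comm, ← Matrix.mul_assoc,
    mul_vecMulVec, mulVec_mulVec, nonsing_inv_mul _ hpsi.isUnit_det_Q, one_mulVec]
  rw [mul_vecMulVec, vecMulVec_mul_vecMulVec, trace_vecMulVec, dotProduct_smul, smul_eq_mul,
    mul_comm]

lemma TendstoInDistribution.congr_limit {E Ω₁ Ω₂ : Type*} [TopologicalSpace E] [MeasurableSpace E]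
    [OpensMeasurableSpace E] [MeasurableSpace Ω₁] [MeasurableSpace Ω₂] {P₁ : Measure Ω₁}
    [IsProbabilityMeasure P₁] {P₂ : Measure Ω₂} [IsProbabilityMeasure P₂] {X : ℕ → Ω → E}
    {Z₁ : Ω₁ → E} {Z₂ : Ω₂ → E} (h : TendstoInDistribution X atTop Z₁ (fun _ => P) P₁)
    (hZ : AEMeasurable Z₂ P₂) (heq : P₁.map Z₁ = P₂.map Z₂) :
    TendstoInDistribution X atTop Z₂ (fun _ => P) P₂ where
  forall_aemeasurable := h.forall_aemeasurable
  aemeasurable_limit := hZ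
  tendsto := by
    have h1 := h.tendsto
    simp_rw [heq] at h1
    exact h1

variable [DecidableEq κ]

/-- The limit law of the statistic `J`. -/
theorem tendstoInDistribution_Jstat [Nonempty κ] {m : ℕ}
    (hdata : ∀ T, StationaryData P (r T) (g T))
    (hpsi : HomoskedasticLimit P r g Q Sig) (hV : ConsistentVariance P r g V) (hN : 0 < N)
    (h : WeakLimit (fun T => qPop P (r T) (g T)) Cs Cw As Aw L₁ L₂)
    (hm : m + Fintype.card σ = N) {R : Matrix (Fin N) (Fin N) ℝ} (hR : R * Sig * Rᵀ = 1)
    {G : Matrix κ κ ℝ} (hG : Gᵀ * ((tailRows Cw)ᵀ * Q * tailRows Cw) * G = 1)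
    {M : Matrix (Fin m) κ ℝ}
    (hM : Mᵀ * M = (R * L₂ * G)ᵀ * annihilator (R * L₁) * (R * L₂ * G)) :
    TendstoInDistribution
      (fun (T : ℕ) ω => Jstat (fun t => r T t ω) (fun t => g T t ω) T) atTop
      (fun X => minEigenvalue (wishart X)) (fun _ => P) (gaussianEntries M) := by
  have hRu := (isUnit_det_of_mul_mul_transpose_eq_one hR).1
  have hX := isUnit_det_gram h.full hRu
  obtain ⟨W₀, hW01, hW02⟩ := exists_mul_transpose_eq_one_of_annihilator (R * L₁) hX hm
  -- `W₀ R L₂ G` has the prescribed Gram matrix but need not equal `M`. Rotating `W₀` by `U` makes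
  -- the mean exactly `M` while preserving both identities of `W₀`, so every admissible mean is
  -- covered.
  obtain ⟨U, hU1, hU2, hU3⟩ := exists_orthogonal_mul_eq (M := M) (M' := W₀ * (R * L₂ * G)) (by
    rw [hM, transpose_mul W₀, Matrix.mul_assoc _ W₀ᵀ, ← Matrix.mul_assoc W₀ᵀ, hW02,
      Matrix.mul_assoc])
  set W := U * W₀ with hW
  have hW1 : W * Wᵀ = 1 := by
    rw [hW, transpose_mul, Matrix.mul_assoc, ← Matrix.mul_assoc W₀, hW01, Matrix.one_mul, hU2]
  have hW2 : Wᵀ * W = annihilator (R * L₁) := by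
    rw [hW, transpose_mul, Matrix.mul_assoc, ← Matrix.mul_assoc Uᵀ, hU1, Matrix.one_mul, hW02]
  have hWM : W * R * L₂ * G = M := by
    rw [← hU3, hW]
    simp only [Matrix.mul_assoc]
  have hK : KroneckerOn Cw L₁ Q Sig (covLim V) := by
    intro z hz
    rw [← hV.eq_quadOf]
    exact ⟨hV.posDef _ fun h0 => hz (h.tailRows_injective hN h0),
      fun y hy => h.dotProduct_mulVec_eq hdata hpsi hV hN hz hy⟩
  have hQi := hpsi.isUnit_det_Q
  have hQt : Qᵀ = Q := by simpa using hpsi.posDef_Q.isHermitian.eq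
  let root : EuclideanSpace ℝ (Fin (p + 1) × Fin N) → Fin m → κ → ℝ :=
    fun ψ => rootLim Cw L₂ Q (unvec ψ) W R G
  have hroot : Continuous root := by
    have : Continuous fun ψ : EuclideanSpace ℝ (Fin (p + 1) × Fin N) =>
        W * R * (L₂ + unvec ψ * Q * tailRows Cw) * G :=
      (continuous_const.matrix_mul (continuous_const.add ((continuous_unvec.matrix_mul
        continuous_const).matrix_mul continuous_const))).matrix_mul continuous_const
    exact this
  -- The limiting root is `M + (W R) Ψ (Q tail(Cw) G)`: `W R` whitens `Sig` on the left, and `Q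
  -- tail(Cw) G` whitens `Q⁻¹` on the right.
  have hlaw : (multivariateGaussian 0 (Q⁻¹ ⊗ₖ Sig)).map root = gaussianEntries M := by
    rw [← map_multivariateGaussian_eq_gaussianEntries hpsi.posDef_Q.inv.posSemidef
      hpsi.posDef_Sig.posSemidef (W * R) (Q * tailRows Cw * G) M]
    · congr 1
      ext ψ i j
      change (W * R * (L₂ + unvec ψ * Q * tailRows Cw) * G) i j = _
      rw [← hWM]
      simp only [Matrix.mul_add, Matrix.add_mul, Matrix.mul_assoc]
    · rw [transpose_mul, Matrix.mul_assoc, ← Matrix.mul_assoc Sig, Matrix.mul_assoc W,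
        ← Matrix.mul_assoc R, ← Matrix.mul_assoc R, hR, Matrix.one_mul, hW1]
    · rw [← hG, transpose_mul, transpose_mul, hQt]
      have : Q * Q⁻¹ = 1 := mul_nonsing_inv _ hQi
      simp only [Matrix.mul_assoc]
      rw [← Matrix.mul_assoc Q Q⁻¹, this, Matrix.one_mul]
  have hcont := continuous_minEigenvalue_wishart (ι := κ) (m := Fin m)
  refine TendstoInDistribution.congr_limit (P₁ := multivariateGaussian 0 (Q⁻¹ ⊗ₖ Sig))
    (Z₁ := fun ψ => minEigenvalue (wishart (root ψ))) ?_ hcont.measurable.aemeasurable ?_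
  · refine tendstoInDistribution_of_eventually hpsi.tendsto_psi
      (hpsi.convProb_QGHat.prodMk hV.convProb_covData)
      (fun T => (measurable_Jstat (hdata T).measurable_r (hdata T).measurable_g T).aemeasurable)
      (hcont.comp hroot).measurable.aemeasurable fun ω' U hU => ?_
    obtain ⟨ε, hε, hball⟩ := Metric.mem_nhds_iff.1 hU
    obtain ⟨u₀, hu₀, hle⟩ := exists_le_minEigenvalue (L₂ := L₂) (Ψ := unvec ω') hK h.full hR hG hW2
    have hT : Tendsto (fun zz : ℕ × EuclideanSpace ℝ (Fin (p + 1) × Fin N) ×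
        (Matrix (Fin (p + 1)) (Fin (p + 1)) ℝ × (Fin (p + 1) → Fin (p + 1) →
          Matrix (Fin N) (Fin N) ℝ)) => zz.1) (atTop ×ˢ 𝓝 (id ω') ×ˢ 𝓝 (Q, covLim V)) atTop :=
      tendsto_fst
    have hΨ : Tendsto (fun zz : ℕ × EuclideanSpace ℝ (Fin (p + 1) × Fin N) ×
        (Matrix (Fin (p + 1)) (Fin (p + 1)) ℝ × (Fin (p + 1) → Fin (p + 1) →
          Matrix (Fin N) (Fin N) ℝ)) => unvec zz.2.1) (atTop ×ˢ 𝓝 (id ω') ×ˢ 𝓝 (Q, covLim V))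
          (𝓝 (unvec ω')) :=
      (continuous_unvec.tendsto ω').comp (tendsto_fst.comp tendsto_snd)
    have hY : Tendsto (fun zz : ℕ × EuclideanSpace ℝ (Fin (p + 1) × Fin N) ×
        (Matrix (Fin (p + 1)) (Fin (p + 1)) ℝ × (Fin (p + 1) → Fin (p + 1) →
          Matrix (Fin N) (Fin N) ℝ)) => zz.2.2) (atTop ×ˢ 𝓝 (id ω') ×ˢ 𝓝 (Q, covLim V))
          (𝓝 (Q, covLim V)) :=
      tendsto_snd.comp tendsto_snd
    have hQh := (continuous_fst.tendsto (Q, covLim V)).comp hY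
    have hD := (continuous_snd.tendsto (Q, covLim V)).comp hY
    have hlow := h.eventually_le_AR hpsi.tendsto_Q hQi hT hΨ hQh hD
      (c := minEigenvalue (wishart (root ω')) - ε / 2)
      (exists_lt_of_lt_minEigenvalue hK h.full hR hG hW1 hW2 (sub_lt_self _ (by linarith)))
    have hup := h.eventually_exists_AR_lt hpsi.tendsto_Q hQi hT hΨ hQh hD u₀ hu₀
      (c := minEigenvalue (wishart (root ω')) + ε / 2)
      (lt_of_le_of_lt hle (lt_add_of_pos_right _ (by linarith)))
    filter_upwards [hlow, hup] with zz hz1 hz2 ω hω1 hω2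
    have e1 : √(zz.1 : ℝ) • (BHat (fun t => r zz.1 t ω) (fun t => g zz.1 t ω) zz.1 -
        qPop P (r zz.1) (g zz.1) * (QGPop P (g zz.1))⁻¹) = unvec zz.2.1 := by
      rw [← hω1]; rfl
    have e2 : QGHat (fun t => g zz.1 t ω) zz.1 = zz.2.2.1 := congrArg Prod.fst hω2
    have e3 : covData (fun t => r zz.1 t ω) (fun t => g zz.1 t ω) zz.1 = zz.2.2.2 :=
      congrArg Prod.snd hω2
    obtain ⟨θ, hθ1, hθ2⟩ := hz2 _ _ e1 e2 e3
    have hJ1 := (Jstat_le _ _ _ hθ1).trans_lt hθ2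
    have hJ2 : minEigenvalue (wishart (root ω')) - ε / 2
        ≤ Jstat (fun t => r zz.1 t ω) (fun t => g zz.1 t ω) zz.1 := by
      refine le_csInf ⟨_, θ, hθ1, rfl⟩ ?_
      rintro v ⟨θ', hθ', rfl⟩
      exact hz1 _ _ e1 e2 e3 θ' hθ'
    refine hball ?_
    rw [Metric.mem_ball, Real.dist_eq, abs_lt]
    constructor <;> linarith
  · rw [← hlaw, Measure.map_map hcont.measurable hroot.measurable]
    rfl

end LimitLaw

/-! ### Uniform bounds for the HJS critical values -/

section WeightedChiSq

variable {ι : Type*} [Fintype ι]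

lemma continuous_sum_mul_sq (w : ι → ℝ) : Continuous fun z : ι → ℝ => ∑ i, w i * z i ^ 2 := by
  fun_prop

instance (w : ι → ℝ) : IsProbabilityMeasure (weightedChiSq w) :=
  Measure.isProbabilityMeasure_map (continuous_sum_mul_sq w).measurable.aemeasurable

/-- Nonnegativity of `C` covers the case of a set unbounded below, where the real infimum takes the
value `0`. -/
lemma quantile_le {ν : Measure ℝ} {p C : ℝ} (hC : 0 ≤ C) (h : ENNReal.ofReal p ≤ ν (Set.Iic C)) :
    quantile ν p ≤ C := by
  unfold quantile
  by_cases hb : BddBelow {x : ℝ | ENNReal.ofReal p ≤ ν (Set.Iic x)}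
  · exact csInf_le hb h
  · rwa [Real.sInf_of_not_bddBelow hb]

lemma weightedChiSq_Iic_anti {w w' : ι → ℝ} (h : ∀ i, w i ≤ w' i) (C : ℝ) :
    weightedChiSq w' (Set.Iic C) ≤ weightedChiSq w (Set.Iic C) := by
  unfold weightedChiSq
  rw [Measure.map_apply (continuous_sum_mul_sq w').measurable measurableSet_Iic,
    Measure.map_apply (continuous_sum_mul_sq w).measurable measurableSet_Iic]
  refine measure_mono fun z hz => ?_
  exact (Finset.sum_le_sum fun i _ => mul_le_mul_of_nonneg_right (h i) (sq_nonneg _)).trans hz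

/-- Increasing a weight only moves mass to the right, so the law with all weights equal to `B` gives
one bound for every admissible choice. -/
lemma exists_quantile_weightedChiSq_le (B p : ℝ) (hp : p < 1) :
    ∃ C : ℝ, 0 ≤ C ∧ ∀ w : ι → ℝ, (∀ i, w i ≤ B) → quantile (weightedChiSq w) p ≤ C := by
  have h1 := tendsto_measure_Iic_atTop (weightedChiSq fun _ : ι => B)
  rw [measure_univ] at h1
  have h2 : ENNReal.ofReal p < 1 := by simpa using hp
  obtain ⟨C, hC, hC0⟩ := ((h1.eventually_const_lt h2).and (eventually_ge_atTop 0)).exists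
  exact ⟨C, hC0, fun w hw => quantile_le hC0 (hC.le.trans (weightedChiSq_Iic_anti hw C))⟩

end WeightedChiSq

section Weight

variable {N p : ℕ} (x : ℕ → Fin N → ℝ) (y : ℕ → Fin p → ℝ) (T : ℕ) (θ : Fin (p + 1) → ℝ)

lemma trace_weightMatrix : (weightMatrix x y T θ).trace = ((QrHat x T)⁻¹ * SHat x y T θ).trace := by
  have hS := SHat_posSemidef x y T θ
  have h1 : (CFC.sqrt (SHat x y T θ))ᴴ = CFC.sqrt (SHat x y T θ) :=
    (IsSelfAdjoint.of_nonneg (CFC.sqrt_nonneg _)).star_eq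
  rw [weightMatrix, h1, Matrix.mul_assoc, trace_mul_comm, Matrix.mul_assoc,
    CFC.sqrt_mul_sqrt_self _ hS.nonneg]

lemma weightMatrix_posSemidef : (weightMatrix x y T θ).PosSemidef :=
  (QrHat_posSemidef x T).inv.mul_mul_conjTranspose_same _

/-- The eigenvalues are nonnegative, so each is at most their sum. The trace is a continuous
function of the moments, and no spectral perturbation argument is needed. -/
lemma eigenvalues_weightMatrix_le (i : Fin N) :
    (weightMatrix_isHermitian x y T θ).eigenvalues i ≤ ((QrHat x T)⁻¹ * SHat x y T θ).trace := by
  rw [← trace_weightMatrix, (weightMatrix_isHermitian x y T θ).trace_eq_sum_eigenvalues]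
  exact Finset.single_le_sum (f := (weightMatrix_isHermitian x y T θ).eigenvalues)
    (fun j _ => (weightMatrix_posSemidef x y T θ).eigenvalues_nonneg j) (Finset.mem_univ i)

variable {x y T}

/-- Bounds on all of `Θ` suffice, so the behaviour of the confidence set is irrelevant; an empty set
is included, with critical value `0` and statistic `∞`. -/
lemma hjsRejects_of_bounds {Θ : Set (Fin (p + 1) → ℝ)} {α₁ α₂ B C d : ℝ}
    (hC : ∀ w : Fin N → ℝ, (∀ i, w i ≤ B) → quantile (weightedChiSq w) (1 - α₂) ≤ C)
    (hB : ∀ θ ∈ Θ, ((QrHat x T)⁻¹ * SHat x y T θ).trace ≤ B) (hd : ∀ θ ∈ Θ, d ≤ hjDist x y T θ)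
    (hT : C < T * d) (hC0 : 0 ≤ C) : HJSRejects Θ α₁ α₂ x y T := by
  have h1 : hjsCrit Θ α₁ α₂ x y T ≤ ENNReal.ofReal C :=
    iSup₂_le fun θ hθ => ENNReal.ofReal_le_ofReal (hC _ fun i =>
      (eigenvalues_weightMatrix_le x y T θ i).trans (hB θ hθ.1))
  have h2 : ENNReal.ofReal d ≤ hjsStat Θ α₁ x y T :=
    le_iInf₂ fun θ hθ => ENNReal.ofReal_le_ofReal (hd θ hθ.1)
  calc hjsCrit Θ α₁ α₂ x y T ≤ ENNReal.ofReal C := h1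
    _ < ENNReal.ofReal (T * d) := (ENNReal.ofReal_lt_ofReal_iff (hC0.trans_lt hT)).2 hT
    _ = T * ENNReal.ofReal d := by
        rw [ENNReal.ofReal_mul (by positivity), ENNReal.ofReal_natCast]
    _ ≤ T * hjsStat Θ α₁ x y T := by gcongr

end Weight

/-! ### Consistency of the HJS test -/

section Power

variable {Ω : Type*} [MeasurableSpace Ω] {P : Measure Ω} [IsProbabilityMeasure P] {N p : ℕ}
  {r : ℕ → ℕ → Ω → Fin N → ℝ} {g : ℕ → ℕ → Ω → Fin p → ℝ}
  {Q : Matrix (Fin (p + 1)) (Fin (p + 1)) ℝ} {Sig : Matrix (Fin N) (Fin N) ℝ}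
  {V : (Fin (p + 1) → ℝ) → Matrix (Fin N) (Fin N) ℝ}

/-- Subadditivity alone gives `1 ≤ P (B T) + P (B T)ᶜ`, so the rejection events need not be
measurable. -/
lemma liminf_measure_eq_one {B : ℕ → Set Ω}
    (h : limsup (fun T => P (B T)ᶜ) atTop ≤ 0) : liminf (fun T => P (B T)) atTop = 1 := by
  have h0 : Tendsto (fun T => P (B T)ᶜ) atTop (𝓝 0) :=
    tendsto_of_le_liminf_of_limsup_le zero_le h
  have h1 : Tendsto (fun T => 1 - P (B T)ᶜ) atTop (𝓝 (1 - 0)) :=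
    ENNReal.Tendsto.sub tendsto_const_nhds h0 (Or.inl ENNReal.one_ne_top)
  rw [tsub_zero] at h1
  refine Tendsto.liminf_eq (tendsto_of_tendsto_of_tendsto_of_le_of_le h1 tendsto_const_nhds ?_
    fun T => prob_le_one)
  intro T
  have h2 := measure_union_le (μ := P) (B T) (B T)ᶜ
  rw [Set.union_compl_self, measure_univ] at h2
  exact tsub_le_iff_right.2 h2

/-- The HJS test is consistent against fixed misspecification. -/
theorem liminf_measure_HJSRejects (hpsi : HomoskedasticLimit P r g Q Sig)
    (hV : ConsistentVariance P r g V) {Θ : Set (Fin (p + 1) → ℝ)} (hΘ : IsCompact Θ)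
    (hmis : ∃ a : ℝ, 0 < a ∧ ∀ T, ∀ θ ∈ Θ, a < ‖WithLp.toLp 2 (errPop P (r T) (g T) θ)‖)
    {α₁ α₂ : ℝ} (hα₂ : 0 < α₂) {q : Matrix (Fin N) (Fin (p + 1)) ℝ}
    (hq : Tendsto (fun T => qPop P (r T) (g T)) atTop (𝓝 q)) :
    liminf (fun T : ℕ => P {ω | HJSRejects Θ α₁ α₂ (fun t => r T t ω) (fun t => g T t ω) T})
      atTop = 1 := by
  have hQi := hpsi.isUnit_det_Q
  set D₀ := covLim V with hD₀
  let E : Matrix (Fin N) (Fin (p + 1)) ℝ → (Fin (p + 1) → ℝ) → Fin N → ℝ :=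
    fun q θ => (fun _ => 1) - q *ᵥ θ
  let S₀ : (Fin (p + 1) → ℝ) → Matrix (Fin N) (Fin N) ℝ :=
    fun θ => quadOf D₀ θ + vecMulVec (E q θ) (E q θ)
  set Qr : Matrix (Fin N) (Fin N) ℝ := quadOf D₀ (Pi.single 0 1)
    + vecMulVec (q *ᵥ Pi.single 0 1) (q *ᵥ Pi.single 0 1) with hQr
  have hQrpos : Qr.PosDef := by
    have h1 := hV.posDef (Pi.single 0 1) (by simp)
    rw [hV.eq_quadOf] at h1
    exact h1.add_posSemidef (vecMulVec_self_posSemidef _)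
  have hQru : IsUnit Qr.det := (isUnit_iff_isUnit_det _).1 hQrpos.isUnit
  -- The lower bound `a` is uniform in `T`, hence it survives in the limit as a weak inequality.
  have hE0 : ∀ θ ∈ Θ, E q θ ≠ 0 := by
    obtain ⟨a, ha, hmis⟩ := hmis
    intro θ hθ h0
    have h1 : Tendsto (fun T => errPop P (r T) (g T) θ) atTop (𝓝 (E q θ)) :=
      tendsto_const_nhds.sub (hq.matrixMulVec tendsto_const_nhds)
    have h2 : Tendsto (fun T => ‖WithLp.toLp 2 (errPop P (r T) (g T) θ)‖) atTop
        (𝓝 ‖WithLp.toLp 2 (E q θ)‖) :=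
      (((PiLp.continuous_toLp 2 _).norm).tendsto _).comp h1
    have h3 := ge_of_tendsto' h2 fun T => (hmis T θ hθ).le
    rw [h0] at h3
    simp at h3
    linarith
  have hEc : Continuous (E q) :=
    continuous_const.sub (continuous_const.matrix_mulVec continuous_id)
  obtain ⟨d, hd, hdle⟩ : ∃ d : ℝ, 0 < d ∧ ∀ θ ∈ Θ, d < E q θ ⬝ᵥ Qr⁻¹ *ᵥ E q θ := by
    have hf : Continuous fun θ => E q θ ⬝ᵥ Qr⁻¹ *ᵥ E q θ :=
      hEc.dotProduct (continuous_const.matrix_mulVec hEc)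
    rcases Θ.eq_empty_or_nonempty with rfl | hne
    · exact ⟨1, one_pos, by simp⟩
    · obtain ⟨θ₀, hθ₀, hmin⟩ := hΘ.exists_isMinOn hne hf.continuousOn
      have hpos : 0 < E q θ₀ ⬝ᵥ Qr⁻¹ *ᵥ E q θ₀ := by
        simpa using hQrpos.inv.dotProduct_mulVec_pos (hE0 θ₀ hθ₀)
      exact ⟨_, half_pos hpos, fun θ hθ => (half_lt_self hpos).trans_le (hmin hθ)⟩
  obtain ⟨B, hB⟩ : ∃ B : ℝ, ∀ θ ∈ Θ, (Qr⁻¹ * S₀ θ).trace < B := by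
    have hS₀ : Continuous S₀ := (continuous_quadOf.comp (Continuous.prodMk_right D₀)).add
      (hEc.matrix_vecMulVec hEc)
    have hf : Continuous fun θ => (Qr⁻¹ * S₀ θ).trace :=
      (continuous_const.matrix_mul hS₀).matrix_trace
    obtain ⟨B, hB⟩ := (hΘ.image hf).bddAbove
    exact ⟨B + 1, fun θ hθ => (hB ⟨θ, hθ, rfl⟩).trans_lt (lt_add_one B)⟩
  obtain ⟨C, hC0, hC⟩ := exists_quantile_weightedChiSq_le (ι := Fin N) B (1 - α₂) (by linarith)
  -- The exceptional set is empty: whatever the limit `ω'` of the scaled estimation error, rejection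
  -- is certain for all nearby data and large `T`.
  refine liminf_measure_eq_one ((limsup_measure_le_of_eventually hpsi.tendsto_psi
    (hpsi.convProb_QGHat.prodMk hV.convProb_covData) _ ∅ fun ω' _ => ?_).trans_eq measure_empty)
  set l := (atTop : Filter ℕ) ×ˢ 𝓝 (id ω') ×ˢ 𝓝 (Q, D₀) with hl
  have hT : Tendsto (fun zz : ℕ × EuclideanSpace ℝ (Fin (p + 1) × Fin N) ×
      (Matrix (Fin (p + 1)) (Fin (p + 1)) ℝ × (Fin (p + 1) → Fin (p + 1) →
        Matrix (Fin N) (Fin N) ℝ)) => zz.1) l atTop := tendsto_fst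
  have hΨ : Tendsto (fun zz : ℕ × EuclideanSpace ℝ (Fin (p + 1) × Fin N) ×
      (Matrix (Fin (p + 1)) (Fin (p + 1)) ℝ × (Fin (p + 1) → Fin (p + 1) →
        Matrix (Fin N) (Fin N) ℝ)) => unvec zz.2.1) l (𝓝 (unvec ω')) :=
    (continuous_unvec.tendsto ω').comp (tendsto_fst.comp tendsto_snd)
  have hY : Tendsto (fun zz : ℕ × EuclideanSpace ℝ (Fin (p + 1) × Fin N) ×
      (Matrix (Fin (p + 1)) (Fin (p + 1)) ℝ × (Fin (p + 1) → Fin (p + 1) →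
        Matrix (Fin N) (Fin N) ℝ)) => zz.2.2) l (𝓝 (Q, D₀)) := tendsto_snd.comp tendsto_snd
  have hQh : Tendsto (fun zz : ℕ × EuclideanSpace ℝ (Fin (p + 1) × Fin N) ×
      (Matrix (Fin (p + 1)) (Fin (p + 1)) ℝ × (Fin (p + 1) → Fin (p + 1) →
        Matrix (Fin N) (Fin N) ℝ)) => zz.2.2.1) l (𝓝 Q) :=
    (continuous_fst.tendsto (Q, D₀)).comp hY
  have hD : Tendsto (fun zz : ℕ × EuclideanSpace ℝ (Fin (p + 1) × Fin N) ×
      (Matrix (Fin (p + 1)) (Fin (p + 1)) ℝ × (Fin (p + 1) → Fin (p + 1) →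
        Matrix (Fin N) (Fin N) ℝ)) => zz.2.2.2) l (𝓝 D₀) :=
    (continuous_snd.tendsto (Q, D₀)).comp hY
  -- The sample `q̂` rebuilt from `Ψ` and `Q̂`. The factor `T^{-1/2}` makes the Gaussian part
  -- disappear in the limit.
  let qh : ℕ × EuclideanSpace ℝ (Fin (p + 1) × Fin N) ×
      (Matrix (Fin (p + 1)) (Fin (p + 1)) ℝ × (Fin (p + 1) → Fin (p + 1) →
        Matrix (Fin N) (Fin N) ℝ)) → Matrix (Fin N) (Fin (p + 1)) ℝ := fun zz =>
    (qPop P (r zz.1) (g zz.1) * (QGPop P (g zz.1))⁻¹ + (√(zz.1 : ℝ))⁻¹ • unvec zz.2.1) * zz.2.2.1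
  have hqh : Tendsto qh l (𝓝 q) := by
    have h1 := (((hq.comp hT).matrixMul ((hpsi.tendsto_Q.comp hT).matrixInv hQi)).add
      ((tendsto_inv_sqrt hT).smul hΨ)).matrixMul hQh
    rw [zero_smul, add_zero, Matrix.mul_assoc, nonsing_inv_mul _ hQi, Matrix.mul_one] at h1
    exact h1
  let Qrh : ℕ × EuclideanSpace ℝ (Fin (p + 1) × Fin N) ×
      (Matrix (Fin (p + 1)) (Fin (p + 1)) ℝ × (Fin (p + 1) → Fin (p + 1) →
        Matrix (Fin N) (Fin N) ℝ)) → Matrix (Fin N) (Fin N) ℝ := fun zz =>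
    quadOf zz.2.2.2 (Pi.single 0 1)
      + vecMulVec (qh zz *ᵥ Pi.single 0 1) (qh zz *ᵥ Pi.single 0 1)
  have hQrh : Tendsto Qrh l (𝓝 Qr) := by
    have h1 := hqh.matrixMulVec (tendsto_const_nhds (x := Pi.single 0 1))
    exact (tendsto_quadOf hD tendsto_const_nhds).add (h1.matrixVecMulVec h1)
  have hR := eventually_forall_mem_compact (l := l) (R := fun zz θ =>
    ((Qrh zz)⁻¹ * (quadOf zz.2.2.2 θ + vecMulVec (E (qh zz) θ) (E (qh zz) θ))).trace ≤ B ∧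
      d ≤ E (qh zz) θ ⬝ᵥ (Qrh zz)⁻¹ *ᵥ E (qh zz) θ) hΘ (by
    intro θ hθ
    have hfst := tendsto_fst (f := l) (g := 𝓝 θ)
    have hsnd := tendsto_snd (f := l) (g := 𝓝 θ)
    have hE := (tendsto_const_nhds (x := (fun _ => 1 : Fin N → ℝ))).sub
      ((hqh.comp hfst).matrixMulVec hsnd)
    have hinv := (hQrh.comp hfst).matrixInv hQru
    have h1 := hinv.matrixMul ((tendsto_quadOf (hD.comp hfst) hsnd).add (hE.matrixVecMulVec hE))
    have h2 := ((continuous_id.matrix_trace).tendsto _).comp h1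
    have h3 := hE.dotProduct' (hinv.matrixMulVec hE)
    filter_upwards [h2.eventually_lt_const (hB θ hθ), h3.eventually_const_lt (hdle θ hθ)] with
      z hz1 hz2
    exact ⟨hz1.le, hz2.le⟩)
  have hTd : Tendsto (fun T : ℕ => (T : ℝ) * d) atTop atTop :=
    tendsto_natCast_atTop_atTop.atTop_mul_const hd
  filter_upwards [hR, hT.eventually_gt_atTop 0, hQh.eventually_isUnit_det hQi,
    (hTd.comp hT).eventually_gt_atTop C] with zz hzz hT0 hdet hTC ω hω1 hω2
  rw [Set.mem_compl_iff, not_not]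
  have e1 : √(zz.1 : ℝ) • (BHat (fun t => r zz.1 t ω) (fun t => g zz.1 t ω) zz.1 -
      qPop P (r zz.1) (g zz.1) * (QGPop P (g zz.1))⁻¹) = unvec zz.2.1 := by
    rw [← hω1]; rfl
  have e2 : QGHat (fun t => g zz.1 t ω) zz.1 = zz.2.2.1 := congrArg Prod.fst hω2
  have e3 : covData (fun t => r zz.1 t ω) (fun t => g zz.1 t ω) zz.1 = zz.2.2.2 :=
    congrArg Prod.snd hω2
  have hq1 : qHat (fun t => r zz.1 t ω) (fun t => g zz.1 t ω) zz.1 = qh zz := by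
    rw [qHat_eq_of_psi hT0 (by rw [e2]; exact hdet) e1, e2]
  have hQ1 : QrHat (fun t => r zz.1 t ω) zz.1 = Qrh zz := by
    rw [QrHat_eq _ (fun t => g zz.1 t ω) hT0, e3, hq1]
  have he1 : ∀ θ, errBar (fun t => r zz.1 t ω) (fun t => g zz.1 t ω) zz.1 θ = E (qh zz) θ :=
    fun θ => by rw [errBar, hq1]
  refine hjsRejects_of_bounds (B := B) (d := d) hC (fun θ hθ => ?_) (fun θ hθ => ?_) hTC hC0
  · rw [hQ1, SHat_eq _ _ hT0, e3, he1]
    exact (hzz θ hθ).1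
  · rw [hjDist, hQ1, he1]
    exact (hzz θ hθ).2

end Power

/-! ### Chi-square quantiles -/

section ChiSq

/-- By Fubini: once all other coordinates are fixed, at most two values of the first one give the
sum `c`, a null set for the normal law. -/
lemma chiSq_succ_singleton (n : ℕ) (c : ℝ) : chiSq (n + 1) {c} = 0 := by
  have hsum := continuous_sum_mul_sq (fun _ : Fin (n + 1) => (1 : ℝ))
  have hs : MeasurableSet {z : ℝ × (Fin n → ℝ) | z.1 ^ 2 + ∑ i, z.2 i ^ 2 = c} :=
    measurableSet_eq_fun (by fun_prop) (by fun_prop)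
  have hmp := measurePreserving_piFinSuccAbove (fun _ : Fin (n + 1) => gaussianReal 0 1) 0
  have hset : (fun z : Fin (n + 1) → ℝ => ∑ i, (1 : ℝ) * z i ^ 2) ⁻¹' {c} =
      MeasurableEquiv.piFinSuccAbove (fun _ : Fin (n + 1) => ℝ) 0 ⁻¹'
        {z : ℝ × (Fin n → ℝ) | z.1 ^ 2 + ∑ i, z.2 i ^ 2 = c} := by
    ext z
    simp [Fin.sum_univ_succ, MeasurableEquiv.piFinSuccAbove, Fin.tail]
  unfold chiSq weightedChiSq
  rw [Measure.map_apply hsum.measurable (measurableSet_singleton c), hset,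
    hmp.measure_preimage hs.nullMeasurableSet, Measure.prod_apply_symm hs, lintegral_eq_zero_iff'
      (measurable_measure_prodMk_right hs).aemeasurable]
  refine ae_of_all _ fun b => ?_
  have hfin : ((fun a : ℝ => (a, b)) ⁻¹'
      {z : ℝ × (Fin n → ℝ) | z.1 ^ 2 + ∑ i, z.2 i ^ 2 = c}).Finite := by
    refine (Set.toFinite {√(c - ∑ i, b i ^ 2), -√(c - ∑ i, b i ^ 2)}).subset fun a ha => ?_
    have h1 : a ^ 2 + ∑ i, b i ^ 2 = c := ha
    have h2 : √(c - ∑ i, b i ^ 2) = |a| := by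
      rw [← h1, add_sub_cancel_right, Real.sqrt_sq_eq_abs]
    rw [h2]
    rcases abs_choice a with h | h <;> rw [h] <;> simp
  have := nullSingletonClass_gaussianReal (μ := 0) (v := 1) one_ne_zero
  exact hfin.measure_zero _

lemma chiSq_Iic_zero (n : ℕ) : chiSq (n + 1) (Set.Iic 0) = 0 := by
  have hsum := continuous_sum_mul_sq (fun _ : Fin (n + 1) => (1 : ℝ))
  have h : (Set.Iic (0 : ℝ)) = Set.Iio 0 ∪ {0} := by ext; simp [le_iff_lt_or_eq]
  have h1 : chiSq (n + 1) (Set.Iio 0) = 0 := by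
    unfold chiSq weightedChiSq
    rw [Measure.map_apply hsum.measurable measurableSet_Iio]
    convert measure_empty (μ := Measure.pi fun _ : Fin (n + 1) => gaussianReal 0 1)
    refine Set.eq_empty_iff_forall_notMem.2 fun z hz => not_le_of_gt
      (show ∑ i, (1 : ℝ) * z i ^ 2 < 0 from hz) ?_
    exact Finset.sum_nonneg fun i _ => by positivity
  rw [h]
  exact measure_union_null h1 (chiSq_succ_singleton n 0)

instance (n : ℕ) : IsProbabilityMeasure (chiSq n) := by unfold chiSq; infer_instance

/-- Right continuity of the distribution function shows that the infimum defining the quantile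
satisfies the inequality itself. -/
lemma le_measure_Iic_quantile {ν : Measure ℝ} [IsProbabilityMeasure ν] {p : ℝ}
    (hp1 : p < 1) : ENNReal.ofReal p ≤ ν (Set.Iic (quantile ν p)) := by
  set S := {x : ℝ | ENNReal.ofReal p ≤ ν (Set.Iic x)} with hS
  have hmono : ∀ x ∈ S, ∀ x', x ≤ x' → x' ∈ S := fun x hx x' h =>
    le_trans hx (measure_mono (Set.Iic_subset_Iic.2 h))
  have hne : S.Nonempty := by
    have h1 := tendsto_measure_Iic_atTop ν
    rw [measure_univ] at h1
    obtain ⟨x, hx⟩ := (h1.eventually_const_lt (u := ENNReal.ofReal p) (by simpa using hp1)).exists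
    exact ⟨x, hx.le⟩
  have hmem : ∀ x, quantile ν p < x → ENNReal.ofReal p ≤ ν (Set.Iic x) := by
    intro x hx
    obtain ⟨y, hy, hyx⟩ := exists_lt_of_csInf_lt hne hx
    exact hmono y hy x hyx.le
  have hrc := ((cdf ν).right_continuous (quantile ν p)).mono_left
    (nhdsWithin_mono _ Set.Ioi_subset_Ici_self)
  have hrc' := (ENNReal.continuous_ofReal.tendsto _).comp hrc
  rw [ofReal_cdf] at hrc'
  refine ge_of_tendsto hrc' ?_
  filter_upwards [self_mem_nhdsWithin] with x hx
  rw [Function.comp_apply, ofReal_cdf]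
  exact hmem x hx

lemma quantile_chiSq_pos (n : ℕ) {p : ℝ} (hp : 0 < p) (hp1 : p < 1) :
    0 < quantile (chiSq (n + 1)) p := by
  by_contra! h
  have h1 := (le_measure_Iic_quantile (ν := chiSq (n + 1)) hp1).trans
    (measure_mono (Set.Iic_subset_Iic.2 h))
  rw [chiSq_Iic_zero, nonpos_iff_eq_zero, ENNReal.ofReal_eq_zero] at h1
  linarith

/-- The rejection region is closed at the critical value, so the absence of atoms is what brings its
probability down to `α`. -/
lemma chiSq_Ici_quantile_le (n : ℕ) {α : ℝ} (hα : 0 < α) (hα1 : α ≤ 1) :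
    chiSq (n + 1) (Set.Ici (quantile (chiSq (n + 1)) (1 - α))) ≤ ENNReal.ofReal α := by
  set c := quantile (chiSq (n + 1)) (1 - α)
  have h1 : ENNReal.ofReal (1 - α) ≤ chiSq (n + 1) (Set.Iic c) :=
    le_measure_Iic_quantile (by linarith)
  have h2 : chiSq (n + 1) (Set.Ici c) ≤ chiSq (n + 1) (Set.Iic c)ᶜ := by
    have : Set.Ici c ⊆ (Set.Iic c)ᶜ ∪ {c} := fun x hx => by
      rcases (Set.mem_Ici.1 hx).lt_or_eq with h | h
      · exact Or.inl (by simpa using h)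
      · exact Or.inr h.symm
    refine (measure_mono this).trans ((measure_union_le _ _).trans ?_)
    rw [chiSq_succ_singleton, add_zero]
  refine h2.trans ?_
  rw [prob_compl_eq_one_sub measurableSet_Iic]
  refine (tsub_le_tsub_left h1 1).trans ?_
  rw [← ENNReal.ofReal_one, ← ENNReal.ofReal_sub _ (by linarith), sub_sub_cancel]

lemma weightedChiSq_one_eq_chiSq {ι : Type*} [Fintype ι] {n : ℕ} (e : ι ≃ Fin n) :
    weightedChiSq (fun _ : ι => 1) = chiSq n := by
  have hmp := measurePreserving_piCongrLeft (fun _ : Fin n => gaussianReal 0 1) e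
  unfold chiSq weightedChiSq
  rw [← hmp.map_eq, Measure.map_map (continuous_sum_mul_sq _).measurable hmp.measurable]
  congr 1
  ext z
  rw [Function.comp_apply, ← e.sum_comp]
  refine Finset.sum_congr rfl fun i _ => ?_
  rw [MeasurableEquiv.coe_piCongrLeft, Equiv.piCongrLeft_apply_apply]

end ChiSq

/-! ### Smallest eigenvalues of Wishart matrices -/

section Wishart

variable {m κ : Type*} [Fintype m] [Fintype κ]

lemma exists_orthogonal_unit {b : Type*} [Fintype b] (h : Fintype.card b < Fintype.card κ)
    (B : Matrix b κ ℝ) : ∃ u : κ → ℝ, u ⬝ᵥ u = 1 ∧ B *ᵥ u = 0 := by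
  have hker : LinearMap.ker B.mulVecLin ≠ ⊥ :=
    LinearMap.ker_ne_bot_of_finrank_lt (by simpa using h)
  obtain ⟨v, hv, hv0⟩ := Submodule.exists_mem_ne_zero_of_ne_bot hker
  have hpos : 0 < v ⬝ᵥ v := by simpa using dotProduct_star_self_pos_iff.2 hv0
  refine ⟨(√(v ⬝ᵥ v))⁻¹ • v, ?_, ?_⟩
  · have hs : √(v ⬝ᵥ v) * √(v ⬝ᵥ v) = v ⬝ᵥ v := Real.mul_self_sqrt hpos.le
    rw [smul_dotProduct, dotProduct_smul, smul_eq_mul, smul_eq_mul, ← mul_assoc, ← mul_inv, hs,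
      inv_mul_cancel₀ hpos.ne']
  · have : B *ᵥ v = 0 := hv
    rw [mulVec_smul, this, smul_zero]

lemma isOpenPosMeasure_gaussianEntries (M : Matrix m κ ℝ) :
    (gaussianEntries M).IsOpenPosMeasure := by
  have h : ∀ i j, (gaussianReal (M i j) 1).IsOpenPosMeasure := fun i j =>
    (gaussianReal_absolutelyContinuous' (M i j) one_ne_zero).isOpenPosMeasure
  have h' : ∀ i, (Measure.pi fun j => gaussianReal (M i j) 1).IsOpenPosMeasure :=
    fun i => inferInstance
  have hs : ∀ i, SigmaFinite (Measure.pi fun j => gaussianReal (M i j) 1) :=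
    fun i => inferInstance
  unfold gaussianEntries
  infer_instance

variable [DecidableEq κ]

/-- The smallest eigenvalue of a central Wishart matrix is dominated by a chi-square variable. -/
theorem gaussianEntries_zero_minEigenvalue_le {n : ℕ} (s : m → Prop) [DecidablePred s]
    (e : {i // s i} ≃ Fin n) (hcard : Fintype.card {i // ¬ s i} < Fintype.card κ) (c : ℝ) :
    gaussianEntries (0 : Matrix m κ ℝ) {X | c ≤ minEigenvalue (wishart X)}
      ≤ chiSq n (Set.Ici c) := by
  have : Nonempty κ := Fintype.card_pos_iff.1 (Nat.zero_lt_of_lt hcard)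
  have hcont := continuous_minEigenvalue_wishart (ι := κ) (m := m)
  set ν : Measure (κ → ℝ) := Measure.pi fun _ => gaussianReal 0 1 with hν
  have hmp := measurePreserving_piEquivPiSubtypeProd (fun _ : m => ν) s
  set E := MeasurableEquiv.piEquivPiSubtypeProd (fun _ : m => κ → ℝ) s with hE
  have hA : MeasurableSet {X : m → κ → ℝ | c ≤ minEigenvalue (wishart X)} :=
    measurableSet_le measurable_const hcont.measurable
  have hB : MeasurableSet (E.symm ⁻¹' {X | c ≤ minEigenvalue (wishart X)}) :=
    E.symm.measurable hA
  have hpi : gaussianEntries (0 : Matrix m κ ℝ) = Measure.pi fun _ : m => ν := rfl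
  have hAB : {X : m → κ → ℝ | c ≤ minEigenvalue (wishart X)}
      = E ⁻¹' (E.symm ⁻¹' {X | c ≤ minEigenvalue (wishart X)}) := by
    rw [← Set.preimage_comp, E.symm_comp_self, Set.preimage_id]
  rw [hpi, hAB, hmp.measure_preimage hB.nullMeasurableSet, Measure.prod_apply_symm hB]
  calc _ ≤ ∫⁻ _, chiSq n (Set.Ici c) ∂(Measure.pi fun _ : {i // ¬ s i} => ν) := by
        refine lintegral_mono fun b => ?_
        -- Condition on the rows `b` outside `s`, which are too few to span. Then `u` depends on `b`
        -- alone, so the remaining rows tested against `u` are independent standard normal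
        -- variables.
        obtain ⟨u, hu1, hu0⟩ := exists_orthogonal_unit hcard (Matrix.of b)
        have hd : Continuous fun z : κ → ℝ => z ⬝ᵥ u := continuous_id.dotProduct continuous_const
        have hmap : (Measure.pi fun _ : {i // s i} => ν).map (fun a i => a i ⬝ᵥ u)
            = Measure.pi fun _ => gaussianReal 0 1 := by
          have hl := map_dotProduct_pi_gaussianReal u hu1
          have hsf : ∀ _ : {i // s i}, SigmaFinite (ν.map fun z => z ⬝ᵥ u) := fun _ => by
            rw [hl]; infer_instance
          rw [Measure.pi_map_pi (f := fun _ : {i // s i} => fun z : κ → ℝ => z ⬝ᵥ u)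
            fun _ => hd.measurable.aemeasurable]
          simp_rw [hν, hl]
        have hdm : Measurable fun (a : {i // s i} → κ → ℝ) i => a i ⬝ᵥ u :=
          measurable_pi_lambda _ fun i => hd.measurable.comp (measurable_pi_apply i)
        rw [← weightedChiSq_one_eq_chiSq e, weightedChiSq, ← hmap,
          Measure.map_map (continuous_sum_mul_sq _).measurable hdm,
          Measure.map_apply ((continuous_sum_mul_sq _).measurable.comp hdm) measurableSet_Ici]
        refine measure_mono fun a ha => ?_
        replace ha : c ≤ minEigenvalue (wishart (E.symm (a, b))) := ha
        have h1 := minEigenvalue_mul_le (isHermitian_wishart (E.symm (a, b))) u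
        rw [hu1, mul_one, dotProduct_wishart] at h1
        refine (ha.trans h1).trans_eq ?_
        have h2 : ∀ i (h : s i), E.symm (a, b) i = a ⟨i, h⟩ := fun i h => dif_pos h
        have h3 : ∀ i (h : ¬ s i), E.symm (a, b) i = b ⟨i, h⟩ := fun i h => dif_neg h
        rw [dotProduct, ← Fintype.sum_subtype_add_sum_subtype s]
        have h4 : ∑ i : {i // ¬ s i}, (Matrix.of (E.symm (a, b)) *ᵥ u) i *
            (Matrix.of (E.symm (a, b)) *ᵥ u) i = 0 := by
          refine Finset.sum_eq_zero fun i _ => ?_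
          have : (Matrix.of (E.symm (a, b)) *ᵥ u) i = (Matrix.of b *ᵥ u) i := by
            simp only [mulVec, of_apply]
            rw [h3 i.1 i.2]
          rw [this, hu0]
          simp
        rw [h4, add_zero]
        refine Finset.sum_congr rfl fun i _ => ?_
        have : (Matrix.of (E.symm (a, b)) *ᵥ u) i = a i ⬝ᵥ u := by
          simp only [mulVec, of_apply]
          rw [h2 i.1 i.2]
        rw [this]
        simp only [one_mul]
        ring
    _ = chiSq n (Set.Ici c) := by simp

/-- Near the zero matrix the smallest eigenvalue is below `c`, and a nondegenerate Gaussian law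
charges every nonempty open set, whatever its mean. -/
lemma gaussianEntries_minEigenvalue_lt_one [Nonempty κ] (M : Matrix m κ ℝ) {c : ℝ} (hc : 0 < c) :
    gaussianEntries M {X | c ≤ minEigenvalue (wishart X)} < 1 := by
  have hcont := continuous_minEigenvalue_wishart (ι := κ) (m := m)
  have hopen : IsOpen {X : m → κ → ℝ | minEigenvalue (wishart X) < c} :=
    isOpen_lt hcont continuous_const
  have hne : {X : m → κ → ℝ | minEigenvalue (wishart X) < c}.Nonempty := by
    refine ⟨0, ?_⟩
    have h1 := minEigenvalue_mul_le (isHermitian_wishart (0 : m → κ → ℝ)) fun _ => 1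
    rw [dotProduct_wishart] at h1
    have h2 : Matrix.of (0 : m → κ → ℝ) *ᵥ (fun _ : κ => (1 : ℝ)) = 0 := zero_mulVec _
    rw [h2, dotProduct_zero] at h1
    have h3 : (0 : ℝ) < (fun _ : κ => (1 : ℝ)) ⬝ᵥ fun _ => 1 := by
      simp [dotProduct, Fintype.card_pos]
    exact lt_of_le_of_lt (nonpos_of_mul_nonpos_left h1 h3) hc
  have := isOpenPosMeasure_gaussianEntries M
  have hpos := hopen.measure_pos (gaussianEntries M) hne
  have hcompl : {X : m → κ → ℝ | c ≤ minEigenvalue (wishart X)}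
      = {X : m → κ → ℝ | minEigenvalue (wishart X) < c}ᶜ := by
    ext; simp
  rw [hcompl, prob_compl_eq_one_sub hopen.measurableSet]
  exact ENNReal.sub_lt_self ENNReal.one_ne_top one_ne_zero hpos.ne'

end Wishart

/-! ### Symmetric inverse square roots -/

section Whitening

variable {n : Type*} [Fintype n] [DecidableEq n]

lemma transpose_sqrt_inv (S : Matrix n n ℝ) : (CFC.sqrt S⁻¹)ᵀ = CFC.sqrt S⁻¹ := by
  rw [← conjTranspose_eq_transpose_of_trivial]
  exact (IsSelfAdjoint.of_nonneg (CFC.sqrt_nonneg _)).star_eq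

lemma sqrt_inv_mul_mul_sqrt_inv {S : Matrix n n ℝ} (hS : S.PosDef) :
    CFC.sqrt S⁻¹ * S * CFC.sqrt S⁻¹ = 1 := by
  have h1 : CFC.sqrt S⁻¹ * CFC.sqrt S⁻¹ = S⁻¹ :=
    CFC.sqrt_mul_sqrt_self _ hS.inv.posSemidef.nonneg
  have hu : IsUnit S.det := (isUnit_iff_isUnit_det _).1 hS.isUnit
  rw [mul_eq_one_comm, ← Matrix.mul_assoc, h1, nonsing_inv_mul _ hu]

end Whitening

/-! ### Strong and weak directions in the two models -/

section Bases

variable {N p : ℕ}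

/-- `Cw` parametrizes the kernel of `H` and `Cs` a complement, on which `H` is injective; `As` and
`Aw` are the coordinates of the two projections. -/
lemma exists_ker_splitting {n N k : ℕ} (H : Matrix (Fin N) (Fin n) ℝ) (hk : H.rank + k = n) :
    ∃ (Cs : Matrix (Fin n) (Fin (n - k)) ℝ) (Cw : Matrix (Fin n) (Fin k) ℝ)
      (As : Matrix (Fin (n - k)) (Fin n) ℝ) (Aw : Matrix (Fin k) (Fin n) ℝ),
      Cs * As + Cw * Aw = 1 ∧ (∀ c, Cw *ᵥ c = 0 → c = 0) ∧ H * Cw = 0 ∧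
      ∀ c, (H * Cs) *ᵥ c = 0 → c = 0 := by
  set K := LinearMap.ker H.mulVecLin with hK
  obtain ⟨K', hKK'⟩ := K.exists_isCompl
  have hrank : H.rank + Module.finrank ℝ K = n := by
    have := H.mulVecLin.finrank_range_add_finrank_ker
    rwa [Module.finrank_fin_fun] at this
  have hf : Module.finrank ℝ K = k := by omega
  have hf' : Module.finrank ℝ K' = n - k := by
    have := Submodule.finrank_add_eq_of_isCompl hKK'
    rw [Module.finrank_fin_fun] at this
    omega
  let f : (Fin k → ℝ) ≃ₗ[ℝ] K := LinearEquiv.ofFinrankEq _ _ (by rw [Module.finrank_fin_fun, hf])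
  let f' : (Fin (n - k) → ℝ) ≃ₗ[ℝ] K' :=
    LinearEquiv.ofFinrankEq _ _ (by rw [Module.finrank_fin_fun, hf'])
  let cw : (Fin k → ℝ) →ₗ[ℝ] (Fin n → ℝ) := K.subtype ∘ₗ f.toLinearMap
  let cs : (Fin (n - k) → ℝ) →ₗ[ℝ] (Fin n → ℝ) := K'.subtype ∘ₗ f'.toLinearMap
  let aw : (Fin n → ℝ) →ₗ[ℝ] (Fin k → ℝ) := f.symm.toLinearMap ∘ₗ K.projectionOnto K' hKK'
  let as : (Fin n → ℝ) →ₗ[ℝ] (Fin (n - k) → ℝ) :=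
    f'.symm.toLinearMap ∘ₗ K'.projectionOnto K hKK'.symm
  have hHw : ∀ c, H *ᵥ cw c = 0 := fun c => (f c).2
  have hws : cs ∘ₗ as + cw ∘ₗ aw = LinearMap.id := by
    refine LinearMap.ext fun v => ?_
    have h := Submodule.projection_add_projection_eq_self hKK'.symm v
    simpa [cs, as, cw, aw] using h
  refine ⟨LinearMap.toMatrix' cs, LinearMap.toMatrix' cw, LinearMap.toMatrix' as,
    LinearMap.toMatrix' aw, ?_, fun c hc => ?_, ?_, fun c hc => ?_⟩
  · rw [← LinearMap.toMatrix'_comp, ← LinearMap.toMatrix'_comp, ← map_add, hws,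
      LinearMap.toMatrix'_id]
  · rw [LinearMap.toMatrix'_mulVec] at hc
    exact f.map_eq_zero_iff.1 (Subtype.ext hc)
  · refine Matrix.toLin'.injective (LinearMap.ext fun c => ?_)
    rw [toLin'_apply, ← mulVec_mulVec, LinearMap.toMatrix'_mulVec, hHw]
    simp
  · rw [← mulVec_mulVec, LinearMap.toMatrix'_mulVec] at hc
    have h1 : cs c ∈ K := hc
    have h2 : cs c ∈ K' := (f' c).2
    have h3 : cs c = 0 := Submodule.disjoint_def.1 hKK'.disjoint _ h1 h2
    exact f'.map_eq_zero_iff.1 (Subtype.ext h3)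

lemma weakLimit_of_eq {k : ℕ} {q : ℕ → Matrix (Fin N) (Fin (p + 1)) ℝ}
    {H : Matrix (Fin N) (Fin (p + 2)) ℝ} (hH : ∀ T, Hof (q T) = H) (hk : H.rank + k = p + 2) :
    ∃ (Cs : Matrix (Fin (p + 2)) (Fin (p + 2 - k)) ℝ) (Cw : Matrix (Fin (p + 2)) (Fin k) ℝ)
      (As : Matrix (Fin (p + 2 - k)) (Fin (p + 2)) ℝ) (Aw : Matrix (Fin k) (Fin (p + 2)) ℝ),
      WeakLimit q Cs Cw As Aw (H * Cs) 0 := by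
  obtain ⟨Cs, Cw, As, Aw, h1, h2, h3, h4⟩ := exists_ker_splitting H hk
  refine ⟨Cs, Cw, As, Aw, h1, h2, ?_, ?_, h4⟩
  · simp only [hH, tendsto_const_nhds]
  · simp only [hH, h3, smul_zero, tendsto_const_nhds]

/-- The columns of the identity matrix that select the strongly identified coordinates. -/
def strongCols (p k : ℕ) : Matrix (Fin (p + 2)) (Strong p k) ℝ :=
  (1 : Matrix (Fin (p + 2)) (Fin (p + 2)) ℝ).submatrix id Subtype.val

/-- The columns of the identity matrix that select the weakly identified coordinates. -/
def weakCols (p k : ℕ) : Matrix (Fin (p + 2)) (Weak p k) ℝ :=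
  (1 : Matrix (Fin (p + 2)) (Fin (p + 2)) ℝ).submatrix id fun j => j.val.succ

lemma strongCols_apply {k : ℕ} (i : Fin (p + 2)) (j : Strong p k) :
    strongCols p k i j = if i = j.val then 1 else 0 := by
  simp only [strongCols, submatrix_apply, id_eq, one_apply]

lemma weakCols_apply {k : ℕ} (i : Fin (p + 2)) (j : Weak p k) :
    weakCols p k i j = if i = j.val.succ then 1 else 0 := by
  simp only [weakCols, submatrix_apply, id_eq, one_apply]

lemma mul_strongCols {k : ℕ} (A : Matrix (Fin N) (Fin (p + 2)) ℝ) :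
    A * strongCols p k = A.submatrix id Subtype.val :=
  mul_submatrix_one (Equiv.refl _) _ A

lemma mul_weakCols {k : ℕ} (A : Matrix (Fin N) (Fin (p + 2)) ℝ) :
    A * weakCols p k = A.submatrix id fun j => j.val.succ :=
  mul_submatrix_one (Equiv.refl _) _ A

lemma tailRows_weakCols (p k : ℕ) : tailRows (weakCols p k) =
    (1 : Matrix (Fin (p + 1)) (Fin (p + 1)) ℝ).submatrix id Subtype.val := by
  ext i j
  simp [tailRows, weakCols, one_apply]

lemma transpose_tailRows_weakCols_mul (k : ℕ) (Q : Matrix (Fin (p + 1)) (Fin (p + 1)) ℝ) :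
    (tailRows (weakCols p k))ᵀ * Q * tailRows (weakCols p k)
      = Q.submatrix Subtype.val Subtype.val := by
  have h1 : (tailRows (weakCols p k))ᵀ * Q = Q.submatrix Subtype.val id := by
    rw [tailRows_weakCols, transpose_submatrix, transpose_one]
    exact one_submatrix_mul _ (Equiv.refl _) Q
  rw [h1, tailRows_weakCols]
  exact mul_submatrix_one (Equiv.refl _) _ _

lemma strongCols_weakCols_complete {k : ℕ} (hk : k ≤ p + 1) :
    strongCols p k * (strongCols p k)ᵀ + weakCols p k * (weakCols p k)ᵀ = 1 := by
  ext i i'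
  simp only [Matrix.add_apply, mul_apply, transpose_apply, strongCols_apply, weakCols_apply]
  rw [one_apply]
  by_cases hi : (i : ℕ) < p + 2 - k
  · have h2 : ∑ j : Weak p k, (if i = j.val.succ then (1 : ℝ) else 0) *
        (if i' = j.val.succ then 1 else 0) = 0 := by
      refine Finset.sum_eq_zero fun j _ => ?_
      have : i ≠ j.val.succ := by
        rintro rfl
        have := j.2
        rw [Fin.val_succ] at hi
        omega
      rw [if_neg this, zero_mul]
    rw [h2, add_zero, Finset.sum_eq_single_of_mem (⟨i, hi⟩ : Strong p k) (Finset.mem_univ _)]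
    · simp [eq_comm]
    · intro j _ hj
      have : i ≠ j.val := fun h => hj (Subtype.ext h.symm)
      rw [if_neg this, zero_mul]
  · have hi0 : i ≠ 0 := by
      rintro rfl
      apply hi
      rw [Fin.val_zero]
      omega
    obtain ⟨j, rfl⟩ := Fin.exists_succ_eq.2 hi0
    have hj : p + 1 - k ≤ (j : ℕ) := by
      rw [Fin.val_succ] at hi
      omega
    have h2 : ∑ j' : Strong p k, (if j.succ = j'.val then (1 : ℝ) else 0) *
        (if i' = j'.val then 1 else 0) = 0 := by
      refine Finset.sum_eq_zero fun j' _ => ?_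
      have : j.succ ≠ j'.val := fun h => hi (h ▸ j'.2)
      rw [if_neg this, zero_mul]
    rw [h2, zero_add, Finset.sum_eq_single_of_mem (⟨j, hj⟩ : Weak p k) (Finset.mem_univ _)]
    · simp [eq_comm]
    · intro j' _ hj'
      have : j.succ ≠ j'.val.succ := fun h => hj' (Subtype.ext (Fin.succ_injective _ h).symm)
      rw [if_neg this, zero_mul]

variable {k : ℕ} {q : ℕ → Matrix (Fin N) (Fin (p + 1)) ℝ} {L : Matrix (Fin N) (Fin (p + 2)) ℝ}

/-- If `k > p + 1`, the column `ι` of `H` would itself be scaled by `√T`, and its entries would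
diverge. -/
lemma le_of_tendsto_Hof_mul_Qx (hN : 0 < N)
    (hL : Tendsto (fun T => Hof (q T) * Qx p k T) atTop (𝓝 L)) :
    k ≤ p + 1 := by
  by_contra! hk
  have h1 : Tendsto (fun T => (Hof (q T) * Qx p k T) ⟨0, hN⟩ 0) atTop (𝓝 (L ⟨0, hN⟩ 0)) :=
    tendsto_pi_nhds.1 (tendsto_pi_nhds.1 hL _) _
  have h2 : ∀ T : ℕ, (Hof (q T) * Qx p k T) ⟨0, hN⟩ 0 = √(T : ℝ) := by
    intro T
    have h0 : p + 2 - k = 0 := by omega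
    rw [Qx, mul_diagonal, h0]
    simp [Hof]
  simp_rw [h2] at h1
  exact not_tendsto_nhds_of_tendsto_atTop
    (Real.tendsto_sqrt_atTop.comp tendsto_natCast_atTop_atTop) _ h1

lemma weakLimit_of_tendsto_Qx (hk : k ≤ p + 1)
    (hL : Tendsto (fun T => Hof (q T) * Qx p k T) atTop (𝓝 L)) (hLL : (Lᵀ * L).PosDef) :
    WeakLimit q (strongCols p k) (weakCols p k) (strongCols p k)ᵀ (weakCols p k)ᵀ
      (L.submatrix id Subtype.val) (L.submatrix id fun j => j.val.succ) where
  complete := strongCols_weakCols_complete hk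
  injective c hc := by
    ext j
    have h1 := congrFun hc j.val.succ
    rw [mulVec, dotProduct, Finset.sum_eq_single_of_mem j (Finset.mem_univ _)] at h1
    · simpa [weakCols_apply] using h1
    · intro j' _ hj'
      have : j.val.succ ≠ j'.val.succ := fun h => hj' (Subtype.ext (Fin.succ_injective _ h).symm)
      rw [weakCols_apply, if_neg this, zero_mul]
  strong := by
    refine tendsto_pi_nhds.2 fun i => tendsto_pi_nhds.2 fun j => ?_
    refine (tendsto_pi_nhds.1 (tendsto_pi_nhds.1 hL i) j.val).congr fun T => ?_
    rw [Qx, mul_diagonal, if_pos j.2, mul_one, mul_strongCols]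
    rfl
  weak := by
    refine tendsto_pi_nhds.2 fun i => tendsto_pi_nhds.2 fun j => ?_
    refine (tendsto_pi_nhds.1 (tendsto_pi_nhds.1 hL i) j.val.succ).congr fun T => ?_
    have hj : ¬ ((j.val.succ : Fin (p + 2)) : ℕ) < p + 2 - k := by
      have := j.2
      rw [Fin.val_succ]
      omega
    rw [Qx, mul_diagonal, if_neg hj, mul_weakCols, mul_comm]
    rfl
  full c hc := by
    rw [← mul_strongCols, ← mulVec_mulVec] at hc
    have h0 : strongCols p k *ᵥ c = 0 := by
      by_contra hne
      have := hLL.dotProduct_mulVec_pos hne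
      rw [← mulVec_mulVec, hc, mulVec_zero, dotProduct_zero] at this
      exact lt_irrefl _ this
    ext j
    have h1 := congrFun h0 j.val
    rw [mulVec, dotProduct, Finset.sum_eq_single_of_mem j (Finset.mem_univ _)] at h1
    · simpa [strongCols_apply] using h1
    · intro j' _ hj'
      have : j.val ≠ j'.val := fun h => hj' (Subtype.ext h.symm)
      rw [strongCols_apply, if_neg this, zero_mul]

/-- Weak columns converge after multiplication by `√T`, so they vanish in the limit. The power
argument needs only that `q` has a limit, not that it is identified. -/
lemma tendsto_of_tendsto_Hof_mul_Qx
    (hL : Tendsto (fun T => Hof (q T) * Qx p k T) atTop (𝓝 L)) :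
    Tendsto q atTop (𝓝 (Matrix.of fun i (j : Fin (p + 1)) =>
      if (j.succ : ℕ) < p + 2 - k then L i j.succ else 0)) := by
  refine tendsto_pi_nhds.2 fun i => tendsto_pi_nhds.2 fun j => ?_
  have h1 : Tendsto (fun T => (Hof (q T) * Qx p k T) i j.succ) atTop (𝓝 (L i j.succ)) :=
    tendsto_pi_nhds.1 (tendsto_pi_nhds.1 hL i) j.succ
  rw [of_apply]
  split_ifs with hj
  · refine h1.congr fun T => ?_
    rw [Qx, mul_diagonal, if_pos hj, mul_one]
    rfl
  · have h2 := (tendsto_inv_sqrt (T := id) tendsto_id).mul h1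
    rw [zero_mul] at h2
    refine h2.congr' ?_
    filter_upwards [eventually_gt_atTop 0] with T hT
    have hs : √(T : ℝ) ≠ 0 := by positivity
    rw [Qx, mul_diagonal, if_neg hj, id, mul_comm, mul_assoc, mul_inv_cancel₀ hs, mul_one]
    rfl

end Bases

lemma limsup_measure_le_of_tendstoInDistribution {Ω Ω' : Type*} [MeasurableSpace Ω]
    [MeasurableSpace Ω'] {P : Measure Ω} [IsProbabilityMeasure P] {P' : Measure Ω'}
    [IsProbabilityMeasure P'] {W : ℕ → Ω → ℝ} {w : Ω' → ℝ}
    (h : TendstoInDistribution W atTop w (fun _ => P) P') (x : ℝ) :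
    limsup (fun T => P {ω | x ≤ W T ω}) atTop ≤ P' {ω | x ≤ w ω} := by
  have h1 := ProbabilityMeasure.limsup_measure_closed_le_of_tendsto h.tendsto
    (isClosed_Ici (a := x))
  simp only [ProbabilityMeasure.coe_mk] at h1
  rw [Measure.map_apply_of_aemeasurable h.aemeasurable_limit measurableSet_Ici] at h1
  simp_rw [fun T => Measure.map_apply_of_aemeasurable (h.forall_aemeasurable T)
    (measurableSet_Ici (a := x))] at h1
  exact h1

end HJSpec

end

/-! ### Assembly of the unidentified and weakly identified cases -/

open MeasureTheory ProbabilityTheory Filter Topology Matrix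
open scoped ENNReal Kronecker MatrixOrder
theorem mainTheorem4
    {Ω : Type*} [MeasurableSpace Ω] (P : Measure Ω) [IsProbabilityMeasure P]
    -- `N` returns and `p` proxies; `K = p + 1` is the dimension of `G = (1, g')'`
    (N p : ℕ) (hN : p + 1 < N)
    (r : ℕ → ℕ → Ω → Fin N → ℝ) (g : ℕ → ℕ → Ω → Fin p → ℝ)
    (hdata : ∀ T, HJSpec.StationaryData P (r T) (g T))
    (Q : Matrix (Fin (p + 1)) (Fin (p + 1)) ℝ) (Sig : Matrix (Fin N) (Fin N) ℝ)
    (hpsi : HJSpec.HomoskedasticLimit P r g Q Sig)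
    (V : (Fin (p + 1) → ℝ) → Matrix (Fin N) (Fin N) ℝ)
    (hV : HJSpec.ConsistentVariance P r g V)
    (Θ : Set (Fin (p + 1) → ℝ)) (hΘ : IsCompact Θ)
    (hmis : ∃ a : ℝ, 0 < a ∧ ∀ T, ∀ θ ∈ Θ,
      a < ‖WithLp.toLp 2 (HJSpec.errPop P (r T) (g T) θ)‖)
    (α α₁ α₂ : ℝ) (hα : α ∈ Set.Ioo (0 : ℝ) 1) (hα₁ : α₁ ∈ Set.Ioo (0 : ℝ) 1)
    (hα₂ : α₂ ∈ Set.Ioo (0 : ℝ) 1) (hαs : (1 - α₁) * (1 - α₂) = 1 - α) :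
    -- (i) unidentified model
    (∀ k : ℕ, 1 ≤ k → ∀ H : Matrix (Fin N) (Fin (p + 2)) ℝ,
      (∀ T, HJSpec.Hmat P (r T) (g T) = H) → H.rank + k = p + 2 →
      (∀ x : ℝ,
        limsup (fun T : ℕ => P {ω | x ≤ HJSpec.Jstat (fun t => r T t ω) (fun t => g T t ω) T}) atTop
          ≤ HJSpec.gaussianEntries (0 : Matrix (Fin (N - (p + 1) - 1 + k)) (Fin k) ℝ)
              {X | x ≤ HJSpec.minEigenvalue (HJSpec.wishart X)}) ∧
      limsup (fun T : ℕ => P {ω | HJSpec.quantile (HJSpec.chiSq (N - (p + 1))) (1 - α)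
          ≤ HJSpec.Jstat (fun t => r T t ω) (fun t => g T t ω) T}) atTop ≤ ENNReal.ofReal α ∧
      liminf (fun T : ℕ => P {ω |
          HJSpec.HJSRejects Θ α₁ α₂ (fun t => r T t ω) (fun t => g T t ω) T}) atTop = 1) ∧
    -- (ii) weakly identified model
    (∀ k : ℕ, 1 ≤ k → ∀ L : Matrix (Fin N) (Fin (p + 2)) ℝ,
      Tendsto (fun T : ℕ => HJSpec.Hmat P (r T) (g T) * HJSpec.Qx p k T) atTop (𝓝 L) →
      (Lᵀ * L).PosDef →
      (∃ M : Matrix (Fin (N - (p + 1) - 1 + k)) (HJSpec.Weak p k) ℝ,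
        Mᵀ * M = HJSpec.noncentrality k Q Sig L) ∧
      (∀ M : Matrix (Fin (N - (p + 1) - 1 + k)) (HJSpec.Weak p k) ℝ,
        Mᵀ * M = HJSpec.noncentrality k Q Sig L →
        TendstoInDistribution
          (fun (T : ℕ) ω => HJSpec.Jstat (fun t => r T t ω) (fun t => g T t ω) T) atTop
          (fun X => HJSpec.minEigenvalue (HJSpec.wishart X)) (fun _ => P)
          (HJSpec.gaussianEntries M)) ∧
      liminf (fun T : ℕ => P {ω | HJSpec.quantile (HJSpec.chiSq (N - (p + 1))) (1 - α)
          ≤ HJSpec.Jstat (fun t => r T t ω) (fun t => g T t ω) T}) atTop < 1 ∧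
      liminf (fun T : ℕ => P {ω |
          HJSpec.HJSRejects Θ α₁ α₂ (fun t => r T t ω) (fun t => g T t ω) T}) atTop = 1) := by
  have hN0 : 0 < N := by omega
  obtain ⟨n, hn⟩ : ∃ n, N - (p + 1) = n + 1 := ⟨N - (p + 1) - 1, by omega⟩
  have hc := HJSpec.quantile_chiSq_pos n (p := 1 - α) (by linarith [hα.2]) (by linarith [hα.1])
  rw [← hn] at hc
  have hR : CFC.sqrt Sig⁻¹ * Sig * (CFC.sqrt Sig⁻¹)ᵀ = 1 := by
    rw [HJSpec.transpose_sqrt_inv, HJSpec.sqrt_inv_mul_mul_sqrt_inv hpsi.posDef_Sig]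
  refine ⟨fun k hk H hH hrank => ?_, fun k hk L hL hLL => ?_⟩
  · have : Nonempty (Fin k) := ⟨⟨0, hk⟩⟩
    obtain ⟨Cs, Cw, As, Aw, hW⟩ := HJSpec.weakLimit_of_eq (q := fun T => HJSpec.qPop P (r T) (g T))
      hH hrank
    have hS : ((HJSpec.tailRows Cw)ᵀ * Q * HJSpec.tailRows Cw).PosDef := by
      have hinj : Function.Injective (HJSpec.tailRows Cw).mulVec :=
        (injective_iff_map_eq_zero (HJSpec.tailRows Cw).mulVecLin).2
          fun z hz => hW.tailRows_injective hN0 hz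
      simpa using hpsi.posDef_Q.conjTranspose_mul_mul_same hinj
    have hlim := HJSpec.tendstoInDistribution_Jstat (m := N - (p + 1) - 1 + k) hdata hpsi hV hN0 hW
      (by rw [Fintype.card_fin]; omega) hR
      (by rw [HJSpec.transpose_sqrt_inv, HJSpec.sqrt_inv_mul_mul_sqrt_inv hS]) (M := 0) (by simp)
    have hdom := HJSpec.limsup_measure_le_of_tendstoInDistribution hlim
    refine ⟨hdom, ?_, ?_⟩
    · refine (hdom _).trans ?_
      rw [hn]
      -- The `N - K - 1 + k` rows split into the first `N - K = n + 1` and `k - 1` others. The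
      -- latter cannot span the `k`-dimensional space, so `χ²` with `N - K` degrees of freedom
      -- dominates.
      refine (HJSpec.gaussianEntries_zero_minEigenvalue_le (n := n + 1)
        (fun i : Fin (n + 1 - 1 + k) => (i : ℕ) < n + 1) (Fintype.equivFinOfCardEq
          (Fintype.card_fin_lt_of_le (by omega))) ?_ _).trans
        (HJSpec.chiSq_Ici_quantile_le n hα.1 hα.2.le)
      rw [Fintype.card_subtype_compl, Fintype.card_fin_lt_of_le (by omega), Fintype.card_fin,
        Fintype.card_fin]
      omega
    · refine HJSpec.liminf_measure_HJSRejects hpsi hV hΘ hmis hα₂.1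
        (q := Matrix.of fun i j => H i j.succ) (tendsto_const_nhds.congr fun T => ?_)
      ext i j
      rw [← hH T]
      rfl
  · have hkp : k ≤ p + 1 := HJSpec.le_of_tendsto_Hof_mul_Qx hN0 hL
    have : Nonempty (HJSpec.Weak p k) := ⟨⟨Fin.last p, by rw [Fin.val_last]; omega⟩⟩
    have hW := HJSpec.weakLimit_of_tendsto_Qx hkp hL hLL
    have hm : N - (p + 1) - 1 + k + Fintype.card (HJSpec.Strong p k) = N := by
      rw [Fintype.card_fin_lt_of_le (by omega)]
      omega
    have hG : (CFC.sqrt (Q.submatrix Subtype.val Subtype.val :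
        Matrix (HJSpec.Weak p k) (HJSpec.Weak p k) ℝ)⁻¹)ᵀ *
        ((HJSpec.tailRows (HJSpec.weakCols p k))ᵀ * Q * HJSpec.tailRows (HJSpec.weakCols p k)) *
        CFC.sqrt (Q.submatrix Subtype.val Subtype.val :
          Matrix (HJSpec.Weak p k) (HJSpec.Weak p k) ℝ)⁻¹ = 1 := by
      rw [HJSpec.transpose_tailRows_weakCols_mul, HJSpec.transpose_sqrt_inv]
      exact HJSpec.sqrt_inv_mul_mul_sqrt_inv (hpsi.posDef_Q.submatrix Subtype.val_injective)
    have hlim : ∀ M : Matrix (Fin (N - (p + 1) - 1 + k)) (HJSpec.Weak p k) ℝ,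
        Mᵀ * M = HJSpec.noncentrality k Q Sig L → TendstoInDistribution
          (fun (T : ℕ) ω => HJSpec.Jstat (fun t => r T t ω) (fun t => g T t ω) T) atTop
          (fun X => HJSpec.minEigenvalue (HJSpec.wishart X)) (fun _ => P)
          (HJSpec.gaussianEntries M) := fun M hM =>
      HJSpec.tendstoInDistribution_Jstat hdata hpsi hV hN0 hW hm hR hG hM
    obtain ⟨M, hM⟩ : ∃ M : Matrix (Fin (N - (p + 1) - 1 + k)) (HJSpec.Weak p k) ℝ,
        Mᵀ * M = HJSpec.noncentrality k Q Sig L := by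
      obtain ⟨W, -, hW2⟩ := HJSpec.exists_mul_transpose_eq_one_of_annihilator
        (CFC.sqrt Sig⁻¹ * L.submatrix id (Subtype.val : HJSpec.Strong p k → Fin (p + 2)))
        (HJSpec.isUnit_det_gram hW.full
          (HJSpec.isUnit_det_of_mul_mul_transpose_eq_one hR).1) hm
      -- Compressing the whitened `L₂` by `W` turns its annihilator form into a Gram matrix with the
      -- required number of rows.
      refine ⟨W * (CFC.sqrt Sig⁻¹ * L.submatrix id (fun j : HJSpec.Weak p k => j.val.succ) *
        CFC.sqrt (Q.submatrix Subtype.val Subtype.val :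
          Matrix (HJSpec.Weak p k) (HJSpec.Weak p k) ℝ)⁻¹), ?_⟩
      rw [transpose_mul W, Matrix.mul_assoc _ Wᵀ, ← Matrix.mul_assoc Wᵀ, hW2, ← Matrix.mul_assoc]
      rfl
    refine ⟨⟨M, hM⟩, hlim, ?_, ?_⟩
    · refine (liminf_le_limsup).trans_lt
        ((HJSpec.limsup_measure_le_of_tendstoInDistribution (hlim M hM) _).trans_lt ?_)
      exact HJSpec.gaussianEntries_minEigenvalue_lt_one M hc
    · exact HJSpec.liminf_measure_HJSRejects hpsi hV hΘ hmis hα₂.1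
        (HJSpec.tendsto_of_tendsto_Hof_mul_Qx hL)
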